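/- Let $S$ be a connected Lie group with Lie algebra $\mathfrak s$, acting smoothly, freely and properly on a smooth manifold $M$; let $\pi:M\to M/S$ be the projection, where $M/S$ carries its standard smooth structure (the one for which $\pi$ is a submersion). Let $E\to M$ be an $S$-equivariant Courant algebroid (for the zero pairing on $\mathfrak s$): a Courant algebroid with pairing $\langle\cdot,\cdot\rangle$, anchor $\rho$ and bracket $[\cdot,\cdot]$, with $[u,v]+[v,u]=d_E\langle u,v\rangle$, together with a linear map $\chi:\mathfrak s\to\Gamma(E)$, injective at every point, such that $[\chi(u),\chi(v)]=\chi([u,v])$, $\langle\chi(u),\chi(v)\rangle=0$, and such that the infinitesimal actions $\rho(\chi(u))$ on $M$ and $[\chi(u),\cdot]$ on $E$ integrate to the action of $S$ on $M$ and to an action of $S$ on the vector bundle $E$ covering it. Put $\mathfrak s_E=\chi(\mathfrak s)\subset E$. Let $E_{/S}\to M/S$ be the reduced Courant algebroid, with fibre $\chi_x(\mathfrak s)^\perp/\chi_x(\mathfrak s)$ over $\pi(x)$ and with $\Gamma(E_{/S})=\Gamma(\mathfrak s_E^\perp)^{\mathfrak s}/\Gamma(\mathfrak s_E)^{\mathfrak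 s}$, its pairing, anchor and bracket being induced by those of $E$. Let $V_+\subset E$ be an admissible generalized pseudometric, i.e. a subbundle on which $\langle\cdot,\cdot\rangle$ is non-degenerate, which is $\mathfrak s$-invariant ($[\chi(u),\Gamma(V_+)]\subset\Gamma(V_+)$) and contained in $\mathfrak s_E^\perp$. Let $\mathrm{div}:\Gamma(E)\to C^\infty(M)$ be an equivariant divergence, i.e. an $\mathbb R$-linear map with $\mathrm{div}(fa)=f\,\mathrm{div}\,a+\rho(a)f$, $\rho(\chi(u))\,\mathrm{div}\,a=\mathrm{div}[\chi(u),a]$ and $\mathrm{div}\,\chi(u)=-\mathrm{Tr}_{\mathfrak s}\,\mathrm{ad}_u$ for all $u\in\mathfrak s$, $a\in\Gamma(E)$, $f\in C^\infty(M)$. Let $\tilde V_+\subset E_{/S}$ and $\widetilde{\mathrm{div}}$ be the induced generalized pseudometric and divergence. For a generalized pseudometric $V_+$ and a divergence $\mathrm{div}$ on a Courant algebroid $E$, the generalized scalar curvature is $$\mathcal R^E_{V_+,\mathrm{div}}=\sigma^{-1}\Delta_{V_+}\sigma+\langle e_+,e_+\rangle+2\,\mathrm{div}_{\sigma^2}e_+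 ,$$ where $\sigma$ is any nowhere vanishing half-density, $\mathrm{div}_{\mu}a=\mu^{-1}L_{\rho(a)}\mu$ for a density $\mu$, $e_+$ is the orthogonal projection to $V_+$ of the section $e$ with $\mathrm{div}-\mathrm{div}_{\sigma^2}=\langle e,\cdot\rangle$, and $$\Delta_{V_+}=4L_{\rho(e^a)}L_{\rho(e_a)}-\tfrac16 c_{abc}c^{abc}-\tfrac12c_{ab\bar c}c^{ab\bar c}$$ for any local basis $e_a$ of $V_+$ with constant $\langle e_a,e_b\rangle$ and dual basis $e^a$; here $c_{\alpha\beta\gamma}=\langle e_\alpha,[e_\beta,e_\gamma]\rangle$, barred indices refer to a local basis of $V_-=V_+^\perp$, and repeated indices are summed. Then $\mathcal R^{E}_{V_+,\mathrm{div}}$ and $\mathcal R^{E_{/S}}_{\tilde V_+,\widetilde{\mathrm{div}}}$ are well defined (independent of the choices of $\sigma$ and of the local basis), and $$\mathcal R^E_{V_+,\mathrm{div}}=\pi^*\,\mathcal R^{E_{/S}}_{\tilde V_+,\widetilde{\mathrm{div}}}.$$ -/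

import Mathlib

open Bundle Manifold
open scoped ContDiff Topology

noncomputable section

namespace GenScalar

/-! ### Densities of weight `s` and their Lie derivative

A density of weight `s` on an `m`-manifold `B` is encoded by the function `σ : B → ℝ` whose value
at `x` is its coefficient at `x` in the preferred chart at `x`, i.e. `σ = σ x • |dφₓ|^s` at `x`
(the same convention by which Mathlib writes tangent vectors at `x` as vectors of the model space).
A half-density is a density of weight `1/2`, a density is one of weight `1`. -/

section Density

variable {m : ℕ} {B : Type*} [TopologicalSpace B] [ChartedSpace (EuclideanSpace ℝ (Fin m)) B]

/-- The coefficient at `y` of the density `σ` in the chart `φ` at `x₀`: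
`σ = |det ∂φ_y/∂φ|^s σ(y) |dφ|^s` at `y`. -/
def densityCoeff (m : ℕ) {B : Type*} [TopologicalSpace B]
    [ChartedSpace (EuclideanSpace ℝ (Fin m)) B] [IsManifold (𝓡 m) 1 B] (s : ℝ) (σ : B → ℝ) (x₀ y : B) : ℝ :=
  |(tangentCoordChange (𝓡 m) x₀ y y).det| ^ s * σ y

/-- Smoothness of a density of weight `s`: smooth coefficients in charts. -/
def IsSmoothDensity (m : ℕ) {B : Type*} [TopologicalSpace B]
    [ChartedSpace (EuclideanSpace ℝ (Fin m)) B] [IsManifold (𝓡 m) 1 B] (s : ℝ) (σ : B → ℝ) : Prop :=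
  ∀ x₀ : B, ContMDiffAt (𝓡 m) 𝓘(ℝ, ℝ) ∞ (densityCoeff m s σ x₀) x₀

/-- The derivative `X f` of a function along a vector field, at `x`. -/
def vectorDeriv (X : ∀ x : B, TangentSpace (𝓡 m) x) (f : B → ℝ) (x : B) : ℝ :=
  mfderiv (𝓡 m) 𝓘(ℝ, ℝ) f x (X x)

/-- The divergence `∑ᵢ ∂Xⁱ/∂φⁱ` at `x` of a vector field, in the preferred chart `φ` at `x`. -/
def chartDiv [IsManifold (𝓡 m) 1 B] (X : ∀ x : B, TangentSpace (𝓡 m) x) (x : B) : ℝ :=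
  LinearMap.trace ℝ (EuclideanSpace ℝ (Fin m))
    (fderiv ℝ (fun z : EuclideanSpace ℝ (Fin m) =>
      tangentCoordChange (𝓡 m) ((extChartAt (𝓡 m) x).symm z) x ((extChartAt (𝓡 m) x).symm z)
        (X ((extChartAt (𝓡 m) x).symm z)))
      (extChartAt (𝓡 m) x x)).toLinearMap

/-- The Lie derivative of a density of weight `s`: in a chart, with `σ = f |dφ|^s`,
`L_X σ = (X f + s (∑ᵢ ∂Xⁱ/∂φⁱ) f) |dφ|^s`. -/
def lieDensity [IsManifold (𝓡 m) 1 B] (s : ℝ) (X : ∀ x : B, TangentSpace (𝓡 m) x)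
    (σ : B → ℝ) (x : B) : ℝ :=
  vectorDeriv X (densityCoeff m s σ x) x + s * chartDiv X x * σ x

end Density

/-! ### Courant algebroids -/

section Courant

variable {m : ℕ} {B : Type*} [TopologicalSpace B] [ChartedSpace (EuclideanSpace ℝ (Fin m)) B]

/-- The operations of a Courant algebroid with fibres `E b`: which sections are smooth, the pairing
and the anchor on the fibres, and the bracket of sections (relevant for smooth sections only). -/
structure CourantData (m : ℕ) {B : Type*} [TopologicalSpace B]
    [ChartedSpace (EuclideanSpace ℝ (Fin m)) B] (E : B → Type*)
    [∀ b, AddCommGroup (E b)] [∀ b, Module ℝ (E b)] where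
  IsSmooth : (∀ b, E b) → Prop
  pairing : ∀ b, LinearMap.BilinForm ℝ (E b)
  anchor : ∀ b, E b →ₗ[ℝ] TangentSpace (𝓡 m) b
  bracket : (∀ b, E b) → (∀ b, E b) → ∀ b, E b

section
variable {E : B → Type*} [∀ b, AddCommGroup (E b)] [∀ b, Module ℝ (E b)]

/-- `f u` for a function `f` and a section `u`. -/
def fsmul (f : B → ℝ) (u : ∀ b, E b) (b : B) : E b := f b • u b

namespace CourantData

/-- The function `⟨u, v⟩` for sections `u`, `v`. -/
def pair (D : CourantData m E) (u v : ∀ b, E b) (b : B) : ℝ := D.pairing b (u b) (v b)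

/-- The vector field `ρ(u)`. -/
def rho (D : CourantData m E) (u : ∀ b, E b) (b : B) : TangentSpace (𝓡 m) b := D.anchor b (u b)

/-- The function `u · f = ρ(u) f`. -/
def deriv (D : CourantData m E) (u : ∀ b, E b) (f : B → ℝ) (b : B) : ℝ :=
  vectorDeriv (D.rho u) f b

/-- `div : Γ(E) → C^∞(B)` is a divergence: `ℝ`-linear with `div (f a) = f div a + a · f`. -/
structure IsDivergence (D : CourantData m E) (div : (∀ b, E b) → B → ℝ) : Prop where
  contMDiff : ∀ a, D.IsSmooth a → ContMDiff (𝓡 m) 𝓘(ℝ, ℝ) ∞ (div a)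
  add : ∀ a b, D.IsSmooth a → D.IsSmooth b → div (a + b) = div a + div b
  smul : ∀ (c : ℝ) (a), D.IsSmooth a → div (c • a) = c • div a
  leibniz : ∀ (f : B → ℝ) (a), ContMDiff (𝓡 m) 𝓘(ℝ, ℝ) ∞ f → D.IsSmooth a →
    div (fsmul f a) = f * div a + D.deriv a f

/-- `V₊ ⊂ E` is a generalized pseudometric: a smooth subbundle on which the pairing is
non-degenerate. -/
structure IsGeneralizedPseudometric (D : CourantData m E) (V : ∀ b, Submodule ℝ (E b)) :
    Prop where
  subbundle : ∀ b, ∃ U : Set B, IsOpen U ∧ b ∈ U ∧ ∃ (n : ℕ) (e : Fin n → ∀ b, E b),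
    (∀ i, D.IsSmooth (e i)) ∧ ∀ y ∈ U, LinearIndependent ℝ (fun i => e i y) ∧
      Submodule.span ℝ (Set.range fun i => e i y) = V y
  nondegenerate : ∀ b, ∀ v ∈ V b, (∀ w ∈ V b, D.pairing b v w = 0) → v = 0

/-- `u` is a section of `V₊`. -/
def IsSectionOf (D : CourantData m E) (V : ∀ b, Submodule ℝ (E b)) (u : ∀ b, E b) : Prop :=
  D.IsSmooth u ∧ ∀ b, u b ∈ V b

/-! #### Generalized scalar curvature -/

/-- `e_a` is a local basis of `V₊` over the open set `U` with constant `⟨e_a, e_b⟩`, and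
`e^a` is the dual basis of `V₊`. (Local sections near a point are germs of global ones.) -/
structure IsFrame (D : CourantData m E) (V : ∀ b, Submodule ℝ (E b)) (U : Set B) {n : ℕ}
    (e e' : Fin n → ∀ b, E b) : Prop where
  isOpen : IsOpen U
  smooth : ∀ a, D.IsSmooth (e a)
  smooth_dual : ∀ a, D.IsSmooth (e' a)
  linearIndependent : ∀ y ∈ U, LinearIndependent ℝ (fun a => e a y)
  span : ∀ y ∈ U, Submodule.span ℝ (Set.range fun a => e a y) = V y
  const : ∀ y ∈ U, ∀ z ∈ U, ∀ a b, D.pair (e a) (e b) y = D.pair (e a) (e b) z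
  mem_dual : ∀ y ∈ U, ∀ a, e' a y ∈ V y
  dual : ∀ y ∈ U, ∀ a b, D.pair (e' a) (e b) y = if a = b then 1 else 0

/-- The component in `V₋ = V₊^⊥` of `w` : `w₋ = w - ∑ ⟨w, e_c⟩ e^c`. -/
def minusPart (D : CourantData m E) {n : ℕ} (e e' : Fin n → ∀ b, E b) (w : ∀ b, E b) (b : B) :
    E b :=
  w b - ∑ c, D.pairing b (w b) (e c b) • e' c b

/-- `c_{abc} c^{abc}`, where `c_{abc} = ⟨e_a, [e_b, e_c]⟩`. -/
def ccPlus (D : CourantData m E) {n : ℕ} (e e' : Fin n → ∀ b, E b) (x : B) : ℝ :=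
  ∑ a, ∑ b, ∑ c, D.pair (e a) (D.bracket (e b) (e c)) x *
    D.pair (e' a) (D.bracket (e' b) (e' c)) x

/-- `c_{ab c̄} c^{ab c̄} = ⟨[e_a, e_b]₋, [e^a, e^b]₋⟩`. -/
def ccMinus (D : CourantData m E) {n : ℕ} (e e' : Fin n → ∀ b, E b) (x : B) : ℝ :=
  ∑ a, ∑ b, D.pairing x (D.minusPart e e' (D.bracket (e a) (e b)) x)
    (D.minusPart e e' (D.bracket (e' a) (e' b)) x)

variable [IsManifold (𝓡 m) 1 B]

/-- The Laplacian on half-densities,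
`Δ σ = 4 L_{ρ(e^a)} L_{ρ(e_a)} σ - (1/6 c_{abc} c^{abc} + 1/2 c_{ab c̄} c^{ab c̄}) σ`. -/
def laplacian (D : CourantData m E) {n : ℕ} (e e' : Fin n → ∀ b, E b) (σ : B → ℝ) (x : B) : ℝ :=
  4 * (∑ a, lieDensity (1 / 2) (D.rho (e' a)) (lieDensity (1 / 2) (D.rho (e a)) σ) x)
    - 1 / 6 * D.ccPlus e e' x * σ x - 1 / 2 * D.ccMinus e e' x * σ x

/-- The divergence `div_μ a = μ⁻¹ L_{ρ(a)} μ` of a nowhere vanishing density `μ`. -/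
def divDensity (D : CourantData m E) (μ : B → ℝ) (a : ∀ b, E b) (x : B) : ℝ :=
  (μ x)⁻¹ * lieDensity 1 (D.rho a) μ x

/-- The choices in the definition of the generalized scalar curvature at `x`: a nowhere vanishing
half-density `σ`, a local basis of `V₊` on a neighbourhood `U` of `x`, and, over `U`, the section
`e₊` of `V₊`. Here `div - div_{σ²} = ⟨e, ·⟩` and `e₊` is the orthogonal projection of `e`, that is,
the section of `V₊` with `⟨e₊, a⟩ = div a - div_{σ²} a` for all sections `a` of `V₊`. -/
structure IsChoice (D : CourantData m E) (V : ∀ b, Submodule ℝ (E b))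
    (div : (∀ b, E b) → B → ℝ) (x : B) (σ : B → ℝ) (U : Set B) {n : ℕ}
    (e e' : Fin n → ∀ b, E b) (ePlus : ∀ b, E b) : Prop where
  smooth_density : IsSmoothDensity m (1 / 2) σ
  ne_zero : ∀ y, σ y ≠ 0
  mem : x ∈ U
  isFrame : D.IsFrame V U e e'
  smooth_ePlus : D.IsSmooth ePlus
  ePlus_mem : ∀ y ∈ U, ePlus y ∈ V y
  ePlus_pair : ∀ a, D.IsSectionOf V a → ∀ y ∈ U,
    D.pair ePlus a y = div a y - D.divDensity (σ ^ 2) a y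

/-- `σ⁻¹ Δ σ + ⟨e₊, e₊⟩ + 2 div_{σ²} e₊` at `x`. -/
def scalarValue (D : CourantData m E) (x : B) (σ : B → ℝ) {n : ℕ}
    (e e' : Fin n → ∀ b, E b) (ePlus : ∀ b, E b) : ℝ :=
  (σ x)⁻¹ * D.laplacian e e' σ x + D.pair ePlus ePlus x + 2 * D.divDensity (σ ^ 2) ePlus x

/-- `r` is the generalized scalar curvature of `(V₊, div)` at `x`: there are choices as above, and
each of them gives the value `r`. -/
def IsScalarCurvatureAt (D : CourantData m E) (V : ∀ b, Submodule ℝ (E b))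
    (div : (∀ b, E b) → B → ℝ) (x : B) (r : ℝ) : Prop :=
  (∃ (σ : B → ℝ) (U : Set B) (n : ℕ) (e e' : Fin n → ∀ b, E b) (ePlus : ∀ b, E b),
    D.IsChoice V div x σ U e e' ePlus) ∧
  ∀ (σ : B → ℝ) (U : Set B) (n : ℕ) (e e' : Fin n → ∀ b, E b) (ePlus : ∀ b, E b),
    D.IsChoice V div x σ U e e' ePlus → D.scalarValue x σ e e' ePlus = r

open Classical in
/-- The generalized scalar curvature `R_{V₊, div}`. -/
def scalarCurvature (D : CourantData m E) (V : ∀ b, Submodule ℝ (E b))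
    (div : (∀ b, E b) → B → ℝ) (x : B) : ℝ :=
  if h : ∃ r, D.IsScalarCurvatureAt V div x r then h.choose else 0

end CourantData

end

/-- `D` is a Courant algebroid on the smooth vector bundle `E → B` with typical fibre `F`.
The relation `[u, v] + [v, u] = d_E ⟨u, v⟩`, with `⟨d_E f, w⟩ = w · f`, is paired with `w`. -/
structure IsCourantAlgebroid [IsManifold (𝓡 m) 1 B] (F : Type*) [NormedAddCommGroup F] [NormedSpace ℝ F]
    {E : B → Type*} [TopologicalSpace (TotalSpace F E)] [∀ b, AddCommGroup (E b)]
    [∀ b, Module ℝ (E b)] [∀ b, TopologicalSpace (E b)] [FiberBundle F E] [VectorBundle ℝ F E]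
    (D : CourantData m E) : Prop where
  isSmooth_iff : ∀ a, D.IsSmooth a ↔
    ContMDiff (𝓡 m) ((𝓡 m).prod 𝓘(ℝ, F)) ∞ (fun b => TotalSpace.mk' F b (a b))
  pair_smooth : ∀ u v, D.IsSmooth u → D.IsSmooth v →
    ContMDiff (𝓡 m) 𝓘(ℝ, ℝ) ∞ (D.pair u v)
  pairing_symm : ∀ b v w, D.pairing b v w = D.pairing b w v
  pairing_nondegenerate : ∀ b v, (∀ w, D.pairing b v w = 0) → v = 0
  rho_smooth : ∀ u, D.IsSmooth u →
    ContMDiff (𝓡 m) (𝓡 m).tangent ∞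
      (fun b => (⟨b, D.rho u b⟩ : TangentBundle (𝓡 m) B))
  bracket_smooth : ∀ u v, D.IsSmooth u → D.IsSmooth v → D.IsSmooth (D.bracket u v)
  bracket_add_left : ∀ u v w, D.IsSmooth u → D.IsSmooth v → D.IsSmooth w →
    D.bracket (u + v) w = D.bracket u w + D.bracket v w
  bracket_add_right : ∀ u v w, D.IsSmooth u → D.IsSmooth v → D.IsSmooth w →
    D.bracket u (v + w) = D.bracket u v + D.bracket u w
  bracket_smul_left : ∀ (c : ℝ) (u v), D.IsSmooth u → D.IsSmooth v →
    D.bracket (c • u) v = c • D.bracket u v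
  bracket_smul_right : ∀ (c : ℝ) (u v), D.IsSmooth u → D.IsSmooth v →
    D.bracket u (c • v) = c • D.bracket u v
  jacobi : ∀ u v w, D.IsSmooth u → D.IsSmooth v → D.IsSmooth w →
    D.bracket u (D.bracket v w) = D.bracket (D.bracket u v) w + D.bracket v (D.bracket u w)
  leibniz : ∀ u (f : B → ℝ) v, D.IsSmooth u → ContMDiff (𝓡 m) 𝓘(ℝ, ℝ) ∞ f → D.IsSmooth v →
    D.bracket u (fsmul f v) = fsmul f (D.bracket u v) + fsmul (D.deriv u f) v
  deriv_pair : ∀ u v w, D.IsSmooth u → D.IsSmooth v → D.IsSmooth w →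
    D.deriv u (D.pair v w) = D.pair (D.bracket u v) w + D.pair v (D.bracket u w)
  bracket_add_swap : ∀ u v w, D.IsSmooth u → D.IsSmooth v → D.IsSmooth w →
    D.pair (D.bracket u v + D.bracket v u) w = D.deriv w (D.pair u v)

end Courant

/-! ### Equivariant Courant algebroids and their reduction -/

section Equivariant

variable {k m q : ℕ} {S : Type*} [Group S] [TopologicalSpace S]
  [ChartedSpace (EuclideanSpace ℝ (Fin k)) S]
  {M : Type*} [TopologicalSpace M] [ChartedSpace (EuclideanSpace ℝ (Fin m)) M] [MulAction S M]
  {F : Type*} [NormedAddCommGroup F] [NormedSpace ℝ F]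
  {E : M → Type*} [TopologicalSpace (TotalSpace F E)] [∀ x, AddCommGroup (E x)]
  [∀ x, Module ℝ (E x)] [∀ x, TopologicalSpace (E x)] [FiberBundle F E] [VectorBundle ℝ F E]

/-- An `S`-equivariant structure, for the zero pairing on the Lie algebra `𝔰` of `S`, on a Courant
algebroid `E → M`: a map `χ : 𝔰 → Γ(E)` with `[χ(u), χ(v)] = χ([u, v])` and `⟨χ(u), χ(v)⟩ = 0`,
injective at every point, and a smooth action of `S` on the vector bundle `E` over its action on `M`
that integrates the infinitesimal actions `ρ(χ(u))` on `M` and `[χ(u), ·]` on `E`, i.e.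
`d/dg (g⁻¹ • x)` is `ρ(χ(u))` at `x` and `d/dg (g • a(g⁻¹ • x))` is `[χ(u), a]` at `x`, where
the derivatives are at `g = 1` in the direction of `u`. -/
structure EquivariantStructure (k : ℕ) (S : Type*) [Group S] [TopologicalSpace S]
    [ChartedSpace (EuclideanSpace ℝ (Fin k)) S] [MulAction S M] (F : Type*)
    [NormedAddCommGroup F] [NormedSpace ℝ F] [TopologicalSpace (TotalSpace F E)]
    [FiberBundle F E] [VectorBundle ℝ F E] (D : CourantData m E) where
  χ : GroupLieAlgebra (𝓡 k) S →ₗ[ℝ] ∀ x, E x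
  χ_smooth : ∀ u, D.IsSmooth (χ u)
  χ_bracket : ∀ u v, D.bracket (χ u) (χ v) = χ ⁅u, v⁆
  χ_isotropic : ∀ u v x, D.pairing x (χ u x) (χ v x) = 0
  χ_injective : ∀ x, Function.Injective fun u => χ u x
  act : ∀ (g : S) (x : M), E x →ₗ[ℝ] E (g • x)
  act_one : ∀ x v, TotalSpace.mk' F ((1 : S) • x) (act 1 x v) = TotalSpace.mk' F x v
  act_mul : ∀ g h x v, TotalSpace.mk' F ((g * h) • x) (act (g * h) x v) =
    TotalSpace.mk' F (g • h • x) (act g (h • x) (act h x v))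
  act_smooth : ContMDiff ((𝓡 k).prod ((𝓡 m).prod 𝓘(ℝ, F))) ((𝓡 m).prod 𝓘(ℝ, F)) ∞
    (fun p : S × TotalSpace F E => TotalSpace.mk' F (p.1 • p.2.proj) (act p.1 p.2.proj p.2.snd))
  rho_χ : ∀ u x, (D.anchor x (χ u x) : EuclideanSpace ℝ (Fin m)) =
    mfderiv (𝓡 k) (𝓡 m) (fun g : S => g⁻¹ • x) 1 u
  bracket_χ : ∀ u a x, D.IsSmooth a →
    (trivializationAt F E x (TotalSpace.mk' F x (D.bracket (χ u) a x))).2 =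
      mfderiv (𝓡 k) 𝓘(ℝ, F) (fun g : S => (trivializationAt F E x
        (TotalSpace.mk' F (g • g⁻¹ • x) (act g (g⁻¹ • x) (a (g⁻¹ • x))))).2) 1 u

namespace EquivariantStructure

variable {D : CourantData m E} (X : EquivariantStructure k S F D)

/-- The fibre `χₓ(𝔰)` of the bundle `𝔰_E`. -/
def sFibre (x : M) : Submodule ℝ (E x) := LinearMap.range (LinearMap.proj x ∘ₗ X.χ)

/-- The fibre `χₓ(𝔰)^⊥` of the bundle `𝔰_E^⊥`. -/
def perpFibre (x : M) : Submodule ℝ (E x) where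
  carrier := {v | ∀ u, D.pairing x (X.χ u x) v = 0}
  add_mem' := by
    intro v w hv hw u
    rw [map_add, hv u, hw u, add_zero]
  zero_mem' := fun u => map_zero _
  smul_mem' := by
    intro c v hv u
    rw [map_smul, hv u, smul_zero]

/-- `V₊` is admissible: it is `𝔰`-invariant and contained in `𝔰_E^⊥`. -/
structure IsAdmissible (V : ∀ x, Submodule ℝ (E x)) : Prop where
  invariant : ∀ u a, D.IsSectionOf V a → D.IsSectionOf V (D.bracket (X.χ u) a)
  le_perp : ∀ x, V x ≤ X.perpFibre x

/-- `Tr_𝔰 ad_u`. -/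
def trAd (k : ℕ) (S : Type*) [Group S] [TopologicalSpace S]
    [ChartedSpace (EuclideanSpace ℝ (Fin k)) S] [LieGroup (𝓡 k) ∞ S]
    (u : GroupLieAlgebra (𝓡 k) S) : ℝ :=
  haveI : LieGroup (𝓡 k) (minSmoothness ℝ 3) S := by
    rw [minSmoothness_of_isRCLikeNormedField]
    infer_instance
  LinearMap.trace ℝ (GroupLieAlgebra (𝓡 k) S) (LieAlgebra.ad ℝ (GroupLieAlgebra (𝓡 k) S) u)

/-- The divergence `div` is equivariant: `χ(u) · div a = div [χ(u), a]` and
`div χ(u) = - Tr_𝔰 ad_u`. -/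
structure IsEquivariantDiv [LieGroup (𝓡 k) ∞ S] (div : (∀ x, E x) → M → ℝ) : Prop where
  equivariant : ∀ u a, D.IsSmooth a → D.deriv (X.χ u) (div a) = div (D.bracket (X.χ u) a)
  unimodular : ∀ u x, div (X.χ u) x = -trAd k S u

/-- `a ∈ Γ(𝔰_E^⊥)^𝔰`, an `𝔰`-invariant smooth section of `𝔰_E^⊥`. -/
structure IsInvariantPerp (a : ∀ x, E x) : Prop where
  smooth : D.IsSmooth a
  mem : ∀ x, a x ∈ X.perpFibre x
  invariant : ∀ u, D.bracket (X.χ u) a = 0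

/-- The orbit space `M/S`. -/
abbrev OrbitSpace (S M : Type*) [Group S] [MulAction S M] : Type _ :=
  MulAction.orbitRel.Quotient S M

/-- The projection `π : M → M/S` onto the orbit space. -/
def proj (S : Type*) {M : Type*} [Group S] [MulAction S M] (x : M) : OrbitSpace S M :=
  Quotient.mk _ x

/-- The fibre of `E_{/S}` at `b ∈ M/S` : the quotient `χₓ(𝔰)^⊥ / χₓ(𝔰)`, for a representative `x`
of the orbit `b` (the action of `S` identifies the quotients at the points of an orbit). -/
abbrev RedFibre (b : OrbitSpace S M) : Type _ :=
  X.perpFibre b.out ⧸ (X.sFibre b.out).submoduleOf (X.perpFibre b.out)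

/-- The section `a ∈ Γ(𝔰_E^⊥)^𝔰` represents the section `t` of `E_{/S}`. -/
def Represents (a : ∀ x, E x) (t : ∀ b : OrbitSpace S M, X.RedFibre b) : Prop :=
  ∃ h : X.IsInvariantPerp a, ∀ b, t b = Submodule.Quotient.mk ⟨a b.out, h.mem b.out⟩

open Classical in
/-- A section in `Γ(𝔰_E^⊥)^𝔰` representing the smooth section `t` of `E_{/S}`; it is unique up
to `Γ(𝔰_E)^𝔰`. -/
def lift (t : ∀ b : OrbitSpace S M, X.RedFibre b) : ∀ x, E x :=
  if h : ∃ a, X.Represents a t then h.choose else 0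

section Facts

variable [IsManifold (𝓡 m) 1 M]

theorem isInvariantPerp_zero (hD : IsCourantAlgebroid F D) : X.IsInvariantPerp 0 := by
  have h0 : (0 : ∀ x, E x) = (0 : ℝ) • X.χ 0 := by simp
  have hs : D.IsSmooth 0 := by
    have := X.χ_smooth 0
    rwa [map_zero] at this
  refine ⟨hs, fun x => (X.perpFibre x).zero_mem, fun u => ?_⟩
  have := hD.bracket_smul_right 0 (X.χ u) 0 (X.χ_smooth u) hs
  simpa using this

theorem isInvariantPerp_lift (hD : IsCourantAlgebroid F D)
    (t : ∀ b : OrbitSpace S M, X.RedFibre b) : X.IsInvariantPerp (X.lift t) := by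
  unfold lift
  split_ifs with h
  · exact h.choose_spec.choose
  · exact X.isInvariantPerp_zero hD

/-- `Γ(𝔰_E^⊥)^𝔰` is closed under the bracket, part of the descent of the bracket to `E_{/S}`. -/
theorem bracket_mem_perpFibre (hD : IsCourantAlgebroid F D) {a b : ∀ x, E x}
    (ha : X.IsInvariantPerp a) (hb : X.IsInvariantPerp b) (x : M) :
    D.bracket a b x ∈ X.perpFibre x := by
  intro u
  have hzero : ∀ c : ∀ x, E x, D.deriv c (0 : M → ℝ) = 0 := by
    intro c
    funext y
    simp only [CourantData.deriv, vectorDeriv]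
    have : mfderiv (𝓡 m) 𝓘(ℝ, ℝ) (0 : M → ℝ) y = 0 := mfderiv_const
    rw [this]
    rfl
  have h1 : D.pair (X.χ u) b = 0 := funext fun y => hb.mem y u
  have h2 : D.pair a (X.χ u) = 0 := funext fun y => by
    simpa [CourantData.pair] using (hD.pairing_symm y _ _).trans (ha.mem y u)
  have h3 := hD.bracket_add_swap a (X.χ u) b ha.smooth (X.χ_smooth u) hb.smooth
  rw [ha.invariant u, add_zero, h2, hzero] at h3
  have h4 := hD.deriv_pair a (X.χ u) b ha.smooth (X.χ_smooth u) hb.smooth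
  rw [h1, hzero, h3, zero_add] at h4
  exact (congrFun h4 x).symm

end Facts

/-- `dπ ∘ ρ` vanishes on `χₓ(𝔰)`. -/
theorem mfderiv_proj_anchor [LieGroup (𝓡 k) ∞ S] [ContMDiffSMul (𝓡 k) (𝓡 m) ∞ S M]
    [ChartedSpace (EuclideanSpace ℝ (Fin q)) (OrbitSpace S M)]
    (hπ : IsSubmersion (𝓡 m) (𝓡 q) ∞ (proj S : M → OrbitSpace S M))
    (x : M) (u : GroupLieAlgebra (𝓡 k) S) :
    mfderiv (𝓡 m) (𝓡 q) (proj S : M → OrbitSpace S M) x (D.anchor x (X.χ u x)) = 0 := by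
  have ho : MDifferentiableAt (𝓡 k) (𝓡 m) (fun g : S => g⁻¹ • x) 1 := by
    have h1 : ContMDiff (𝓡 k) (𝓡 m) ∞ (fun g : S => g⁻¹ • x) :=
      (contMDiff_smul (I := 𝓡 k) (I' := 𝓡 m) (n := ∞) (G := S) (M := M)).comp
        ((contMDiff_inv (𝓡 k) ∞).prodMk contMDiff_const)
    exact (h1 1).mdifferentiableAt (by simp)
  have hp : ∀ y, y = x → MDifferentiableAt (𝓡 m) (𝓡 q) (proj S : M → OrbitSpace S M) y :=
    fun y _ => (hπ.contMDiff y).mdifferentiableAt (by simp)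
  have hx : (1 : S)⁻¹ • x = x := by simp
  have hc := mfderiv_comp (1 : S) (hp _ hx) ho
  have hconst : (proj S : M → OrbitSpace S M) ∘ (fun g : S => g⁻¹ • x) =
      fun _ => proj S x := by
    funext g
    exact Quotient.sound (MulAction.mem_orbit x g⁻¹)
  rw [hconst, mfderiv_const] at hc
  have hcu := congrArg (fun L => (L u : EuclideanSpace ℝ (Fin q))) hc
  have hr := X.rho_χ u x
  have key : ∀ (y : M), y = x → ∀ (w : EuclideanSpace ℝ (Fin m)),
      (mfderiv (𝓡 m) (𝓡 q) (proj S : M → OrbitSpace S M) y w : EuclideanSpace ℝ (Fin q)) =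
      (mfderiv (𝓡 m) (𝓡 q) (proj S : M → OrbitSpace S M) x w : EuclideanSpace ℝ (Fin q)) := by
    rintro y rfl w
    rfl
  have hk := key _ hx (mfderiv (𝓡 k) (𝓡 m) (fun g : S => g⁻¹ • x) 1 u)
  have hk' := hk.symm.trans hcu.symm
  rw [← hr] at hk'
  exact hk'

/-! #### The reduction `E_{/S} → M/S` -/

section Reduction

variable [IsManifold (𝓡 m) 1 M] [LieGroup (𝓡 k) ∞ S] [ContMDiffSMul (𝓡 k) (𝓡 m) ∞ S M]
  [ChartedSpace (EuclideanSpace ℝ (Fin q)) (OrbitSpace S M)]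

/-- The pairing on `χₓ(𝔰)^⊥ / χₓ(𝔰)`. -/
def redPairing (hD : IsCourantAlgebroid F D) (b : OrbitSpace S M) :
    LinearMap.BilinForm ℝ (X.RedFibre b) :=
  LinearMap.liftQ₂ ((X.sFibre b.out).submoduleOf (X.perpFibre b.out))
    ((X.sFibre b.out).submoduleOf (X.perpFibre b.out))
    ((D.pairing b.out).domRestrict₁₂ (X.perpFibre b.out) (X.perpFibre b.out))
    (by
      rintro v ⟨u, hu⟩
      ext w
      have h : D.pairing b.out (v : E b.out) (w : E b.out) = 0 := by
        have hu' : X.χ u b.out = (v : E b.out) := hu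
        rw [← hu']
        exact w.2 u
      exact h)
    (by
      rintro v ⟨u, hu⟩
      ext w
      have h : D.pairing b.out (w : E b.out) (v : E b.out) = 0 := by
        have hu' : X.χ u b.out = (v : E b.out) := hu
        rw [← hu', hD.pairing_symm]
        exact w.2 u
      exact h)

/-- The anchor `χₓ(𝔰)^⊥ / χₓ(𝔰) → T_b(M/S)`, induced by `dπ ∘ ρ`. -/
def redAnchor (hπ : IsSubmersion (𝓡 m) (𝓡 q) ∞ (proj S : M → OrbitSpace S M))
    (b : OrbitSpace S M) : X.RedFibre b →ₗ[ℝ] EuclideanSpace ℝ (Fin q) :=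
  ((X.sFibre b.out).submoduleOf (X.perpFibre b.out)).liftQ
    (((mfderiv (𝓡 m) (𝓡 q) (proj S : M → OrbitSpace S M) b.out).toLinearMap ∘ₗ
      D.anchor b.out) ∘ₗ (X.perpFibre b.out).subtype)
    (by
      rintro v ⟨u, hu⟩
      have h := X.mfderiv_proj_anchor hπ b.out u
      have hu' : X.χ u b.out = (v : E b.out) := hu
      rw [hu'] at h
      exact h)

/-- The reduced Courant algebroid `E_{/S} → M/S`: its smooth sections are represented by
`Γ(𝔰_E^⊥)^𝔰`, and the operations are induced by those of `E`. -/
def reduction (hD : IsCourantAlgebroid F D)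
    (hπ : IsSubmersion (𝓡 m) (𝓡 q) ∞ (proj S : M → OrbitSpace S M)) :
    CourantData q X.RedFibre where
  IsSmooth t := ∃ a, X.Represents a t
  pairing b := X.redPairing hD b
  anchor b := X.redAnchor hπ b
  bracket t t' b := Submodule.Quotient.mk
    ⟨D.bracket (X.lift t) (X.lift t') b.out,
      X.bracket_mem_perpFibre hD (X.isInvariantPerp_lift hD t) (X.isInvariantPerp_lift hD t') _⟩

/-- The divergence on `E_{/S}` induced by an equivariant divergence on `E`. -/
def redDiv (div : (∀ x, E x) → M → ℝ) (t : ∀ b : OrbitSpace S M, X.RedFibre b)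
    (b : OrbitSpace S M) : ℝ :=
  div (X.lift t) b.out

/-- The subbundle of `E_{/S}` induced by `V₊ ⊂ 𝔰_E^⊥`. -/
def redSubbundle (V : ∀ x, Submodule ℝ (E x)) (b : OrbitSpace S M) :
    Submodule ℝ (X.RedFibre b) :=
  ((V b.out).submoduleOf (X.perpFibre b.out)).map (Submodule.mkQ _)

end Reduction

end EquivariantStructure

end Equivariant

end GenScalar

set_option linter.unusedSectionVars false
set_option linter.unusedVariables false

/-! Half-densities can be eliminated from the generalized scalar curvature. For dual local bases
e_a, e^a of V₊ with constant Gram matrix the curvature equals Σ (2 ρ(e^a) div e_a + div e^a div e_a)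
- 1/2 Σ ⟨[e_a, e_b], [e^a, e^b]⟩ + 1/3 c_{abc} c^{abc}, which is `frameScalar`. On sections a of V₊
one has div_{σ²} a = div a - ⟨e₊, a⟩; inserting this in the definition makes all terms with e₊
cancel. The term c_{ab c̄} c^{ab c̄} is the full square of the bracket minus c_{abc} c^{abc}, so the
last coefficient is 1/2 - 1/6 = 1/3 (`scalarValue_eq`).

The formula does not depend on the basis (`frameScalar_eq`). A change of basis at x is the composite
of a constant one, for which only contractions of dual indices matter, and of a pointwise orthogonal
matrix A with A(x) = 1. For the latter, the bracket of the new basis at x is the old one plus first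
derivatives of A plus a gradient; gradients are isotropic and mutually orthogonal because ρ kills
them. Differentiating the orthogonality relation once and twice reduces the difference of the two
values to a finite identity between contractions (`frame_change_identity`), which holds precisely
for the weights -1/2 and 1/3.

For the reduction, connectedness of S turns infinitesimal invariance into invariance under S, and
freeness and properness allow averaging over S, so that invariant sections span every fibre
(`exists_invariant_section`). Orthogonal projection to V₊ preserves invariance. Hence a local basis
of the reduced pseudometric lifts to an invariant local basis of V₊ (`exists_frame_of_reduction`).
This lift and an arbitrary invariant lift to 𝔰_E^⊥ differ by invariant sections of 𝔰_E. Such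
sections change no ingredient of `frameScalar`: they are orthogonal to 𝔰_E^⊥, they kill invariant
functions, their brackets with invariant sections of 𝔰_E^⊥ stay in 𝔰_E, and their divergence is
zero. The last point is where div χ(u) = -Tr ad_u is needed (`div_eq_zero_of_mem_sFibre`). So the
formula takes the same value on both sides.

The reduced data are used only through `IsPreCourant`, `IsDivergence` and
`IsGeneralizedPseudometric`, which suffice to eliminate the half-density. Independence of the basis
on M/S is inherited from M, since every reduced basis lifts. -/

namespace GenScalar

/-! ### Smooth functions, derivatives along vector fields, bump functions -/

section Functions

variable {m : ℕ} {B : Type*} [TopologicalSpace B] [ChartedSpace (EuclideanSpace ℝ (Fin m)) B]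

/-- Smooth real functions. -/
abbrev IsSmoothFun (m : ℕ) {B : Type*} [TopologicalSpace B]
    [ChartedSpace (EuclideanSpace ℝ (Fin m)) B] (f : B → ℝ) : Prop :=
  ContMDiff (𝓡 m) 𝓘(ℝ, ℝ) ∞ f

theorem IsSmoothFun.mdiff {f : B → ℝ} (hf : IsSmoothFun m f) (x : B) :
    MDifferentiableAt (𝓡 m) 𝓘(ℝ, ℝ) f x := (hf x).mdifferentiableAt (by simp)

theorem isSmoothFun_const (c : ℝ) : IsSmoothFun m (fun _ : B => c) := contMDiff_const

theorem isSmoothFun_mul {f g : B → ℝ} (hf : IsSmoothFun m f) (hg : IsSmoothFun m g) :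
    IsSmoothFun m (fun y => f y * g y) := ContMDiff.mul hf hg

theorem isSmoothFun_add {f g : B → ℝ} (hf : IsSmoothFun m f) (hg : IsSmoothFun m g) :
    IsSmoothFun m (fun y => f y + g y) := ContMDiff.add hf hg

theorem isSmoothFun_const_mul {f : B → ℝ} (c : ℝ) (hf : IsSmoothFun m f) :
    IsSmoothFun m (fun y => c * f y) := isSmoothFun_mul (isSmoothFun_const c) hf

theorem isSmoothFun_sum {ι : Type*} {s : Finset ι} {f : ι → B → ℝ}
    (hf : ∀ i ∈ s, IsSmoothFun m (f i)) : IsSmoothFun m (fun y => ∑ i ∈ s, f i y) := by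
  classical
  induction s using Finset.induction_on with
  | empty => simpa using isSmoothFun_const 0
  | insert a s ha ih =>
    simp only [Finset.sum_insert ha]
    exact (hf a (Finset.mem_insert_self _ _)).add
      (ih fun i hi => hf i (Finset.mem_insert_of_mem hi))

section vectorDeriv

variable {X : ∀ x : B, TangentSpace (𝓡 m) x} {f g : B → ℝ} {x : B}

theorem vectorDeriv_add (hf : MDifferentiableAt (𝓡 m) 𝓘(ℝ, ℝ) f x)
    (hg : MDifferentiableAt (𝓡 m) 𝓘(ℝ, ℝ) g x) :
    vectorDeriv X (fun y => f y + g y) x = vectorDeriv X f x + vectorDeriv X g x := by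
  have h := (hf.hasMFDerivAt.add hg.hasMFDerivAt).mfderiv
  exact congrArg (fun L : TangentSpace (𝓡 m) x →L[ℝ] ℝ => L (X x)) h

theorem vectorDeriv_mul (hf : MDifferentiableAt (𝓡 m) 𝓘(ℝ, ℝ) f x)
    (hg : MDifferentiableAt (𝓡 m) 𝓘(ℝ, ℝ) g x) :
    vectorDeriv X (fun y => f y * g y) x =
      f x * vectorDeriv X g x + g x * vectorDeriv X f x := by
  have h := (hf.hasMFDerivAt.mul hg.hasMFDerivAt).mfderiv
  exact congrArg (fun L : TangentSpace (𝓡 m) x →L[ℝ] ℝ => L (X x)) h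

theorem vectorDeriv_const (c : ℝ) : vectorDeriv X (fun _ : B => c) x = 0 := by
  have h : mfderiv (𝓡 m) 𝓘(ℝ, ℝ) (fun _ : B => c) x = 0 := mfderiv_const
  exact congrArg (fun L : TangentSpace (𝓡 m) x →L[ℝ] ℝ => L (X x)) h

theorem vectorDeriv_congr (h : f =ᶠ[𝓝 x] g) : vectorDeriv X f x = vectorDeriv X g x := by
  have h := h.mfderiv_eq (I := 𝓡 m) (I' := 𝓘(ℝ, ℝ))
  exact congrArg (fun L : TangentSpace (𝓡 m) x →L[ℝ] ℝ => L (X x)) h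

theorem vectorDeriv_const_mul (c : ℝ) (hf : MDifferentiableAt (𝓡 m) 𝓘(ℝ, ℝ) f x) :
    vectorDeriv X (fun y => c * f y) x = c * vectorDeriv X f x := by
  rw [vectorDeriv_mul (mdifferentiableAt_const) hf, vectorDeriv_const]; ring

theorem vectorDeriv_sum {ι : Type*} (s : Finset ι) {f : ι → B → ℝ}
    (hf : ∀ i, IsSmoothFun m (f i)) :
    vectorDeriv X (fun y => ∑ i ∈ s, f i y) x = ∑ i ∈ s, vectorDeriv X (f i) x := by
  classical
  induction s using Finset.induction_on with
  | empty => simpa using vectorDeriv_const 0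
  | insert a s ha ih =>
    simp only [Finset.sum_insert ha]
    rw [vectorDeriv_add ((hf a).mdiff x) ((isSmoothFun_sum fun i _ => hf i).mdiff x), ih]

theorem vectorDeriv_smooth [IsManifold (𝓡 m) ∞ B] (hX : ContMDiff (𝓡 m) (𝓡 m).tangent ∞
      (fun b => (⟨b, X b⟩ : TangentBundle (𝓡 m) B))) (hf : IsSmoothFun m f) :
    IsSmoothFun m (vectorDeriv X f) := by
  have h1 : ContMDiff (𝓡 m).tangent 𝓘(ℝ, ℝ).tangent ∞ (tangentMap (𝓡 m) 𝓘(ℝ, ℝ) f) :=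
    hf.contMDiff_tangentMap (by simp)
  have h2 := h1.comp hX
  exact (contMDiff_snd_tangentBundle_modelSpace ℝ 𝓘(ℝ, ℝ)).comp h2

end vectorDeriv

section Bump

variable [T2Space B] [IsManifold (𝓡 m) ∞ B]

theorem exists_bump {x : B} {U : Set B} (hU : U ∈ 𝓝 x) :
    ∃ φ : B → ℝ, IsSmoothFun m φ ∧ (φ =ᶠ[𝓝 x] fun _ => 1) ∧ tsupport φ ⊆ U := by
  obtain ⟨f, -, hf⟩ := (SmoothBumpFunction.nhds_basis_tsupport (I := 𝓡 m) x).mem_iff.1 hU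
  exact ⟨f, f.contMDiff, f.eventuallyEq_one, hf⟩

/-- The Leibniz rules for brackets and divergences are stated for functions smooth on the whole
base. Coefficients that are only defined near a point are therefore cut off by a bump function,
which does not alter their germ. -/
theorem exists_global_extension {x : B} {f : B → ℝ}
    (hf : ∀ᶠ y in 𝓝 x, ContMDiffAt (𝓡 m) 𝓘(ℝ, ℝ) ∞ f y) :
    ∃ g : B → ℝ, IsSmoothFun m g ∧ g =ᶠ[𝓝 x] f := by
  obtain ⟨φ, hφ, h1, hs⟩ := exists_bump (m := m) hf
  refine ⟨fun y => φ y * f y, contMDiff_of_tsupport fun y hy => ?_, ?_⟩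
  · have : y ∈ tsupport φ := closure_mono (fun z hz => by
      simp only [Function.mem_support] at hz ⊢; exact left_ne_zero_of_mul hz) hy
    exact (hφ y).mul (hs this)
  · filter_upwards [h1] with y hy
    simp [hy]

end Bump

end Functions

/-! ### Sections, pairing, anchor and divergence without a bracket -/

section PreCourant

variable {m : ℕ} {B : Type*} [TopologicalSpace B] [ChartedSpace (EuclideanSpace ℝ (Fin m)) B]
  {E : B → Type*} [∀ b, AddCommGroup (E b)] [∀ b, Module ℝ (E b)]

/-- Smooth sections form a module over smooth functions, and the pairing and the anchor are
smooth. -/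
structure IsPreCourant [IsManifold (𝓡 m) 1 B] (D : CourantData m E) : Prop where
  zero : D.IsSmooth 0
  add : ∀ u v, D.IsSmooth u → D.IsSmooth v → D.IsSmooth (u + v)
  fsmul : ∀ (f : B → ℝ) u, IsSmoothFun m f → D.IsSmooth u → D.IsSmooth (fsmul f u)
  pair_smooth : ∀ u v, D.IsSmooth u → D.IsSmooth v → IsSmoothFun m (D.pair u v)
  pairing_symm : ∀ b v w, D.pairing b v w = D.pairing b w v
  rho_smooth : ∀ u, D.IsSmooth u → ContMDiff (𝓡 m) (𝓡 m).tangent ∞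
    (fun b => (⟨b, D.rho u b⟩ : TangentBundle (𝓡 m) B))

variable [IsManifold (𝓡 m) ∞ B] {D : CourantData m E}

theorem fsmul_const (c : ℝ) (u : ∀ b, E b) : fsmul (fun _ => c) u = c • u := rfl

namespace CourantData

theorem deriv_congr {u : ∀ b, E b} {f g : B → ℝ} {x : B} (h : f =ᶠ[𝓝 x] g) :
    D.deriv u f x = D.deriv u g x := vectorDeriv_congr h

/-- The linear map `w ↦ ρ(w) f` on the fibre at `x`. -/
def anchorDeriv (D : CourantData m E) (f : B → ℝ) (x : B) : E x →ₗ[ℝ] ℝ :=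
  (mfderiv (𝓡 m) 𝓘(ℝ, ℝ) f x).toLinearMap ∘ₗ D.anchor x

theorem deriv_apply (u : ∀ b, E b) (f : B → ℝ) (x : B) :
    D.deriv u f x = D.anchorDeriv f x (u x) := rfl

theorem deriv_congr_left {u v : ∀ b, E b} {f : B → ℝ} {x : B} (h : u x = v x) :
    D.deriv u f x = D.deriv v f x := by
  rw [deriv_apply, deriv_apply, h]

theorem deriv_eq_zero {u : ∀ b, E b} {f : B → ℝ} {x : B} (h : u x = 0) :
    D.deriv u f x = 0 := by
  rw [deriv_apply, h, map_zero]

theorem deriv_add_left (u v : ∀ b, E b) (f : B → ℝ) (x : B) :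
    D.deriv (u + v) f x = D.deriv u f x + D.deriv v f x := by
  simp only [deriv_apply, Pi.add_apply, map_add]

theorem deriv_fsmul_left (g : B → ℝ) (u : ∀ b, E b) (f : B → ℝ) (x : B) :
    D.deriv (fsmul g u) f x = g x * D.deriv u f x := by
  simp only [deriv_apply, fsmul, map_smul, smul_eq_mul]

theorem deriv_smul_left (c : ℝ) (u : ∀ b, E b) (f : B → ℝ) (x : B) :
    D.deriv (c • u) f x = c * D.deriv u f x := deriv_fsmul_left (fun _ => c) u f x

theorem deriv_sum_left {ι : Type*} (s : Finset ι) (u : ι → ∀ b, E b) (f : B → ℝ) (x : B) :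
    D.deriv (∑ i ∈ s, u i) f x = ∑ i ∈ s, D.deriv (u i) f x := by
  simp only [deriv_apply, Finset.sum_apply, map_sum]

theorem deriv_const (u : ∀ b, E b) (c : ℝ) (x : B) : D.deriv u (fun _ => c) x = 0 :=
  vectorDeriv_const c

theorem deriv_add {u : ∀ b, E b} {f g : B → ℝ} (hf : IsSmoothFun m f) (hg : IsSmoothFun m g)
    (x : B) : D.deriv u (fun y => f y + g y) x = D.deriv u f x + D.deriv u g x :=
  vectorDeriv_add (hf.mdiff x) (hg.mdiff x)

theorem deriv_mul {u : ∀ b, E b} {f g : B → ℝ} (hf : IsSmoothFun m f) (hg : IsSmoothFun m g)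
    (x : B) : D.deriv u (fun y => f y * g y) x = f x * D.deriv u g x + g x * D.deriv u f x :=
  vectorDeriv_mul (hf.mdiff x) (hg.mdiff x)

theorem deriv_const_mul {u : ∀ b, E b} {f : B → ℝ} (c : ℝ) (hf : IsSmoothFun m f)
    (x : B) : D.deriv u (fun y => c * f y) x = c * D.deriv u f x :=
  vectorDeriv_const_mul c (hf.mdiff x)

theorem deriv_sum {ι : Type*} (s : Finset ι) {u : ∀ b, E b} {f : ι → B → ℝ}
    (hf : ∀ i, IsSmoothFun m (f i)) (x : B) :
    D.deriv u (fun y => ∑ i ∈ s, f i y) x = ∑ i ∈ s, D.deriv u (f i) x :=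
  vectorDeriv_sum s hf

theorem pair_sum_left {ι : Type*} (s : Finset ι) (u : ι → ∀ b, E b) (v : ∀ b, E b) (x : B) :
    D.pair (∑ i ∈ s, u i) v x = ∑ i ∈ s, D.pair (u i) v x := by
  simp only [pair, Finset.sum_apply, map_sum, LinearMap.sum_apply]

theorem pair_sum_right {ι : Type*} (s : Finset ι) (u : ι → ∀ b, E b) (v : ∀ b, E b) (x : B) :
    D.pair v (∑ i ∈ s, u i) x = ∑ i ∈ s, D.pair v (u i) x := by
  simp only [pair, Finset.sum_apply, map_sum]

theorem pair_add_left (u v w : ∀ b, E b) (x : B) :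
    D.pair (u + v) w x = D.pair u w x + D.pair v w x := by simp [pair]

theorem pair_fsmul_left (f : B → ℝ) (u w : ∀ b, E b) (x : B) :
    D.pair (fsmul f u) w x = f x * D.pair u w x := by simp [pair, fsmul]

theorem pair_fsmul_right (f : B → ℝ) (u w : ∀ b, E b) (x : B) :
    D.pair w (fsmul f u) x = f x * D.pair w u x := by simp [pair, fsmul]

theorem pair_smul_left (c : ℝ) (u w : ∀ b, E b) (x : B) :
    D.pair (c • u) w x = c * D.pair u w x := by simp [pair]

theorem pair_smul_right (c : ℝ) (u w : ∀ b, E b) (x : B) :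
    D.pair w (c • u) x = c * D.pair w u x := by simp [pair]

end CourantData

namespace IsPreCourant

open CourantData

theorem smul (hD : IsPreCourant D) (c : ℝ) {u : ∀ b, E b} (hu : D.IsSmooth u) :
    D.IsSmooth (c • u) := hD.fsmul (fun _ => c) u (isSmoothFun_const c) hu

theorem sum (hD : IsPreCourant D) {ι : Type*} {s : Finset ι} {u : ι → ∀ b, E b}
    (hu : ∀ i ∈ s, D.IsSmooth (u i)) : D.IsSmooth (∑ i ∈ s, u i) := by
  classical
  induction s using Finset.induction_on with
  | empty => simpa using hD.zero
  | insert a s ha ih =>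
    rw [Finset.sum_insert ha]
    exact hD.add _ _ (hu a (Finset.mem_insert_self _ _))
      (ih fun i hi => hu i (Finset.mem_insert_of_mem hi))

theorem comb (hD : IsPreCourant D) {ι : Type*} {s : Finset ι} {u : ι → ∀ b, E b} {A : ι → B → ℝ}
    (hA : ∀ i, IsSmoothFun m (A i)) (hu : ∀ i, D.IsSmooth (u i)) :
    D.IsSmooth (∑ i ∈ s, GenScalar.fsmul (A i) (u i)) :=
  hD.sum fun i _ => hD.fsmul _ _ (hA i) (hu i)

theorem deriv_smooth (hD : IsPreCourant D) {u : ∀ b, E b} {f : B → ℝ}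
    (hu : D.IsSmooth u) (hf : IsSmoothFun m f) : IsSmoothFun m (D.deriv u f) :=
  vectorDeriv_smooth (hD.rho_smooth u hu) hf

theorem pair_comm (hD : IsPreCourant D) (u v : ∀ b, E b) (x : B) : D.pair u v x = D.pair v u x :=
  hD.pairing_symm _ _ _

section Divergence

variable [T2Space B] {div : (∀ b, E b) → B → ℝ}

theorem div_sum (hD : IsPreCourant D) (hdiv : D.IsDivergence div) {ι : Type*} (s : Finset ι)
    {u : ι → ∀ b, E b} (hu : ∀ i, D.IsSmooth (u i)) (x : B) :
    div (∑ i ∈ s, u i) x = ∑ i ∈ s, div (u i) x := by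
  classical
  induction s using Finset.induction_on with
  | empty =>
    have := hdiv.smul 0 0 hD.zero
    simp only [zero_smul] at this
    simp [this]
  | insert a s ha ih =>
    rw [Finset.sum_insert ha, hdiv.add _ _ (hu a) (hD.sum fun i _ => hu i), Finset.sum_insert ha,
      Pi.add_apply, ih]

theorem div_fsmul (hdiv : D.IsDivergence div) {f : B → ℝ} {u : ∀ b, E b} (hf : IsSmoothFun m f)
    (hu : D.IsSmooth u) (x : B) :
    div (GenScalar.fsmul f u) x = f x * div u x + D.deriv u f x := by
  rw [hdiv.leibniz f u hf hu]; rfl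

theorem div_comb (hD : IsPreCourant D) (hdiv : D.IsDivergence div) {ι : Type*} (s : Finset ι)
    {u : ι → ∀ b, E b} {A : ι → B → ℝ} (hA : ∀ i, IsSmoothFun m (A i))
    (hu : ∀ i, D.IsSmooth (u i)) (x : B) :
    div (∑ i ∈ s, GenScalar.fsmul (A i) (u i)) x =
      ∑ i ∈ s, (A i x * div (u i) x + D.deriv (u i) (A i) x) := by
  rw [hD.div_sum hdiv s (fun i => hD.fsmul _ _ (hA i) (hu i))]
  exact Finset.sum_congr rfl fun i _ => div_fsmul hdiv (hA i) (hu i) x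

/-- Locality follows from the Leibniz rule: for a bump function φ supported where the sections
agree, φu = φv everywhere, and at x, where φ is 1 to first order, the divergence of φu is that of u.
-/
theorem div_congr (hD : IsPreCourant D) (hdiv : D.IsDivergence div) {u v : ∀ b, E b}
    (hu : D.IsSmooth u) (hv : D.IsSmooth v) {x : B} (h : ∀ᶠ y in 𝓝 x, u y = v y) :
    div u x = div v x := by
  obtain ⟨φ, hφ, h1, hs⟩ := exists_bump (m := m) h
  have key : GenScalar.fsmul φ u = GenScalar.fsmul φ v := by
    funext y
    by_cases hy : y ∈ tsupport φ
    · have : u y = v y := hs hy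
      simp [GenScalar.fsmul, this]
    · simp [GenScalar.fsmul, image_eq_zero_of_notMem_tsupport hy]
  have h2 := congrArg (fun w => div w x) key
  simp only [div_fsmul hdiv hφ hu, div_fsmul hdiv hφ hv, h1.self_of_nhds, one_mul,
    deriv_congr h1, CourantData.deriv_const, add_zero] at h2
  exact h2

end Divergence

end IsPreCourant

end PreCourant

/-! ### Locality and the Leibniz rules of a Courant algebroid -/

section Courant

open CourantData

variable {m : ℕ} {B : Type*} [TopologicalSpace B] [ChartedSpace (EuclideanSpace ℝ (Fin m)) B]
  [IsManifold (𝓡 m) ∞ B]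
  {F : Type*} [NormedAddCommGroup F] [NormedSpace ℝ F]
  {E : B → Type*} [TopologicalSpace (TotalSpace F E)] [∀ b, AddCommGroup (E b)]
  [∀ b, Module ℝ (E b)] [∀ b, TopologicalSpace (E b)] [FiberBundle F E] [VectorBundle ℝ F E]
  {D : CourantData m E}

namespace IsCourantAlgebroid

theorem isPreCourant (hD : IsCourantAlgebroid F D) : IsPreCourant D where
  zero := (hD.isSmooth_iff _).2 (contMDiff_zeroSection ℝ E)
  add u v hu hv := (hD.isSmooth_iff _).2
    (((hD.isSmooth_iff _).1 hu).add_section ((hD.isSmooth_iff _).1 hv))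
  fsmul f u hf hu := (hD.isSmooth_iff _).2 (hf.smul_section ((hD.isSmooth_iff _).1 hu))
  pair_smooth := hD.pair_smooth
  pairing_symm := hD.pairing_symm
  rho_smooth := hD.rho_smooth

theorem finiteDimensional_fibre [FiniteDimensional ℝ F] (x : B) : FiniteDimensional ℝ (E x) :=
  ((trivializationAt F E x).continuousLinearEquivAt ℝ x
    (FiberBundle.mem_baseSet_trivializationAt' x)).symm.toLinearEquiv.finiteDimensional

theorem isSmooth_of_locally (hD : IsCourantAlgebroid F D) {a : ∀ b, E b}
    (h : ∀ x, ∃ b, D.IsSmooth b ∧ ∀ᶠ y in 𝓝 x, a y = b y) : D.IsSmooth a := by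
  rw [hD.isSmooth_iff]
  intro x
  obtain ⟨b, hb, hab⟩ := h x
  refine ((hD.isSmooth_iff _).1 hb x).congr_of_eventuallyEq ?_
  filter_upwards [hab] with y hy
  rw [hy]

variable [T2Space B]

/-- The axioms speak of global sections, whereas equalities in a fibre are tested by pairing with
vectors. This passes from one to the other. -/
theorem exists_section [ContMDiffVectorBundle ∞ F E (𝓡 m)] (hD : IsCourantAlgebroid F D) (x : B)
    (v : E x) : ∃ a, D.IsSmooth a ∧ a x = v := by
  obtain ⟨s, hs, h⟩ := FiberBundle.exists_contMDiffOn_extend (k := ∞) (I := 𝓡 m) F v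
  obtain ⟨U, hUs, hU, hxU⟩ := mem_nhds_iff.1 hs
  obtain ⟨φ, hφ, h1, hsupp⟩ := exists_bump (m := m) (hU.mem_nhds hxU)
  refine ⟨fsmul φ (FiberBundle.extend F v), (hD.isSmooth_iff _).2
    (hφ.contMDiffOn.smul_section_of_tsupport hU hsupp (h.mono hUs)), ?_⟩
  simp [fsmul, h1.self_of_nhds]

section

variable {u v w u' v' : ∀ b, E b} {f : B → ℝ} {x : B}

theorem bracket_fsmul_right (hD : IsCourantAlgebroid F D) (hu : D.IsSmooth u)
    (hf : IsSmoothFun m f) (hv : D.IsSmooth v) (x : B) :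
    D.bracket u (fsmul f v) x = f x • D.bracket u v x + D.deriv u f x • v x := by
  rw [hD.leibniz u f v hu hf hv]; rfl

theorem bracket_congr_right (hD : IsCourantAlgebroid F D) (hu : D.IsSmooth u)
    (hv : D.IsSmooth v) (hv' : D.IsSmooth v') (h : ∀ᶠ y in 𝓝 x, v y = v' y) :
    D.bracket u v x = D.bracket u v' x := by
  obtain ⟨φ, hφ, h1, hs⟩ := exists_bump (m := m) h
  have key : fsmul φ v = fsmul φ v' := by
    funext y
    by_cases hy : y ∈ tsupport φ
    · have : v y = v' y := hs hy
      simp [fsmul, this]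
    · simp [fsmul, image_eq_zero_of_notMem_tsupport hy]
  have h2 := congrArg (fun w => D.bracket u w x) key
  simp only [hD.bracket_fsmul_right hu hφ hv, hD.bracket_fsmul_right hu hφ hv', h1.self_of_nhds,
    one_smul, deriv_congr h1, CourantData.deriv_const, zero_smul, add_zero] at h2
  exact h2

theorem pair_bracket_swap (hD : IsCourantAlgebroid F D) (hu : D.IsSmooth u) (hv : D.IsSmooth v)
    (hw : D.IsSmooth w) (x : B) :
    D.pair (D.bracket u v) w x = D.deriv w (D.pair u v) x - D.pair (D.bracket v u) w x := by
  have := congrFun (hD.bracket_add_swap u v w hu hv hw) x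
  rw [pair_add_left] at this
  linarith

/-- The Leibniz axiom concerns the second argument only. In the first argument the bracket is
exchanged using its symmetric part d_E⟨u, v⟩, and this produces the additional gradient term ⟨u, v⟩
d_E f. -/
theorem pair_bracket_fsmul_left (hD : IsCourantAlgebroid F D) (hu : D.IsSmooth u)
    (hf : IsSmoothFun m f) (hv : D.IsSmooth v) (hw : D.IsSmooth w) (x : B) :
    D.pair (D.bracket (fsmul f u) v) w x = f x * D.pair (D.bracket u v) w x
      - D.deriv v f x * D.pair u w x + D.pair u v x * D.deriv w f x := by
  have hp := hD.isPreCourant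
  have h1 := hD.pair_bracket_swap (hp.fsmul f u hf hu) hv hw x
  have h2 := hD.pair_bracket_swap hu hv hw x
  have h3 : D.pair (D.bracket v (fsmul f u)) w x =
      f x * D.pair (D.bracket v u) w x + D.deriv v f x * D.pair u w x := by
    simp only [CourantData.pair, hD.bracket_fsmul_right hv hf hu, map_add, map_smul,
      LinearMap.add_apply, LinearMap.smul_apply, smul_eq_mul]
  have h4 : D.deriv w (D.pair (fsmul f u) v) x =
      f x * D.deriv w (D.pair u v) x + D.pair u v x * D.deriv w f x := by
    rw [← deriv_mul hf (hp.pair_smooth u v hu hv)]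
    congr 1
    funext y
    exact pair_fsmul_left _ _ _ _
  rw [h1, h3, h4, h2]
  ring

variable [ContMDiffVectorBundle ∞ F E (𝓡 m)]

/-- Reduces to locality in the second argument, because the symmetric part of the bracket is a
differential and hence local. -/
theorem bracket_congr_left (hD : IsCourantAlgebroid F D) (hu : D.IsSmooth u)
    (hu' : D.IsSmooth u') (hv : D.IsSmooth v) (h : ∀ᶠ y in 𝓝 x, u y = u' y) :
    D.bracket u v x = D.bracket u' v x := by
  rw [← sub_eq_zero]
  refine hD.pairing_nondegenerate x _ fun w => ?_
  obtain ⟨w, hw, rfl⟩ := hD.exists_section x w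
  have h1 := hD.pair_bracket_swap hu hv hw x
  have h2 := hD.pair_bracket_swap hu' hv hw x
  have h3 : D.deriv w (D.pair u v) x = D.deriv w (D.pair u' v) x :=
    deriv_congr (h.mono fun y hy => by simp [CourantData.pair, hy])
  have h4 : D.pair (D.bracket v u) w x = D.pair (D.bracket v u') w x := by
    simp only [CourantData.pair, hD.bracket_congr_right hv hu hu' h]
  have h5 : D.pair (D.bracket u v) w x = D.pair (D.bracket u' v) w x := by
    rw [h1, h2, h3, h4]
  rw [map_sub, LinearMap.sub_apply, sub_eq_zero]
  exact h5

/-- That the anchor preserves brackets is not an axiom. It follows from the Jacobi identity for u,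
v, fw: after expanding by the Leibniz rule, everything cancels except the multiples of w. -/
theorem deriv_bracket (hD : IsCourantAlgebroid F D) (hu : D.IsSmooth u) (hv : D.IsSmooth v)
    (hf : IsSmoothFun m f) (x : B) : D.deriv (D.bracket u v) f x =
      D.deriv u (D.deriv v f) x - D.deriv v (D.deriv u f) x := by
  have hp := hD.isPreCourant
  -- A nonzero w is needed to read off its coefficient; over a zero fibre all three derivatives
  -- vanish because the sections do.
  by_cases hx : ∀ w : E x, w = 0
  · rw [deriv_eq_zero (hx _), deriv_eq_zero (hx _), deriv_eq_zero (hx _), sub_zero]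
  push Not at hx
  obtain ⟨w, hw0⟩ := hx
  obtain ⟨w, hw, rfl⟩ := hD.exists_section x w
  have hdu := hp.deriv_smooth hu hf
  have hdv := hp.deriv_smooth hv hf
  have huv := hD.bracket_smooth u v hu hv
  have huw := hD.bracket_smooth u w hu hw
  have hvw := hD.bracket_smooth v w hv hw
  have h1 := congrFun (hD.jacobi u v (fsmul f w) hu hv (hp.fsmul f w hf hw)) x
  rw [hD.leibniz v f w hv hf hw, hD.leibniz u f w hu hf hw] at h1
  rw [hD.bracket_add_right u _ _ hu (hp.fsmul _ _ hf hvw) (hp.fsmul _ _ hdv hw),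
    hD.bracket_add_right v _ _ hv (hp.fsmul _ _ hf huw) (hp.fsmul _ _ hdu hw)] at h1
  simp only [Pi.add_apply] at h1
  rw [hD.bracket_fsmul_right hu hf hvw, hD.bracket_fsmul_right hu hdv hw,
    hD.bracket_fsmul_right hv hf huw, hD.bracket_fsmul_right hv hdu hw,
    hD.bracket_fsmul_right huv hf hw, hD.jacobi u v w hu hv hw] at h1
  have h2 : (D.deriv (D.bracket u v) f x -
      (D.deriv u (D.deriv v f) x - D.deriv v (D.deriv u f) x)) • w x = 0 := by
    simp only [Pi.add_apply, smul_add] at h1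
    simp only [sub_smul]
    rw [← sub_eq_zero] at h1
    rw [← neg_eq_zero, ← h1]
    abel
  have h3 := (smul_eq_zero.1 h2).resolve_right hw0
  linarith

end

end IsCourantAlgebroid

end Courant

/-! ### The algebraic identity for a change of orthogonal basis -/

section TripleSums

variable {ι : Type*} [Fintype ι]

/-- The contraction of a tensor of order three with a diagonal metric. -/
def tripleSum (η : ι → ℝ) : (ι → ι → ι → ℝ) →ₗ[ℝ] ℝ where
  toFun f := ∑ a, ∑ b, ∑ d, η a * η b * η d * f a b d
  map_add' f g := by simp only [Pi.add_apply, mul_add, Finset.sum_add_distrib]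
  map_smul' c f := by
    simp only [Pi.smul_apply, smul_eq_mul, RingHom.id_apply, Finset.mul_sum]
    refine Finset.sum_congr rfl fun a _ => Finset.sum_congr rfl fun b _ =>
      Finset.sum_congr rfl fun d _ => by ring

variable (η : ι → ℝ) (f : ι → ι → ι → ℝ)

theorem tripleSum_swap_left : tripleSum η (fun a b d => f b a d) = tripleSum η f := by
  simp only [tripleSum, LinearMap.coe_mk, AddHom.coe_mk]
  rw [Finset.sum_comm]
  refine Finset.sum_congr rfl fun a _ => Finset.sum_congr rfl fun b _ =>
    Finset.sum_congr rfl fun d _ => by ring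

theorem tripleSum_swap_right : tripleSum η (fun a b d => f a d b) = tripleSum η f := by
  simp only [tripleSum, LinearMap.coe_mk, AddHom.coe_mk]
  refine Finset.sum_congr rfl fun a _ => ?_
  rw [Finset.sum_comm]
  refine Finset.sum_congr rfl fun b _ => Finset.sum_congr rfl fun d _ => by ring

theorem tripleSum_rotate : tripleSum η (fun a b d => f d a b) = tripleSum η f := by
  rw [tripleSum_swap_right η (fun a b d => f b a d), tripleSum_swap_left]

variable {η} {θ : ι → ι → ι → ℝ}

/-- The algebraic identity behind the independence of the generalized scalar curvature of the local
basis. -/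
theorem frame_change_identity (hθ : ∀ c i j, θ c i j = -θ c j i) (T : ι → ι → ι → ι → ℝ)
    (hT : ∀ c d i j, T c d i j + T c d j i =
      -∑ a, η a * (θ c i a * θ d j a + θ d i a * θ c j a))
    (δ : ι → ℝ) (c : ι → ι → ι → ℝ) (hc : ∀ a b d, c a b d = -c b a d)
    (hc' : ∀ a b d, c a b d = -c a d b) :
    ∑ i, η i * (2 * ∑ a, η a * (θ i i a * δ a + T i a i a) + 2 * δ i * ∑ a, η a * θ a i a +
        (∑ a, η a * θ a i a) ^ 2)
      - 1 / 2 * ∑ a, ∑ b, η a * η b * (2 * ∑ d, η d * ((θ a b d - θ b a d) * c a b d)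
          + 2 * (T a b a b - T b a a b) + ∑ d, η d * (θ a b d - θ b a d) ^ 2
          + 2 * ∑ d, η d * ((θ a b d - θ b a d) * θ d a b))
      + 1 / 3 * ∑ a, ∑ b, ∑ d, η a * η b * η d *
          ((c a b d + θ a b d - θ b a d + θ d a b) ^ 2 - c a b d ^ 2) = 0 := by
  -- Relabelling summation indices and using the antisymmetries reduces every sum to the six
  -- contractions P, W, U, Z, Q, Q'.
  set S := tripleSum η with hS
  set P := S fun a b d => θ a b d ^ 2 with hP
  set W := S fun a b d => θ a b d * θ b a d with hW
  set U := S fun a b d => θ a a d * θ b b d with hU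
  set Z := S fun a b d => c a b d * θ a b d with hZ
  set Q := ∑ a, ∑ b, η a * η b * T a b a b with hQ
  set Q' := ∑ a, ∑ b, η a * η b * T b a a b with hQ'
  have p1 : S (fun a b d => θ b a d ^ 2) = P := tripleSum_swap_left η _
  have p2 : S (fun a b d => θ d a b ^ 2) = P := tripleSum_rotate η fun a b d => θ a b d ^ 2
  have w1 : S (fun a b d => θ a b d * θ d a b) = -W := by
    rw [hW, ← tripleSum_swap_right, ← map_neg]
    congr 1; funext a b d
    simp only [Pi.neg_apply]
    rw [hθ a d b]; ring
  have w2 : S (fun a b d => θ b a d * θ d a b) = W := by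
    rw [hW, ← tripleSum_rotate η fun a b d => θ a b d * θ b a d,
      ← tripleSum_rotate η fun a b d => θ d a b * θ a d b]
    congr 1; funext a b d
    rw [hθ b a d, hθ d a b]; ring
  have z1 : S (fun a b d => c a b d * θ b a d) = -Z := by
    rw [hZ, ← tripleSum_swap_left, ← map_neg]
    congr 1; funext a b d
    simp only [Pi.neg_apply]
    rw [hc a b d]; ring
  have z2 : S (fun a b d => c a b d * θ d a b) = Z := by
    rw [hZ, ← tripleSum_rotate η fun a b d => c a b d * θ a b d]
    congr 1; funext a b d
    rw [hc d a b, hc' a d b]; ring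
  -- The only relation between second derivatives that is needed: the contraction of `hT` over c = i
  -- and d = j.
  have q1 : Q + Q' = -U - W := by
    have hsw : Q' = ∑ a, ∑ b, η a * η b * T a b b a := by
      rw [hQ', Finset.sum_comm]
      refine Finset.sum_congr rfl fun a _ => Finset.sum_congr rfl fun b _ => by ring
    have : Q + Q' = S (fun a b d => -(θ a a d * θ b b d + θ a b d * θ b a d)) := by
      rw [hsw, hQ, ← Finset.sum_add_distrib, hS]
      simp only [tripleSum, LinearMap.coe_mk, AddHom.coe_mk]
      refine Finset.sum_congr rfl fun a _ => ?_
      rw [← Finset.sum_add_distrib]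
      refine Finset.sum_congr rfl fun b _ => ?_
      rw [← mul_add, hT, ← Finset.sum_neg_distrib, Finset.mul_sum]
      refine Finset.sum_congr rfl fun d _ => by ring
    rw [this, hU, hW, ← map_neg, ← map_sub]
    congr 1; funext a b d
    simp only [Pi.sub_apply, Pi.neg_apply]; ring
  have t1 : ∑ i, η i * (2 * ∑ a, η a * (θ i i a * δ a + T i a i a) +
      2 * δ i * ∑ a, η a * θ a i a + (∑ a, η a * θ a i a) ^ 2) = 2 * Q + U := by
    -- The terms linear in the divergences δ cancel by antisymmetry of θ in its last two indices.
    have l1 : ∑ i, ∑ a, η i * η a * (θ i i a * δ a) + ∑ i, ∑ a, η i * η a * (δ i * θ a i a) = 0 := by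
      rw [Finset.sum_comm, ← Finset.sum_add_distrib]
      refine Finset.sum_eq_zero fun i _ => ?_
      rw [← Finset.sum_add_distrib]
      refine Finset.sum_eq_zero fun a _ => ?_
      rw [hθ a a i]; ring
    have l2 : ∑ i, η i * (∑ a, η a * θ a i a) ^ 2 = U := by
      rw [hU, ← tripleSum_rotate, ← tripleSum_rotate]
      simp only [tripleSum, LinearMap.coe_mk, AddHom.coe_mk]
      refine Finset.sum_congr rfl fun i _ => ?_
      rw [pow_two, Finset.sum_mul_sum, Finset.mul_sum]
      refine Finset.sum_congr rfl fun a _ => ?_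
      rw [Finset.mul_sum]
      refine Finset.sum_congr rfl fun b _ => ?_
      rw [hθ a a i, hθ b b i]; ring
    have l3 : ∑ i, η i * (2 * ∑ a, η a * (θ i i a * δ a + T i a i a) +
        2 * δ i * ∑ a, η a * θ a i a + (∑ a, η a * θ a i a) ^ 2) =
        2 * (∑ i, ∑ a, η i * η a * (θ i i a * δ a) + ∑ i, ∑ a, η i * η a * (δ i * θ a i a)) +
        2 * Q + ∑ i, η i * (∑ a, η a * θ a i a) ^ 2 := by
      simp only [hQ, Finset.mul_sum, ← Finset.sum_add_distrib]
      refine Finset.sum_congr rfl fun i _ => ?_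
      rw [mul_add, add_left_inj, Finset.mul_sum]
      refine Finset.sum_congr rfl fun a _ => by ring
    rw [l3, l1, l2]; ring
  have t2 : ∑ a, ∑ b, η a * η b * (2 * ∑ d, η d * ((θ a b d - θ b a d) * c a b d)
      + 2 * (T a b a b - T b a a b) + ∑ d, η d * (θ a b d - θ b a d) ^ 2
      + 2 * ∑ d, η d * ((θ a b d - θ b a d) * θ d a b)) = 4 * Z + 2 * (Q - Q') + 2 * P - 6 * W := by
    have l1 : ∑ a, ∑ b, η a * η b * (2 * ∑ d, η d * ((θ a b d - θ b a d) * c a b d)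
        + 2 * (T a b a b - T b a a b) + ∑ d, η d * (θ a b d - θ b a d) ^ 2
        + 2 * ∑ d, η d * ((θ a b d - θ b a d) * θ d a b)) = 2 * (Q - Q') +
        S (fun a b d => 2 * ((θ a b d - θ b a d) * c a b d) + (θ a b d - θ b a d) ^ 2 +
          2 * ((θ a b d - θ b a d) * θ d a b)) := by
      simp only [hQ, hQ', ← Finset.sum_sub_distrib, hS, tripleSum, LinearMap.coe_mk,
        AddHom.coe_mk, Finset.mul_sum]
      simp only [← Finset.sum_add_distrib]
      refine Finset.sum_congr rfl fun a _ => Finset.sum_congr rfl fun b _ => ?_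
      have hd : ∀ d, η a * η b * η d * (2 * ((θ a b d - θ b a d) * c a b d) +
          (θ a b d - θ b a d) ^ 2 + 2 * ((θ a b d - θ b a d) * θ d a b)) =
          η a * η b * (2 * (η d * ((θ a b d - θ b a d) * c a b d)) +
          η d * (θ a b d - θ b a d) ^ 2 + 2 * (η d * ((θ a b d - θ b a d) * θ d a b))) :=
        fun d => by ring
      simp only [hd, ← Finset.mul_sum, Finset.sum_add_distrib]
      ring
    have l2 : (fun a b d => 2 * ((θ a b d - θ b a d) * c a b d) + (θ a b d - θ b a d) ^ 2 +
        2 * ((θ a b d - θ b a d) * θ d a b)) =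
        (2 : ℝ) • (fun a b d => c a b d * θ a b d) - (2 : ℝ) • (fun a b d => c a b d * θ b a d)
        + (fun a b d => θ a b d ^ 2) + (fun a b d => θ b a d ^ 2)
        - (2 : ℝ) • (fun a b d => θ a b d * θ b a d)
        + (2 : ℝ) • (fun a b d => θ a b d * θ d a b)
        - (2 : ℝ) • (fun a b d => θ b a d * θ d a b) := by
      funext a b d
      simp only [Pi.add_apply, Pi.sub_apply, Pi.smul_apply, smul_eq_mul]; ring
    rw [l1, l2]
    simp only [map_add, map_sub, map_smul, smul_eq_mul, z1, p1, w1, w2, ← hP, ← hW, ← hZ]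
    ring
  have t3 : ∑ a, ∑ b, ∑ d, η a * η b * η d *
      ((c a b d + θ a b d - θ b a d + θ d a b) ^ 2 - c a b d ^ 2) = 6 * Z + 3 * P - 6 * W := by
    have l2 : (fun a b d => (c a b d + θ a b d - θ b a d + θ d a b) ^ 2 - c a b d ^ 2) =
        (2 : ℝ) • (fun a b d => c a b d * θ a b d) - (2 : ℝ) • (fun a b d => c a b d * θ b a d)
        + (2 : ℝ) • (fun a b d => c a b d * θ d a b)
        + (fun a b d => θ a b d ^ 2) + (fun a b d => θ b a d ^ 2) + (fun a b d => θ d a b ^ 2)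
        - (2 : ℝ) • (fun a b d => θ a b d * θ b a d)
        + (2 : ℝ) • (fun a b d => θ a b d * θ d a b)
        - (2 : ℝ) • (fun a b d => θ b a d * θ d a b) := by
      funext a b d
      simp only [Pi.add_apply, Pi.sub_apply, Pi.smul_apply, smul_eq_mul]; ring
    change S (fun a b d => (c a b d + θ a b d - θ b a d + θ d a b) ^ 2 - c a b d ^ 2) = _
    rw [l2]
    simp only [map_add, map_sub, map_smul, smul_eq_mul, z1, z2, p1, p2, w1, w2, ← hP, ← hW, ← hZ]
    ring
  -- The total is (2Q + U) - 1/2 (4Z + 2(Q - Q') + 2P - 6W) + 1/3 (6Z + 3P - 6W) = Q + Q' + U + W,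
  -- which is zero by `q1`. The weights -1/2 and 1/3 are what cancels Z and P.
  rw [t1, t2, t3]
  linarith

end TripleSums

/-! ### The curvature formula without half-densities, and contractions -/

section FrameScalar

open CourantData

variable {m : ℕ} {B : Type*} [TopologicalSpace B] [ChartedSpace (EuclideanSpace ℝ (Fin m)) B]
  {E : B → Type*} [∀ b, AddCommGroup (E b)] [∀ b, Module ℝ (E b)]

/-- The generalized scalar curvature in terms of dual bases of `V₊` and of the divergence, without
reference to a half-density. -/
def CourantData.frameScalar (D : CourantData m E) (div : (∀ b, E b) → B → ℝ) {ι : Type*} [Fintype ι]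
    (e e' : ι → ∀ b, E b) (x : B) : ℝ :=
  ∑ a, (2 * D.deriv (e' a) (div (e a)) x + div (e' a) x * div (e a) x)
    - 1 / 2 * ∑ a, ∑ b, D.pair (D.bracket (e a) (e b)) (D.bracket (e' a) (e' b)) x
    + 1 / 3 * ∑ a, ∑ b, ∑ c, D.pair (e a) (D.bracket (e b) (e c)) x *
        D.pair (e' a) (D.bracket (e' b) (e' c)) x

/-- Contracting a lower with an upper index is unaffected when they transform by contragredient
matrices. The two index types are kept distinct, so that two bases can be compared without first
equating their cardinalities. -/
theorem sum_contract {ι κ : Type*} [Fintype ι] [Fintype κ] [DecidableEq κ] {C C' : ι → κ → ℝ}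
    (hC : ∀ i j, ∑ a, C a i * C' a j = if i = j then 1 else 0) (t : κ → κ → ℝ) :
    ∑ a, ∑ i, ∑ j, C a i * C' a j * t i j = ∑ i, t i i := by
  rw [Finset.sum_comm]
  refine Finset.sum_congr rfl fun i _ => ?_
  rw [Finset.sum_comm]
  simp_rw [← Finset.sum_mul, hC]
  simp

theorem sum_contract_mul {ι κ : Type*} [Fintype ι] [Fintype κ] [DecidableEq κ] {C C' : ι → κ → ℝ}
    (hC : ∀ i j, ∑ a, C a i * C' a j = if i = j then 1 else 0) (p p' : κ → ℝ) :
    ∑ a, (∑ i, C a i * p i) * (∑ j, C' a j * p' j) = ∑ i, p i * p' i := by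
  rw [← sum_contract hC fun i j => p i * p' j]
  refine Finset.sum_congr rfl fun a _ => ?_
  rw [Finset.sum_mul_sum]
  refine Finset.sum_congr rfl fun i _ => Finset.sum_congr rfl fun j _ => by ring

theorem sum_contract_triple {ι κ : Type*} [Fintype ι] [Fintype κ] [DecidableEq κ]
    {C C' : ι → κ → ℝ} (hC : ∀ i j, ∑ a, C a i * C' a j = if i = j then 1 else 0)
    (p p' : κ → κ → κ → ℝ) :
    ∑ a, ∑ b, ∑ c, (∑ i, C a i * ∑ j, C b j * ∑ k, C c k * p i j k) *
      (∑ i, C' a i * ∑ j, C' b j * ∑ k, C' c k * p' i j k) =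
    ∑ i, ∑ j, ∑ k, p i j k * p' i j k := by
  have h1 : ∀ b, ∑ a, ∑ c, (∑ i, C a i * ∑ j, C b j * ∑ k, C c k * p i j k) *
      (∑ i, C' a i * ∑ j, C' b j * ∑ k, C' c k * p' i j k) =
      ∑ c, ∑ i, (∑ j, C b j * ∑ k, C c k * p i j k) *
        (∑ j, C' b j * ∑ k, C' c k * p' i j k) := fun b => by
    rw [Finset.sum_comm]
    exact Finset.sum_congr rfl fun c _ => sum_contract_mul hC _ _
  have h2 : ∀ c, ∑ b, ∑ i, (∑ j, C b j * ∑ k, C c k * p i j k) *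
        (∑ j, C' b j * ∑ k, C' c k * p' i j k) =
      ∑ i, ∑ j, (∑ k, C c k * p i j k) * (∑ k, C' c k * p' i j k) := fun c => by
    rw [Finset.sum_comm]
    exact Finset.sum_congr rfl fun i _ => sum_contract_mul hC _ _
  rw [Finset.sum_comm, Finset.sum_congr rfl fun b _ => h1 b, Finset.sum_comm,
    Finset.sum_congr rfl fun c _ => h2 c, Finset.sum_comm]
  refine Finset.sum_congr rfl fun i _ => ?_
  rw [Finset.sum_comm]
  exact Finset.sum_congr rfl fun j _ => sum_contract_mul hC _ _

end FrameScalar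

/-! ### Invariance under constant changes of basis -/

section Courant

open CourantData

variable {m : ℕ} {B : Type*} [TopologicalSpace B] [ChartedSpace (EuclideanSpace ℝ (Fin m)) B]
  [IsManifold (𝓡 m) ∞ B]
  {F : Type*} [NormedAddCommGroup F] [NormedSpace ℝ F]
  {E : B → Type*} [TopologicalSpace (TotalSpace F E)] [∀ b, AddCommGroup (E b)]
  [∀ b, Module ℝ (E b)] [∀ b, TopologicalSpace (E b)] [FiberBundle F E] [VectorBundle ℝ F E]
  [T2Space B] {D : CourantData m E} {div : (∀ b, E b) → B → ℝ}

namespace IsCourantAlgebroid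

theorem bracket_sum_left (hD : IsCourantAlgebroid F D) {ι : Type*} (s : Finset ι)
    {u : ι → ∀ b, E b} {v : ∀ b, E b} (hu : ∀ i, D.IsSmooth (u i)) (hv : D.IsSmooth v) :
    D.bracket (∑ i ∈ s, u i) v = ∑ i ∈ s, D.bracket (u i) v := by
  classical
  induction s using Finset.induction_on with
  | empty => simpa using hD.bracket_smul_left 0 0 v hD.isPreCourant.zero hv
  | insert a s ha ih =>
    rw [Finset.sum_insert ha, Finset.sum_insert ha,
      hD.bracket_add_left _ _ _ (hu a) (hD.isPreCourant.sum fun i _ => hu i) hv, ih]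

theorem bracket_sum_right (hD : IsCourantAlgebroid F D) {ι : Type*} (s : Finset ι)
    {u : ι → ∀ b, E b} {v : ∀ b, E b} (hu : ∀ i, D.IsSmooth (u i)) (hv : D.IsSmooth v) :
    D.bracket v (∑ i ∈ s, u i) = ∑ i ∈ s, D.bracket v (u i) := by
  classical
  induction s using Finset.induction_on with
  | empty => simpa using hD.bracket_smul_right 0 v 0 hv hD.isPreCourant.zero
  | insert a s ha ih =>
    rw [Finset.sum_insert ha, Finset.sum_insert ha,
      hD.bracket_add_right _ _ _ hv (hu a) (hD.isPreCourant.sum fun i _ => hu i), ih]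

theorem bracket_lin_left (hD : IsCourantAlgebroid F D) {ι : Type*} (s : Finset ι) (c : ι → ℝ)
    {u : ι → ∀ b, E b} {v : ∀ b, E b} (hu : ∀ i, D.IsSmooth (u i)) (hv : D.IsSmooth v) :
    D.bracket (∑ i ∈ s, c i • u i) v = ∑ i ∈ s, c i • D.bracket (u i) v := by
  rw [hD.bracket_sum_left s (fun i => hD.isPreCourant.smul (c i) (hu i)) hv]
  exact Finset.sum_congr rfl fun i _ => hD.bracket_smul_left (c i) (u i) v (hu i) hv

theorem bracket_lin_right (hD : IsCourantAlgebroid F D) {ι : Type*} (s : Finset ι) (c : ι → ℝ)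
    {u : ι → ∀ b, E b} {v : ∀ b, E b} (hu : ∀ i, D.IsSmooth (u i)) (hv : D.IsSmooth v) :
    D.bracket v (∑ i ∈ s, c i • u i) = ∑ i ∈ s, c i • D.bracket v (u i) := by
  rw [hD.bracket_sum_right s (fun i => hD.isPreCourant.smul (c i) (hu i)) hv]
  exact Finset.sum_congr rfl fun i _ => hD.bracket_smul_right (c i) v (u i) hv (hu i)

/-- Invariance of `frameScalar` under constant changes of the basis. -/
theorem frameScalar_const_change (hD : IsCourantAlgebroid F D) (hdiv : D.IsDivergence div)
    {ι κ : Type*} [Fintype ι] [Fintype κ] [DecidableEq κ] {C C' : ι → κ → ℝ}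
    (hC : ∀ i j, ∑ a, C a i * C' a j = if i = j then 1 else 0) {f f' : κ → ∀ b, E b}
    (hf : ∀ i, D.IsSmooth (f i)) (hf' : ∀ i, D.IsSmooth (f' i)) (x : B) :
    D.frameScalar div (fun a => ∑ i, C a i • f i) (fun a => ∑ i, C' a i • f' i) x =
      D.frameScalar div f f' x := by
  have hp := hD.isPreCourant
  have hg : ∀ a, D.IsSmooth (∑ i, C a i • f i) := fun a => hp.sum fun i _ => hp.smul _ (hf i)
  have hg' : ∀ a, D.IsSmooth (∑ i, C' a i • f' i) := fun a => hp.sum fun i _ => hp.smul _ (hf' i)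
  have hd : ∀ (c : κ → ℝ) (f : κ → ∀ b, E b), (∀ i, D.IsSmooth (f i)) →
      div (∑ i, c i • f i) = fun y => ∑ i, c i * div (f i) y := by
    intro c f hf
    funext y
    rw [hp.div_sum hdiv _ (fun i => hp.smul _ (hf i))]
    refine Finset.sum_congr rfl fun i _ => ?_
    rw [hdiv.smul _ _ (hf i)]; rfl
  unfold CourantData.frameScalar
  congr 1
  · congr 1
    · rw [Finset.sum_add_distrib, Finset.sum_add_distrib]
      congr 1
      · rw [← sum_contract hC fun i j => 2 * D.deriv (f' j) (div (f i)) x]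
        refine Finset.sum_congr rfl fun a _ => ?_
        rw [hd _ _ hf, deriv_sum_left, Finset.sum_comm, Finset.mul_sum]
        refine Finset.sum_congr rfl fun j _ => ?_
        rw [deriv_smul_left, deriv_sum (f := fun i y => C a i * div (f i) y) _
            fun i => isSmoothFun_const_mul _ (hdiv.contMDiff _ (hf i)),
          Finset.mul_sum, Finset.mul_sum]
        refine Finset.sum_congr rfl fun i _ => ?_
        rw [deriv_const_mul _ (hdiv.contMDiff _ (hf i))]; ring
      · simp only [hd _ _ hf, hd _ _ hf']
        simp_rw [mul_comm (∑ j, C' _ j * _)]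
        rw [sum_contract_mul hC]
        simp_rw [mul_comm]
    · congr 1
      -- The bracket is ℝ-bilinear, so constant matrices pass through it; the two pairs of dual
      -- indices are contracted one after the other.
      have h1 : ∀ b, ∑ a, D.pair (D.bracket (∑ i, C a i • f i) (∑ i, C b i • f i))
          (D.bracket (∑ i, C' a i • f' i) (∑ i, C' b i • f' i)) x =
          ∑ i, D.pair (D.bracket (f i) (∑ i, C b i • f i))
            (D.bracket (f' i) (∑ i, C' b i • f' i)) x := by
        intro b
        rw [← sum_contract hC fun i j => D.pair (D.bracket (f i) (∑ i, C b i • f i))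
            (D.bracket (f' j) (∑ i, C' b i • f' i)) x]
        refine Finset.sum_congr rfl fun a _ => ?_
        rw [hD.bracket_lin_left _ _ hf (hg b), hD.bracket_lin_left _ _ hf' (hg' b), pair_sum_left]
        refine Finset.sum_congr rfl fun i _ => ?_
        rw [pair_sum_right]
        refine Finset.sum_congr rfl fun j _ => ?_
        rw [pair_smul_left, pair_smul_right]; ring
      rw [Finset.sum_comm]
      simp_rw [h1]
      rw [Finset.sum_comm]
      refine Finset.sum_congr rfl fun i _ => ?_
      rw [← sum_contract hC fun k l => D.pair (D.bracket (f i) (f k)) (D.bracket (f' i) (f' l)) x]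
      refine Finset.sum_congr rfl fun a _ => ?_
      rw [hD.bracket_lin_right _ _ hf (hf i), hD.bracket_lin_right _ _ hf' (hf' i), pair_sum_left]
      refine Finset.sum_congr rfl fun i _ => ?_
      rw [pair_sum_right]
      refine Finset.sum_congr rfl fun j _ => ?_
      rw [pair_smul_left, pair_smul_right]; ring
  · congr 1
    have e1 : ∀ (c : κ → ℝ) (f : κ → ∀ b, E b) (w : ∀ b, E b),
        D.pair (∑ i, c i • f i) w x = ∑ i, c i * D.pair (f i) w x := by
      intro c f w
      rw [pair_sum_left]
      exact Finset.sum_congr rfl fun i _ => pair_smul_left _ _ _ _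
    have e2 : ∀ (c : κ → ℝ) (f : κ → ∀ b, E b) (u v : ∀ b, E b), (∀ i, D.IsSmooth (f i)) →
        D.IsSmooth v → D.pair u (D.bracket (∑ i, c i • f i) v) x =
          ∑ i, c i * D.pair u (D.bracket (f i) v) x := by
      intro c f u v hf hv
      rw [hD.bracket_lin_left _ _ hf hv, pair_sum_right]
      exact Finset.sum_congr rfl fun i _ => pair_smul_right _ _ _ _
    have e3 : ∀ (c : κ → ℝ) (f : κ → ∀ b, E b) (u v : ∀ b, E b), (∀ i, D.IsSmooth (f i)) →
        D.IsSmooth v → D.pair u (D.bracket v (∑ i, c i • f i)) x =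
          ∑ i, c i * D.pair u (D.bracket v (f i)) x := by
      intro c f u v hf hv
      rw [hD.bracket_lin_right _ _ hf hv, pair_sum_right]
      exact Finset.sum_congr rfl fun i _ => pair_smul_right _ _ _ _
    rw [← sum_contract_triple hC]
    refine Finset.sum_congr rfl fun a _ => Finset.sum_congr rfl fun b _ =>
      Finset.sum_congr rfl fun c _ => ?_
    simp_rw [e1, e2 _ _ _ _ hf (hg _), e3 _ _ _ _ hf (hf _), e2 _ _ _ _ hf' (hg' _),
      e3 _ _ _ _ hf' (hf' _)]

end IsCourantAlgebroid

end Courant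

/-! ### Gradients, and invariance under orthogonal changes trivial at a point -/

section Courant

open CourantData

variable {m : ℕ} {B : Type*} [TopologicalSpace B] [ChartedSpace (EuclideanSpace ℝ (Fin m)) B]
  [IsManifold (𝓡 m) ∞ B]
  {F : Type*} [NormedAddCommGroup F] [NormedSpace ℝ F] [FiniteDimensional ℝ F]
  {E : B → Type*} [TopologicalSpace (TotalSpace F E)] [∀ b, AddCommGroup (E b)]
  [∀ b, Module ℝ (E b)] [∀ b, TopologicalSpace (E b)] [FiberBundle F E] [VectorBundle ℝ F E]
  [ContMDiffVectorBundle ∞ F E (𝓡 m)]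
  [T2Space B] {D : CourantData m E} {div : (∀ b, E b) → B → ℝ}

namespace IsCourantAlgebroid

omit [T2Space B] in
-- Fibres are finite-dimensional, so a non-degenerate pairing identifies a fibre with its dual. In
-- particular this provides the gradient of a function at x as a vector of the fibre.
theorem exists_dual_vector (hD : IsCourantAlgebroid F D) (x : B) (φ : E x →ₗ[ℝ] ℝ) :
    ∃ g : E x, ∀ w, D.pairing x g w = φ w := by
  have := finiteDimensional_fibre (F := F) (E := E) x
  have hinj : Function.Injective (D.pairing x) := by
    rw [injective_iff_map_eq_zero]
    intro v hv
    exact hD.pairing_nondegenerate x v fun w => by rw [hv]; rfl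
  have hsurj := (LinearMap.injective_iff_surjective_of_finrank_eq_finrank
    (Subspace.dual_finrank_eq (K := ℝ) (V := E x)).symm).1 hinj
  obtain ⟨g, hg⟩ := hsurj φ
  exact ⟨g, fun w => by rw [hg]⟩

variable {f h : B → ℝ} {x : B}

/-- `ρ` vanishes on differentials of functions. -/
theorem anchorDeriv_gradient (hD : IsCourantAlgebroid F D) (hf : IsSmoothFun m f)
    (hh : IsSmoothFun m h) {g : E x} (hg : ∀ w, D.pairing x g w = D.anchorDeriv f x w) :
    D.anchorDeriv h x g = 0 := by
  have hp := hD.isPreCourant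
  -- The gradient of ⟨u, v⟩ is [u, v] + [v, u], whose anchor is the sum of a commutator and its
  -- opposite.
  have key : ∀ u v : ∀ b, E b, D.IsSmooth u → D.IsSmooth v → ∀ w : E x,
      (∀ z, D.pairing x w z = D.anchorDeriv (D.pair u v) x z) → D.anchorDeriv h x w = 0 := by
    intro u v hu hv w hw
    have h1 : D.bracket u v x + D.bracket v u x = w := by
      rw [← sub_eq_zero]
      refine hD.pairing_nondegenerate x _ fun z => ?_
      obtain ⟨z, hz, rfl⟩ := hD.exists_section x z
      have := congrFun (hD.bracket_add_swap u v z hu hv hz) x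
      rw [map_sub, LinearMap.sub_apply, hw, sub_eq_zero]
      exact this
    have h2 := hD.deriv_bracket hu hv hh x
    have h3 := hD.deriv_bracket hv hu hh x
    rw [deriv_apply] at h2 h3
    rw [← h1, map_add, h2, h3]
    ring
  by_cases hx : ∀ w : E x, w = 0
  · rw [hx g, map_zero]
  push Not at hx
  obtain ⟨u, hu0⟩ := hx
  have : ∃ v, D.pairing x u v ≠ 0 := by
    by_contra hcon
    push Not at hcon
    exact hu0 (hD.pairing_nondegenerate x u hcon)
  obtain ⟨v, huv⟩ := this
  obtain ⟨u, hu, rfl⟩ := hD.exists_section x u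
  obtain ⟨v, hv, rfl⟩ := hD.exists_section x v
  obtain ⟨w, hw⟩ := hD.exists_dual_vector x (D.anchorDeriv (D.pair u v) x)
  have h1 := key u v hu hv w hw
  -- The gradient of ⟨fu, v⟩ is ⟨u, v⟩ times that of f plus f times that of ⟨u, v⟩; since ⟨u, v⟩ is
  -- nonzero at x, the case of a general f follows.
  have h2 := key (fsmul f u) v (hp.fsmul f u hf hu) hv (D.pair u v x • g + f x • w) (by
    intro z
    obtain ⟨z, hz, rfl⟩ := hD.exists_section x z
    rw [← deriv_apply, deriv_congr (Filter.Eventually.of_forall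
      (fun y => pair_fsmul_left f u v y)), deriv_mul hf (hp.pair_smooth u v hu hv),
      map_add, LinearMap.add_apply, map_smul, map_smul, LinearMap.smul_apply, LinearMap.smul_apply,
      hg, hw, smul_eq_mul, smul_eq_mul, deriv_apply, deriv_apply]
    ring)
  rw [map_add, map_smul, map_smul, h1, smul_zero, add_zero, smul_eq_mul] at h2
  exact (mul_eq_zero.1 h2).resolve_left huv

variable {ι : Type*} [Fintype ι] [DecidableEq ι] {e : ι → ∀ b, E b} {A : ι → ι → B → ℝ}

/-- The bracket of two combinations of sections which at `x` are sections of the family itself. -/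
theorem bracket_comb (hD : IsCourantAlgebroid F D) (he : ∀ a, D.IsSmooth (e a))
    (hA : ∀ i a, IsSmoothFun m (A i a)) (hAx : ∀ i a, A i a x = if i = a then 1 else 0)
    {ε : ι → ℝ} (hε : ∀ a b, D.pair (e a) (e b) x = if a = b then ε a else 0)
    {G : ι → ι → E x} (hG : ∀ i a w, D.pairing x (G i a) w = D.anchorDeriv (A i a) x w) (a b : ι) :
    D.bracket (∑ c, fsmul (A a c) (e c)) (∑ d, fsmul (A b d) (e d)) x =
      D.bracket (e a) (e b) x +
        ∑ d, (D.deriv (e a) (A b d) x - D.deriv (e b) (A a d) x) • e d x + ε b • G a b := by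
  have hp := hD.isPreCourant
  have hg : D.IsSmooth (∑ c, fsmul (A a c) (e c)) := hp.comb (hA a) he
  have hgx : (∑ c, fsmul (A a c) (e c)) x = e a x := by
    simp [Finset.sum_apply, fsmul, hAx]
  rw [← sub_eq_zero]
  refine hD.pairing_nondegenerate x _ fun w => ?_
  obtain ⟨w, hw, rfl⟩ := hD.exists_section x w
  rw [map_sub, LinearMap.sub_apply, sub_eq_zero]
  change D.pair _ w x = _
  have h1 : D.pair (D.bracket (∑ c, fsmul (A a c) (e c)) (∑ d, fsmul (A b d) (e d))) w x =
      D.pair (D.bracket (∑ c, fsmul (A a c) (e c)) (e b)) w x +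
        ∑ d, D.deriv (e a) (A b d) x * D.pair (e d) w x := by
    rw [hD.bracket_sum_right _ (fun d => hp.fsmul _ _ (hA b d) (he d)) hg, pair_sum_left]
    have : ∀ d, D.pair (D.bracket (∑ c, fsmul (A a c) (e c)) (fsmul (A b d) (e d))) w x =
        A b d x * D.pair (D.bracket (∑ c, fsmul (A a c) (e c)) (e d)) w x +
          D.deriv (e a) (A b d) x * D.pair (e d) w x := by
      intro d
      rw [CourantData.pair, hD.bracket_fsmul_right hg (hA b d) (he d), deriv_congr_left hgx]
      simp [CourantData.pair]
    simp_rw [this, Finset.sum_add_distrib, hAx]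
    simp
  -- The Leibniz rule in the first argument contributes the gradients of A a c with weight ⟨e_c,
  -- e_b⟩, and orthogonality leaves only ε b times that of A a b.
  have h2 : D.pair (D.bracket (∑ c, fsmul (A a c) (e c)) (e b)) w x =
      D.pair (D.bracket (e a) (e b)) w x - ∑ c, D.deriv (e b) (A a c) x * D.pair (e c) w x +
        ε b * D.deriv w (A a b) x := by
    rw [hD.bracket_sum_left _ (fun d => hp.fsmul _ _ (hA a d) (he d)) (he b), pair_sum_left]
    simp_rw [hD.pair_bracket_fsmul_left (he _) (hA a _) (he b) hw, Finset.sum_add_distrib,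
      Finset.sum_sub_distrib, hAx, hε]
    simp
  rw [h1, h2]
  simp only [map_add, LinearMap.add_apply, map_sum, LinearMap.sum_apply, map_smul,
    LinearMap.smul_apply, smul_eq_mul, hG, sub_mul, Finset.sum_sub_distrib, CourantData.pair,
    deriv_apply]
  ring

/-- Invariance of `frameScalar` under changes of orthogonal basis which are trivial at `x`. -/
theorem frameScalar_comb (hD : IsCourantAlgebroid F D) (hdiv : D.IsDivergence div)
    (he : ∀ a, D.IsSmooth (e a)) (hA : ∀ i a, IsSmoothFun m (A i a))
    (hAx : ∀ i a, A i a x = if i = a then 1 else 0) {ε η : ι → ℝ} (hη : ∀ a, ε a * η a = 1)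
    (hε : ∀ᶠ y in 𝓝 x, ∀ a b, D.pair (e a) (e b) y = if a = b then ε a else 0)
    (hg : ∀ᶠ y in 𝓝 x, ∀ i j, ∑ a, ε a * (A i a y * A j a y) = if i = j then ε i else 0) :
    D.frameScalar div (fun i => ∑ a, fsmul (A i a) (e a))
      (fun i => η i • ∑ a, fsmul (A i a) (e a)) x =
    D.frameScalar div e (fun a => η a • e a) x := by
  have hp := hD.isPreCourant
  set g : ι → ∀ b, E b := fun i => ∑ a, fsmul (A i a) (e a) with hgdef
  have hgs : ∀ i, D.IsSmooth (g i) := fun i => hp.comb (hA i) he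
  have hgx : ∀ i, g i x = e i x := fun i => by
    simp [hgdef, Finset.sum_apply, fsmul, hAx]
  have hη0 : ∀ a, η a ≠ 0 := fun a h => by simpa [h] using hη a
  have hε0 : ∀ a, ε a ≠ 0 := fun a h => by simpa [h] using hη a
  choose G hG using fun i a => hD.exists_dual_vector x (D.anchorDeriv (A i a) x)
  -- First and second derivatives of A at x, with the last index lowered by the diagonal metric ε.
  set θ : ι → ι → ι → ℝ := fun c i j => ε j * D.deriv (e c) (A i j) x with hθdef
  set T : ι → ι → ι → ι → ℝ := fun c d i j =>
    ε j * D.deriv (e c) (D.deriv (e d) (A i j)) x with hTdef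
  set c : ι → ι → ι → ℝ := fun a b d => D.pair (D.bracket (e a) (e b)) (e d) x with hcdef
  have hs : ∀ c i j, D.deriv (e c) (A i j) x = η j * θ c i j := fun c i j => by
    simp only [hθdef]; rw [← mul_assoc, mul_comm (η j), hη, one_mul]
  have ht : ∀ c d i j, D.deriv (e c) (D.deriv (e d) (A i j)) x = η j * T c d i j :=
    fun c d i j => by simp only [hTdef]; rw [← mul_assoc, mul_comm (η j), hη, one_mul]
  have hdd : ∀ c i j, IsSmoothFun m (D.deriv (e c) (A i j)) := fun c i j =>
    hp.deriv_smooth (he c) (hA i j)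
  -- first derivative of the orthogonality relation
  have hd1 : ∀ c, ∀ y, (∀ᶠ z in 𝓝 y, ∀ i j, ∑ a, ε a * (A i a z * A j a z) =
      if i = j then ε i else 0) → ∀ i j,
      ∑ a, ε a * (A i a y * D.deriv (e c) (A j a) y + A j a y * D.deriv (e c) (A i a) y) = 0 := by
    intro c y hy i j
    have h1 : D.deriv (e c) (fun z => ∑ a, ε a * (A i a z * A j a z)) y = 0 := by
      rw [deriv_congr (hy.mono fun z hz => hz i j)]
      exact CourantData.deriv_const _ _ _
    rw [CourantData.deriv_sum (f := fun a z => ε a * (A i a z * A j a z)) _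
      (fun a => isSmoothFun_const_mul _ (isSmoothFun_mul (hA i a) (hA j a)))] at h1
    rw [← h1]
    refine Finset.sum_congr rfl fun a _ => ?_
    rw [CourantData.deriv_const_mul _ (isSmoothFun_mul (hA i a) (hA j a)), CourantData.deriv_mul (hA i a) (hA j a)]
  -- At x the matrix A is the identity, so the differentiated relation A ε Aᵗ = ε says that θ takes
  -- values in the orthogonal Lie algebra.
  have hθ : ∀ c i j, θ c i j = -θ c j i := by
    intro c i j
    have := hd1 c x hg i j
    simp only [hAx, ite_mul, one_mul, zero_mul, mul_add, mul_ite, mul_zero, Finset.sum_add_distrib,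
      Finset.sum_ite_eq, Finset.mem_univ, if_true] at this
    simp only [hθdef]
    linarith
  -- The relation `hd1` holds at every point near x, so it can be differentiated a second time.
  have hT : ∀ c d i j, T c d i j + T c d j i =
      -∑ a, η a * (θ c i a * θ d j a + θ d i a * θ c j a) := by
    intro c d i j
    have h1 : D.deriv (e c) (fun y => ∑ a, ε a * (A i a y * D.deriv (e d) (A j a) y +
        A j a y * D.deriv (e d) (A i a) y)) x = 0 := by
      rw [deriv_congr (hg.eventually_nhds.mono fun y hy => hd1 d y hy i j)]
      exact CourantData.deriv_const _ _ _
    have hsm : ∀ a, IsSmoothFun m fun y => A i a y * D.deriv (e d) (A j a) y +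
        A j a y * D.deriv (e d) (A i a) y := fun a =>
      isSmoothFun_add (isSmoothFun_mul (hA i a) (hdd d j a)) (isSmoothFun_mul (hA j a) (hdd d i a))
    rw [CourantData.deriv_sum (f := fun a y => ε a * (A i a y * D.deriv (e d) (A j a) y +
        A j a y * D.deriv (e d) (A i a) y)) _ (fun a => isSmoothFun_const_mul _ (hsm a))] at h1
    have h2 : ∀ a, D.deriv (e c) (fun y => ε a * (A i a y * D.deriv (e d) (A j a) y +
        A j a y * D.deriv (e d) (A i a) y)) x = η a * (θ c i a * θ d j a + θ d i a * θ c j a) +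
        ((if i = a then T c d j a else 0) + if j = a then T c d i a else 0) := by
      intro a
      rw [CourantData.deriv_const_mul _ (hsm a), CourantData.deriv_add (isSmoothFun_mul (hA i a) (hdd d j a))
        (isSmoothFun_mul (hA j a) (hdd d i a)), CourantData.deriv_mul (hA i a) (hdd d j a),
        CourantData.deriv_mul (hA j a) (hdd d i a), ht, ht, hs, hs, hs, hs, hAx, hAx]
      have : ε a = (η a)⁻¹ := eq_inv_of_mul_eq_one_left (hη a)
      rw [this]
      have := hη0 a
      split_ifs <;> field_simp <;> ring
    simp_rw [h2, Finset.sum_add_distrib] at h1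
    simp only [Finset.sum_ite_eq, Finset.mem_univ, if_true] at h1
    simp only [Finset.sum_add_distrib, mul_add] at h1 ⊢
    linarith
  have hεx := hε.self_of_nhds
  have hconst : ∀ w a b, D.deriv w (D.pair (e a) (e b)) x = 0 := fun w a b => by
    rw [deriv_congr (hε.mono fun y hy => hy a b)]
    exact CourantData.deriv_const _ _ _
  have hc : ∀ a b d, c a b d = -c b a d := fun a b d => by
    simp only [hcdef]
    rw [hD.pair_bracket_swap (he a) (he b) (he d), hconst]; ring
  have hc' : ∀ a b d, c a b d = -c a d b := fun a b d => by
    have := congrFun (hD.deriv_pair (e a) (e b) (e d) (he a) (he b) (he d)) x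
    rw [hconst, Pi.add_apply, hp.pair_comm (e b)] at this
    simp only [hcdef]; linarith
  have hid := frame_change_identity (η := η) hθ T hT (fun a => div (e a) x) c hc hc'
  -- the three parts of `frameScalar`
  have hdivg : ∀ i, div (g i) = fun y => ∑ a, (A i a y * div (e a) y + D.deriv (e a) (A i a) y) :=
    fun i => funext fun y => hp.div_comb hdiv _ (hA i) he y
  have hdivgx : ∀ i, div (g i) x = div (e i) x + ∑ a, η a * θ a i a := fun i => by
    rw [hdivg]
    simp only [Finset.sum_add_distrib, hAx, hs]
    simp
  have hderivg : ∀ i, D.deriv (e i) (div (g i)) x = D.deriv (e i) (div (e i)) x +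
      ∑ a, η a * (θ i i a * div (e a) x + T i a i a) := fun i => by
    have hsm : ∀ a, IsSmoothFun m fun y => A i a y * div (e a) y + D.deriv (e a) (A i a) y :=
      fun a => isSmoothFun_add (isSmoothFun_mul (hA i a) (hdiv.contMDiff _ (he a))) (hdd a i a)
    rw [hdivg, CourantData.deriv_sum
      (f := fun a y => A i a y * div (e a) y + D.deriv (e a) (A i a) y) _ hsm]
    have : ∀ a, D.deriv (e i) (fun y => A i a y * div (e a) y + D.deriv (e a) (A i a) y) x =
        (if i = a then D.deriv (e i) (div (e a)) x else 0) +
          η a * (θ i i a * div (e a) x + T i a i a) := fun a => by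
      rw [CourantData.deriv_add (isSmoothFun_mul (hA i a) (hdiv.contMDiff _ (he a))) (hdd a i a),
        CourantData.deriv_mul (hA i a) (hdiv.contMDiff _ (he a)), ht, hs, hAx]
      split_ifs <;> ring
    simp_rw [this, Finset.sum_add_distrib]
    simp
  have hGe : ∀ i a d, D.pairing x (G i a) (e d x) = η a * θ d i a := fun i a d => by
    rw [hG, ← hs]; rfl
  -- Gradients are orthogonal to each other, since pairing with a gradient is a derivative along the
  -- anchor, and the anchor kills gradients.
  have hGG : ∀ i a j b, D.pairing x (G i a) (G j b) = 0 := fun i a j b => by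
    rw [hG]; exact hD.anchorDeriv_gradient (hA j b) (hA i a) (hG j b)
  -- Second derivatives enter the square of the bracket only here: ρ([e_a, e_b]) is the commutator
  -- of ρ(e_a) and ρ(e_b).
  have hGb : ∀ a b, D.pairing x (G a b) (D.bracket (e a) (e b) x) = η b * (T a b a b - T b a a b) :=
    fun a b => by
      rw [hG, ← deriv_apply, hD.deriv_bracket (he a) (he b) (hA a b), ht, ht]; ring
  have hbr := fun a b => hD.bracket_comb he hA hAx hεx hG a b
  set K : ι → ι → E x := fun a b =>
    ∑ d, (D.deriv (e a) (A b d) x - D.deriv (e b) (A a d) x) • e d x with hKdef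
  have hKw : ∀ a b (w : E x), D.pairing x (K a b) w =
      ∑ d, η d * ((θ a b d - θ b a d) * D.pairing x (e d x) w) := fun a b w => by
    simp only [hKdef, map_sum, LinearMap.sum_apply, map_smul, LinearMap.smul_apply, smul_eq_mul, hs]
    exact Finset.sum_congr rfl fun d _ => by ring
  have hKe : ∀ a b d, D.pairing x (K a b) (e d x) = θ a b d - θ b a d := fun a b d => by
    rw [hKw]
    have : ∀ k, D.pairing x (e k x) (e d x) = if k = d then ε k else 0 := fun k => hεx k d
    simp_rw [this]
    simp only [mul_ite, mul_zero, Finset.sum_ite_eq', Finset.mem_univ, if_true]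
    rw [mul_comm (_ - _), ← mul_assoc, mul_comm (η d), hη, one_mul]
  have hεη : ∀ b, ε b = (η b)⁻¹ := fun b => eq_inv_of_mul_eq_one_left (hη b)
  have hbb : ∀ a b, D.pair (D.bracket (g a) (g b)) (D.bracket (g a) (g b)) x =
      D.pair (D.bracket (e a) (e b)) (D.bracket (e a) (e b)) x +
      (2 * ∑ d, η d * ((θ a b d - θ b a d) * c a b d)
          + 2 * (T a b a b - T b a a b) + ∑ d, η d * (θ a b d - θ b a d) ^ 2
          + 2 * ∑ d, η d * ((θ a b d - θ b a d) * θ d a b)) := fun a b => by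
    rw [CourantData.pair, hbr]
    set β := D.bracket (e a) (e b) x
    have k1 : D.pairing x (K a b) β = ∑ d, η d * ((θ a b d - θ b a d) * c a b d) := by
      rw [hKw]
      exact Finset.sum_congr rfl fun d _ => by rw [hD.pairing_symm]; rfl
    have k2 : D.pairing x (K a b) (K a b) = ∑ d, η d * (θ a b d - θ b a d) ^ 2 := by
      rw [hKw]
      exact Finset.sum_congr rfl fun d _ => by rw [hD.pairing_symm, hKe]; ring
    have k3 : D.pairing x (K a b) (G a b) = η b * ∑ d, η d * ((θ a b d - θ b a d) * θ d a b) := by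
      rw [hKw, Finset.mul_sum]
      exact Finset.sum_congr rfl fun d _ => by rw [hD.pairing_symm, hGe]; ring
    simp only [map_add, LinearMap.add_apply, map_smul, LinearMap.smul_apply, smul_eq_mul]
    rw [hD.pairing_symm x β (K a b), hD.pairing_symm x β (G a b), hD.pairing_symm x (G a b) (K a b),
      k1, k2, k3, hGb, hGG, hεη, CourantData.pair]
    have := hη0 b
    field_simp
    ring
  have hcg : ∀ a b d, D.pair (D.bracket (g a) (g b)) (g d) x =
      c a b d + θ a b d - θ b a d + θ d a b := fun a b d => by
    rw [CourantData.pair, hbr, hgx]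
    simp only [map_add, LinearMap.add_apply, map_smul, LinearMap.smul_apply, smul_eq_mul]
    rw [hKe, hGe, ← mul_assoc, hη, one_mul]
    simp only [hcdef, CourantData.pair]
    ring
  -- reorganize
  have hform : ∀ u : ι → ∀ b, E b, (∀ i, D.IsSmooth (u i)) →
      D.frameScalar div u (fun i => η i • u i) x =
      ∑ i, η i * (2 * D.deriv (u i) (div (u i)) x + div (u i) x ^ 2)
      - 1 / 2 * ∑ a, ∑ b, η a * η b * D.pair (D.bracket (u a) (u b)) (D.bracket (u a) (u b)) x
      + 1 / 3 * ∑ a, ∑ b, ∑ d, η a * η b * η d * D.pair (D.bracket (u a) (u b)) (u d) x ^ 2 := by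
    intro u hu
    have hbs : ∀ a b, D.bracket (η a • u a) (η b • u b) = (η a * η b) • D.bracket (u a) (u b) :=
      fun a b => by
        rw [hD.bracket_smul_left _ _ _ (hu a) (hp.smul _ (hu b)),
          hD.bracket_smul_right _ _ _ (hu a) (hu b), smul_smul]
    unfold CourantData.frameScalar
    congr 1
    · congr 1
      · refine Finset.sum_congr rfl fun i _ => ?_
        rw [deriv_smul_left, hdiv.smul _ _ (hu i)]
        simp only [Pi.smul_apply, smul_eq_mul]; ring
      · congr 1
        refine Finset.sum_congr rfl fun a _ => Finset.sum_congr rfl fun b _ => ?_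
        rw [hbs, pair_smul_right]
    · congr 1
      rw [Finset.sum_comm]
      refine Finset.sum_congr rfl fun a _ => ?_
      rw [Finset.sum_comm]
      refine Finset.sum_congr rfl fun b _ => Finset.sum_congr rfl fun d _ => ?_
      rw [hbs, pair_smul_right, pair_smul_left, hp.pair_comm (u d)]; ring
  rw [hform g hgs, hform e he]
  simp_rw [hbb, hcg, hdivgx, fun i => (deriv_congr_left (hgx i) :
    D.deriv (g i) (div (g i)) x = D.deriv (e i) (div (g i)) x), hderivg]
  have r1 : ∑ i, η i * (2 * (D.deriv (e i) (div (e i)) x +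
      ∑ a, η a * (θ i i a * div (e a) x + T i a i a)) + (div (e i) x + ∑ a, η a * θ a i a) ^ 2) =
      ∑ i, η i * (2 * D.deriv (e i) (div (e i)) x + div (e i) x ^ 2) +
      ∑ i, η i * (2 * ∑ a, η a * (θ i i a * div (e a) x + T i a i a) +
        2 * div (e i) x * ∑ a, η a * θ a i a + (∑ a, η a * θ a i a) ^ 2) := by
    rw [← Finset.sum_add_distrib]
    exact Finset.sum_congr rfl fun i _ => by ring
  have r2 : ∀ X Y : ι → ι → ℝ, ∑ a, ∑ b, η a * η b * (X a b + Y a b) =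
      ∑ a, ∑ b, η a * η b * X a b + ∑ a, ∑ b, η a * η b * Y a b := fun X Y => by
    simp only [mul_add, Finset.sum_add_distrib]
  have r3 : ∀ X Y : ι → ι → ι → ℝ, ∑ a, ∑ b, ∑ d, η a * η b * η d * (X a b d - Y a b d) =
      ∑ a, ∑ b, ∑ d, η a * η b * η d * X a b d - ∑ a, ∑ b, ∑ d, η a * η b * η d * Y a b d :=
    fun X Y => by simp only [mul_sub, Finset.sum_sub_distrib]
  rw [r3 (fun a b d => (c a b d + θ a b d - θ b a d + θ d a b) ^ 2) fun a b d => c a b d ^ 2] at hid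
  rw [r1, r2]
  simp only [hcdef] at hid ⊢
  linarith

end IsCourantAlgebroid

end Courant

/-! ### The inverse function theorem -/

section InverseFunction

variable {E E' : Type*} [NormedAddCommGroup E] [NormedSpace ℝ E] [NormedAddCommGroup E']
  [NormedSpace ℝ E'] [CompleteSpace E]

/-- The inverse function theorem, with smoothness of the local inverse on a neighbourhood. -/
theorem exists_smooth_local_inverse {f : E → E'} {a : E}
    (hf : ∀ᶠ y in 𝓝 a, ContDiffAt ℝ ∞ f y) (f' : E ≃L[ℝ] E') (hf' : HasFDerivAt f (f' : E →L[ℝ] E') a) :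
    ∃ g : E' → E, g (f a) = a ∧ (∀ᶠ y in 𝓝 (f a), ContDiffAt ℝ ∞ g y ∧ f (g y) = y) ∧
      ∀ᶠ z in 𝓝 a, g (f z) = z := by
  have hfa : ContDiffAt ℝ ∞ f a := hf.self_of_nhds
  have hs : HasStrictFDerivAt f (f' : E →L[ℝ] E') a := hfa.hasStrictFDerivAt' hf' (by simp)
  set φ := HasStrictFDerivAt.toOpenPartialHomeomorph f hs with hφ
  have hφc : (φ : E → E') = f := hs.toOpenPartialHomeomorph_coe
  have ha : a ∈ φ.source := hs.mem_toOpenPartialHomeomorph_source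
  have hga : φ.symm (f a) = a := by
    have := φ.left_inv ha
    rwa [hφc] at this
  have hfat : f a ∈ φ.target := by
    have := φ.map_source ha
    rwa [hφc] at this
  refine ⟨φ.symm, hga, ?_, ?_⟩
  · have h1 : ∀ᶠ y in 𝓝 a, fderiv ℝ f y ∈ Set.range (ContinuousLinearEquiv.toContinuousLinearMap :
        (E ≃L[ℝ] E') → E →L[ℝ] E') := by
      have hc := hfa.continuousAt_fderiv (by simp)
      exact hc (by rw [hf'.fderiv]; exact f'.nhds)
    have hcont : Filter.Tendsto φ.symm (𝓝 (f a)) (𝓝 a) := by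
      have := φ.continuousAt_symm hfat
      rwa [ContinuousAt, hga] at this
    filter_upwards [hcont.eventually (hf.and h1), φ.open_target.mem_nhds hfat] with y hy hyt
    obtain ⟨hy1, L, hL⟩ := hy
    refine ⟨φ.contDiffAt_symm hyt (f₀' := L) ?_ ?_, ?_⟩
    · rw [hφc, hL]
      exact (hy1.differentiableAt (by simp)).hasFDerivAt
    · rwa [hφc]
    · have := φ.right_inv hyt
      rwa [hφc] at this
  · filter_upwards [φ.open_source.mem_nhds ha] with z hz
    have := φ.left_inv hz
    rwa [hφc] at this

end InverseFunction

/-! ### Smooth inversion and congruence of matrix functions -/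

section SmoothMatrices

variable {m : ℕ} {B : Type*} [TopologicalSpace B] [ChartedSpace (EuclideanSpace ℝ (Fin m)) B]
  [IsManifold (𝓡 m) ∞ B] {ι : Type*} [Fintype ι] [DecidableEq ι] {x : B}

theorem contMDiffAt_det {G : ι → ι → B → ℝ} (hG : ∀ i j, ContMDiffAt (𝓡 m) 𝓘(ℝ, ℝ) ∞ (G i j) x) :
    ContMDiffAt (𝓡 m) 𝓘(ℝ, ℝ) ∞ (fun y => (Matrix.of fun i j => G i j y).det) x := by
  simp only [Matrix.det_apply']
  refine ContMDiffAt.sum fun σ _ => ContMDiffAt.mul contMDiffAt_const ?_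
  exact contMDiffAt_finsetProd fun i _ => hG _ _

theorem contMDiffAt_adjugate {G : ι → ι → B → ℝ}
    (hG : ∀ i j, ContMDiffAt (𝓡 m) 𝓘(ℝ, ℝ) ∞ (G i j) x) (i j : ι) :
    ContMDiffAt (𝓡 m) 𝓘(ℝ, ℝ) ∞ (fun y => (Matrix.of fun i j => G i j y).adjugate i j) x := by
  simp only [Matrix.adjugate_apply]
  have := contMDiffAt_det (x := x) (G := fun k l y =>
    (Matrix.of fun i j => G i j y).updateRow j (Pi.single i 1) k l) (m := m) (by
      intro k l
      by_cases h : k = j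
      · subst h
        simpa using contMDiffAt_const
      · simpa [Matrix.updateRow_ne h] using hG k l)
  exact this

/-- Cramer's rule: the entries of the inverse are cofactors divided by a determinant that stays
nonzero near x, cut off to global functions. -/
theorem exists_smooth_matrix_inverse [T2Space B] {G : ι → ι → B → ℝ}
    (hG : ∀ᶠ y in 𝓝 x, ∀ i j, ContMDiffAt (𝓡 m) 𝓘(ℝ, ℝ) ∞ (G i j) y)
    (hdet : (Matrix.of fun i j => G i j x).det ≠ 0) :
    ∃ A : ι → ι → B → ℝ, (∀ i j, IsSmoothFun m (A i j)) ∧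
      ∀ᶠ y in 𝓝 x, (Matrix.of fun i j => A i j y) * (Matrix.of fun i j => G i j y) = 1 := by
  have hne : ∀ᶠ y in 𝓝 x, (Matrix.of fun i j => G i j y).det ≠ 0 :=
    (contMDiffAt_det (fun i j => hG.self_of_nhds i j)).continuousAt.eventually_ne hdet
  have hA : ∀ i j, ∃ a : B → ℝ, IsSmoothFun m a ∧
      a =ᶠ[𝓝 x] fun y => ((Matrix.of fun i j => G i j y).det)⁻¹ *
        (Matrix.of fun i j => G i j y).adjugate i j := by
    intro i j
    refine exists_global_extension ?_
    filter_upwards [hG, hne] with y hy hy'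
    exact ((contMDiffAt_det hy).inv₀ hy').mul (contMDiffAt_adjugate hy i j)
  choose A hA hA' using hA
  refine ⟨A, hA, ?_⟩
  have : ∀ᶠ y in 𝓝 x, ∀ i j, A i j y = ((Matrix.of fun i j => G i j y).det)⁻¹ *
        (Matrix.of fun i j => G i j y).adjugate i j :=
    Filter.eventually_all.2 fun i => Filter.eventually_all.2 fun j => hA' i j
  filter_upwards [this, hne] with y hy hy'
  have h1 : (Matrix.of fun i j => A i j y) = ((Matrix.of fun i j => G i j y).det)⁻¹ •
      (Matrix.of fun i j => G i j y).adjugate := by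
    ext i j; simp [hy]
  rw [h1, Matrix.smul_mul, Matrix.adjugate_mul, smul_smul, inv_mul_cancel₀ hy', one_smul]

/-- The map `X ↦ 2 X + X K X` on square matrices. -/
def quadMap (K : Matrix ι ι ℝ) (X : ι → ι → ℝ) : ι → ι → ℝ :=
  fun i j => 2 * X i j + ∑ k, ∑ l, X i k * K k l * X l j

theorem quadMap_eq (K : Matrix ι ι ℝ) (X : ι → ι → ℝ) :
    Matrix.of (quadMap K X) = (2 : ℝ) • Matrix.of X + Matrix.of X * K * Matrix.of X := by
  ext i j
  simp only [quadMap, Matrix.of_apply, Matrix.add_apply, Matrix.smul_apply, smul_eq_mul,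
    Matrix.mul_apply, Finset.sum_mul]
  rw [Finset.sum_comm]

theorem contDiff_quadMap (K : Matrix ι ι ℝ) : ContDiff ℝ ∞ (quadMap K) := by
  have h : ∀ i j, ContDiff ℝ ∞ fun X : ι → ι → ℝ => X i j := fun i j =>
    contDiff_apply_apply ℝ ℝ i j
  refine contDiff_pi.2 fun i => contDiff_pi.2 fun j => ?_
  refine (contDiff_const.mul (h i j)).add (ContDiff.sum fun k _ => ContDiff.sum fun l _ => ?_)
  exact ((h i k).mul contDiff_const).mul (h l j)

/-- The quadratic part has no first-order term at 0, so the map is a local diffeomorphism there. -/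
theorem hasFDerivAt_quadMap (K : Matrix ι ι ℝ) :
    HasFDerivAt (quadMap K) ((ContinuousLinearEquiv.smulLeft (Units.mk0 (2 : ℝ) two_ne_zero) :
      (ι → ι → ℝ) ≃L[ℝ] (ι → ι → ℝ)) : (ι → ι → ℝ) →L[ℝ] (ι → ι → ℝ)) 0 := by
  have h : ∀ i j, HasFDerivAt (fun X : ι → ι → ℝ => X i j)
      ((ContinuousLinearMap.proj (R := ℝ) (φ := fun _ : ι => ℝ) j : (ι → ℝ) →L[ℝ] ℝ).comp
        (ContinuousLinearMap.proj (R := ℝ) (φ := fun _ : ι => ι → ℝ) i :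
          (ι → ι → ℝ) →L[ℝ] (ι → ℝ))) 0 := fun i j =>
    ((ContinuousLinearMap.proj (R := ℝ) (φ := fun _ : ι => ℝ) j : (ι → ℝ) →L[ℝ] ℝ).comp
      (ContinuousLinearMap.proj (R := ℝ) (φ := fun _ : ι => ι → ℝ) i :
        (ι → ι → ℝ) →L[ℝ] (ι → ℝ))).hasFDerivAt (x := 0)
  refine hasFDerivAt_pi'.2 fun i => hasFDerivAt_pi'.2 fun j => ?_
  have h1 := ((h i j).const_mul 2).add (HasFDerivAt.fun_sum (u := Finset.univ) fun k _ =>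
    HasFDerivAt.fun_sum (u := Finset.univ) fun l _ => ((h i k).mul_const (K k l)).mul (h l j))
  refine h1.congr_fderiv ?_
  ext X
  simp

/-- A smooth symmetric matrix function is near `x` congruent to its value at `x`. -/
theorem exists_smooth_congruence [T2Space B] {G : ι → ι → B → ℝ} (hG : ∀ i j, IsSmoothFun m (G i j))
    (hsymm : ∀ i j y, G i j y = G j i y) (hdet : (Matrix.of fun i j => G i j x).det ≠ 0) :
    ∃ A : ι → ι → B → ℝ, (∀ i j, IsSmoothFun m (A i j)) ∧ (∀ i j, A i j x = if i = j then 1 else 0) ∧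
      ∀ᶠ y in 𝓝 x, ∀ i j, ∑ k, ∑ l, A i k y * A j l y * G k l y = G i j x := by
  -- With K = G0⁻¹ and X symmetric, (1 + XK) G0 (1 + XK)ᵗ = G0 + 2X + XKX. It suffices to solve 2X +
  -- XKX = G - G0 smoothly near X = 0, by the inverse function theorem; A is then (1 + XK)⁻¹.
  set G0 : Matrix ι ι ℝ := Matrix.of fun i j => G i j x with hG0
  set K := G0⁻¹ with hK
  have hG0u : IsUnit G0.det := isUnit_iff_ne_zero.2 hdet
  have hG0t : G0.transpose = G0 := by ext i j; simp [hG0, hsymm i j]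
  have hKt : K.transpose = K := by rw [hK, Matrix.transpose_nonsing_inv, hG0t]
  have hKG : K * G0 = 1 := Matrix.nonsing_inv_mul _ hG0u
  obtain ⟨g, hg0, hg1, hg2⟩ := exists_smooth_local_inverse
    (Filter.Eventually.of_forall fun y => (contDiff_quadMap K).contDiffAt) _ (hasFDerivAt_quadMap K)
  have hq0 : quadMap K 0 = 0 := by ext i j; simp [quadMap]
  rw [hq0] at hg0 hg1
  have htr : Continuous fun X : ι → ι → ℝ => fun i j => X j i := by fun_prop
  have hg3 : ∀ᶠ z in 𝓝 (0 : ι → ι → ℝ), g (quadMap K fun i j => z j i) = fun i j => z j i :=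
    (htr.tendsto' 0 0 rfl).eventually hg2
  have hgc : Filter.Tendsto g (𝓝 0) (𝓝 0) := by
    have := (hg1.self_of_nhds).1.continuousAt
    rwa [ContinuousAt, hg0] at this
  -- the symmetric difference matrix and its preimage
  set Y : B → ι → ι → ℝ := fun y i j => G i j y - G i j x with hY
  have hYs : ContMDiff (𝓡 m) 𝓘(ℝ, ι → ι → ℝ) ∞ Y :=
    contMDiff_pi_space.2 fun i => contMDiff_pi_space.2 fun j => (hG i j).sub contMDiff_const
  have hYx : Y x = 0 := by ext i j; simp [hY]
  have hYt : Filter.Tendsto Y (𝓝 x) (𝓝 0) := by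
    have := hYs.continuous.continuousAt (x := x)
    rwa [ContinuousAt, hYx] at this
  have hX : ∀ᶠ y in 𝓝 x, ContMDiffAt (𝓡 m) 𝓘(ℝ, ι → ι → ℝ) ∞ (fun y => g (Y y)) y ∧
      quadMap K (g (Y y)) = Y y ∧ ∀ i j, g (Y y) i j = g (Y y) j i := by
    filter_upwards [hYt.eventually hg1, hYt.eventually (hgc.eventually hg3)] with y hy hy3
    refine ⟨hy.1.contMDiffAt.comp y (hYs y), hy.2, fun i j => ?_⟩
    -- Y is symmetric, so the transpose of the solution is also a small solution; local uniqueness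
    -- (`hg3`) makes the solution symmetric.
    have h1 : quadMap K (fun i j => g (Y y) j i) = Y y := by
      have h2 : Matrix.of (quadMap K (fun i j => g (Y y) j i)) =
          (Matrix.of (quadMap K (g (Y y)))).transpose := by
        rw [quadMap_eq, quadMap_eq, Matrix.transpose_add, Matrix.transpose_smul,
          Matrix.transpose_mul, Matrix.transpose_mul, hKt, Matrix.mul_assoc]
        rfl
      rw [hy.2] at h2
      funext i j
      have := congrFun (congrFun h2 i) j
      simp only [Matrix.of_apply, Matrix.transpose_apply] at this
      rw [this]
      simp only [hY, hsymm j i]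
    rw [h1] at hy3
    exact congrFun (congrFun hy3 i) j
  set Q : ι → ι → B → ℝ := fun i j y => (if i = j then 1 else 0) + ∑ k, g (Y y) i k * K k j with hQ
  have hQs : ∀ᶠ y in 𝓝 x, ∀ i j, ContMDiffAt (𝓡 m) 𝓘(ℝ, ℝ) ∞ (Q i j) y := by
    filter_upwards [hX] with y hy i j
    refine contMDiffAt_const.add (ContMDiffAt.sum fun k _ => ContMDiffAt.mul ?_ contMDiffAt_const)
    exact contMDiffAt_pi_space.1 (contMDiffAt_pi_space.1 hy.1 i) k
  have hQm : ∀ y, (Matrix.of fun i j => Q i j y) = 1 + Matrix.of (g (Y y)) * K := by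
    intro y; ext i j
    simp [hQ, Matrix.mul_apply, Matrix.one_apply]
  have hQx : (Matrix.of fun i j => Q i j x) = 1 := by
    rw [hQm, hYx, hg0]; simp
  obtain ⟨A, hA, hAQ⟩ := exists_smooth_matrix_inverse hQs (by rw [hQx]; simp)
  refine ⟨A, hA, ?_, ?_⟩
  · have := hAQ.self_of_nhds
    rw [hQx, mul_one] at this
    intro i j
    have := congrFun (congrFun this i) j
    simpa [Matrix.one_apply] using this
  · filter_upwards [hAQ, hX] with y hy hXy
    set X := Matrix.of (g (Y y)) with hXdef
    set Gy : Matrix ι ι ℝ := Matrix.of fun i j => G i j y with hGy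
    set Ay : Matrix ι ι ℝ := Matrix.of fun i j => A i j y with hAy
    have hXt : X.transpose = X := by ext i j; simp [hXdef, hXy.2.2 i j]
    have h1 : Gy = G0 + ((2 : ℝ) • X + X * K * X) := by
      rw [← quadMap_eq, hXy.2.1]
      ext i j; simp [hGy, hG0, hY]
    have h2 : (1 + X * K) * G0 * (1 + X * K).transpose = Gy := by
      have hGK : G0 * K = 1 := Matrix.mul_nonsing_inv _ hG0u
      rw [Matrix.transpose_add, Matrix.transpose_mul, hKt, hXt, Matrix.transpose_one, h1, two_smul,
        add_mul, mul_assoc X K G0, hKG, mul_add, add_mul, one_mul, add_mul,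
        ← mul_assoc G0, hGK, one_mul, ← mul_assoc]
      simp only [mul_one]
      abel
    rw [hQm] at hy
    have h3 : Ay * Gy * Ay.transpose = G0 := by
      have h4 : (1 + X * K).transpose * Ay.transpose = 1 := by
        rw [← Matrix.transpose_mul, hy, Matrix.transpose_one]
      rw [← h2]
      calc Ay * ((1 + X * K) * G0 * (1 + X * K).transpose) * Ay.transpose
          = (Ay * (1 + X * K)) * G0 * ((1 + X * K).transpose * Ay.transpose) := by
            simp only [mul_assoc]
        _ = G0 := by rw [hy, h4, one_mul, mul_one]
    intro i j
    have := congrFun (congrFun h3 i) j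
    simp only [Matrix.mul_apply, hAy, hGy, hG0, Matrix.of_apply, Matrix.transpose_apply,
      Finset.sum_mul] at this
    rw [← this, Finset.sum_comm]
    refine Finset.sum_congr rfl fun l _ => Finset.sum_congr rfl fun k _ => by ring

end SmoothMatrices

/-! ### Local bases and orthogonalization -/

section Frames

open CourantData

variable {m : ℕ} {B : Type*} [TopologicalSpace B] [ChartedSpace (EuclideanSpace ℝ (Fin m)) B]
  [IsManifold (𝓡 m) ∞ B]
  {E : B → Type*} [∀ b, AddCommGroup (E b)] [∀ b, Module ℝ (E b)]
  {D : CourantData m E} {V : ∀ b, Submodule ℝ (E b)} {U : Set B}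

namespace CourantData.IsFrame

variable {n : ℕ} {e e' : Fin n → ∀ b, E b} {y : B}

theorem mem (hF : D.IsFrame V U e e') (hy : y ∈ U) (a : Fin n) : e a y ∈ V y := by
  rw [← hF.span y hy]
  exact Submodule.subset_span ⟨a, rfl⟩

theorem eq_sum (hF : D.IsFrame V U e e') (hy : y ∈ U) {w : E y} (hw : w ∈ V y) :
    w = ∑ a, D.pairing y (e' a y) w • e a y := by
  rw [← hF.span y hy, Submodule.mem_span_range_iff_exists_fun] at hw
  obtain ⟨c, rfl⟩ := hw
  refine Finset.sum_congr rfl fun a _ => ?_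
  have : ∀ b, D.pairing y (e' a y) (e b y) = if a = b then 1 else 0 := hF.dual y hy a
  simp [this]

theorem eq_zero (hD : IsPreCourant D) (hF : D.IsFrame V U e e') (hy : y ∈ U) {w : E y}
    (hw : w ∈ V y) (h : ∀ a, D.pairing y w (e a y) = 0) : w = 0 := by
  rw [hF.eq_sum hy hw]
  refine Finset.sum_eq_zero fun a _ => ?_
  rw [hF.eq_sum hy (hF.mem_dual y hy a), hD.pairing_symm]
  simp [h]

theorem eq_sum_dual (hD : IsPreCourant D) (hF : D.IsFrame V U e e') (hy : y ∈ U) {w : E y}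
    (hw : w ∈ V y) : w = ∑ a, D.pairing y w (e a y) • e' a y := by
  rw [← sub_eq_zero]
  refine hF.eq_zero hD hy (Submodule.sub_mem _ hw (Submodule.sum_mem _ fun a _ =>
    Submodule.smul_mem _ _ (hF.mem_dual y hy a))) fun b => ?_
  have : ∀ a, D.pairing y (e' a y) (e b y) = if a = b then 1 else 0 := fun a => hF.dual y hy a b
  simp [this]

theorem pairing_eq_sum (hD : IsPreCourant D) (hF : D.IsFrame V U e e') (hy : y ∈ U) {v w : E y}
    (hw : w ∈ V y) : D.pairing y v w = ∑ a, D.pairing y v (e' a y) * D.pairing y w (e a y) := by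
  conv_lhs => rw [hF.eq_sum_dual hD hy hw]
  simp only [map_sum, map_smul, smul_eq_mul, mul_comm]

end CourantData.IsFrame

/-- `e` is an orthogonal basis of `V` over the open set `U`, with constant squares `ε a` and
`η a = (ε a)⁻¹`. -/
structure IsOrthogonalFrame (D : CourantData m E) (V : ∀ b, Submodule ℝ (E b)) (U : Set B) {n : ℕ}
    (e : Fin n → ∀ b, E b) (ε η : Fin n → ℝ) : Prop where
  isOpen : IsOpen U
  smooth : ∀ a, D.IsSmooth (e a)
  linearIndependent : ∀ y ∈ U, LinearIndependent ℝ (fun a => e a y)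
  span : ∀ y ∈ U, Submodule.span ℝ (Set.range fun a => e a y) = V y
  mul_eq_one : ∀ a, ε a * η a = 1
  pair_eq : ∀ y ∈ U, ∀ a b, D.pair (e a) (e b) y = if a = b then ε a else 0

theorem IsOrthogonalFrame.isFrame (hD : IsPreCourant D) {n : ℕ} {e : Fin n → ∀ b, E b}
    {ε η : Fin n → ℝ} (h : IsOrthogonalFrame D V U e ε η) :
    D.IsFrame V U e (fun a => η a • e a) where
  isOpen := h.isOpen
  smooth := h.smooth
  smooth_dual a := hD.smul _ (h.smooth a)
  linearIndependent := h.linearIndependent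
  span := h.span
  const y hy z hz a b := by rw [h.pair_eq y hy, h.pair_eq z hz]
  mem_dual y hy a := by
    rw [← h.span y hy]
    exact Submodule.smul_mem _ _ (Submodule.subset_span ⟨a, rfl⟩)
  dual y hy a b := by
    rw [pair_smul_left, h.pair_eq y hy]
    split_ifs
    · rw [mul_comm, h.mul_eq_one]
    · rw [mul_zero]

/-- Sections with non-degenerate orthogonal Gram matrix at a point can be made orthogonal near that
point. -/
theorem exists_orthogonalFrame [T2Space B] (hD : IsPreCourant D) {x : B} (hU : IsOpen U)
    (hx : x ∈ U) {n : ℕ} {s : Fin n → ∀ b, E b} (hs : ∀ i, D.IsSmooth (s i))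
    (hli : ∀ y ∈ U, LinearIndependent ℝ (fun i => s i y))
    (hspan : ∀ y ∈ U, Submodule.span ℝ (Set.range fun i => s i y) = V y)
    (hnd : ∀ v ∈ V x, (∀ w ∈ V x, D.pairing x v w = 0) → v = 0) :
    ∃ (U' : Set B) (e : Fin n → ∀ b, E b) (ε η : Fin n → ℝ), U' ⊆ U ∧ x ∈ U' ∧
      IsOrthogonalFrame D V U' e ε η := by
  have hfr : ∀ y ∈ U, Module.finrank ℝ (V y) = n := fun y hy => by
    rw [← hspan y hy, finrank_span_eq_card (hli y hy), Fintype.card_fin]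
  have hfd : ∀ y ∈ U, FiniteDimensional ℝ (V y) := fun y hy => by
    rw [← hspan y hy]
    exact FiniteDimensional.span_of_finite ℝ (Set.finite_range _)
  have := hfd x hx
  have hsymm : LinearMap.IsSymm ((D.pairing x).restrict (V x)) :=
    ⟨fun v w => hD.pairing_symm x _ _⟩
  have : Invertible (2 : ℝ) := invertibleOfNonzero two_ne_zero
  obtain ⟨b0, hb0⟩ := LinearMap.BilinForm.exists_orthogonal_basis
    (B := (D.pairing x).restrict (V x)) hsymm
  set b := b0.reindex (finCongr (hfr x hx)) with hb
  have hbo : ∀ i j, i ≠ j → D.pairing x (b i : E x) (b j) = 0 := by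
    intro i j hij
    have := hb0 (i := (finCongr (hfr x hx)).symm i) (j := (finCongr (hfr x hx)).symm j)
      (fun h => hij ((finCongr (hfr x hx)).symm.injective h))
    simpa [hb, Function.onFun] using this
  have hP : ∀ i, ∃ c : Fin n → ℝ, ∑ j, c j • s j x = b i := fun i => by
    rw [← Submodule.mem_span_range_iff_exists_fun, hspan x hx]
    exact (b i).2
  choose P hP using hP
  -- A constant change of basis diagonalizes the Gram matrix at x alone; the signs of the entries
  -- are arbitrary, so a Gram-Schmidt process is not available in general.
  set r : Fin n → ∀ b, E b := fun i => ∑ j, P i j • s j with hr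
  have hrs : ∀ i, D.IsSmooth (r i) := fun i => hD.sum fun j _ => hD.smul _ (hs j)
  have hrx : ∀ i, r i x = b i := fun i => by
    rw [← hP i]; simp [hr, Finset.sum_apply]
  have hrV : ∀ y ∈ U, ∀ i, r i y ∈ V y := fun y hy i => by
    rw [← hspan y hy]
    simp only [hr, Finset.sum_apply, Pi.smul_apply]
    exact Submodule.sum_mem _ fun j _ => Submodule.smul_mem _ _ (Submodule.subset_span ⟨j, rfl⟩)
  set ε : Fin n → ℝ := fun i => D.pair (r i) (r i) x with hε
  have hG : ∀ i j, D.pair (r i) (r j) x = if i = j then ε i else 0 := by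
    intro i j
    split_ifs with h
    · rw [h]
    · simp only [CourantData.pair, hrx]
      exact hbo i j h
  have hε0 : ∀ i, ε i ≠ 0 := by
    intro i h
    have h0 : (b i : E x) = 0 := by
      refine hnd _ (b i).2 fun w hw => ?_
      have hw' := b.sum_repr ⟨w, hw⟩
      have hw2 : w = ∑ j, b.repr ⟨w, hw⟩ j • (b j : E x) := by
        have := congrArg (Subtype.val : V x → E x) hw'
        rw [Submodule.coe_sum] at this
        exact this.symm
      rw [hw2, map_sum]
      refine Finset.sum_eq_zero fun j _ => ?_
      rw [map_smul]
      by_cases hij : i = j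
      · subst hij
        have : D.pairing x (b i : E x) (b i) = 0 := by
          simpa [hε, CourantData.pair, hrx] using h
        rw [this, smul_zero]
      · rw [hbo i j hij, smul_zero]
    exact b.ne_zero i (Subtype.ext h0)
  -- The smooth congruence keeps the Gram matrix equal to its value at x throughout a neighbourhood.
  obtain ⟨A, hA, hAx, hAG⟩ := exists_smooth_congruence (x := x)
    (G := fun i j => D.pair (r i) (r j)) (fun i j => hD.pair_smooth _ _ (hrs i) (hrs j))
    (fun i j y => hD.pair_comm _ _ _) (by
      have : (Matrix.of fun i j => D.pair (r i) (r j) x) = Matrix.diagonal ε := by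
        ext i j
        simp [hG, Matrix.diagonal_apply]
      rw [this, Matrix.det_diagonal]
      exact Finset.prod_ne_zero_iff.2 fun i _ => hε0 i)
  obtain ⟨U', hU', hU'o, hxU'⟩ := mem_nhds_iff.1 (hAG.and (hU.mem_nhds hx))
  set e : Fin n → ∀ b, E b := fun i => ∑ k, fsmul (A i k) (r k) with he
  have hpair : ∀ y ∈ U', ∀ i j, D.pair (e i) (e j) y = if i = j then ε i else 0 := by
    intro y hy i j
    rw [← hG i j, ← (hU' hy).1 i j]
    simp only [he, pair_sum_left, pair_sum_right, pair_fsmul_left, pair_fsmul_right,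
      Finset.mul_sum]
    rw [Finset.sum_comm]
    refine Finset.sum_congr rfl fun k _ => Finset.sum_congr rfl fun l _ => by ring
  have heli : ∀ y ∈ U', LinearIndependent ℝ (fun a => e a y) := by
    intro y hy
    rw [Fintype.linearIndependent_iff]
    intro c hc j
    have h1 := congrArg (fun w => D.pairing y w (e j y)) hc
    have h2 : ∀ i, D.pairing y (e i y) (e j y) = if i = j then ε i else 0 :=
      fun i => hpair y hy i j
    simp only [map_sum, map_smul, LinearMap.sum_apply, LinearMap.smul_apply, h2, map_zero,
      LinearMap.zero_apply] at h1
    simpa [hε0] using h1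
  refine ⟨U', e, ε, fun a => (ε a)⁻¹, fun y hy => (hU' hy).2, hxU', hU'o,
    fun a => hD.comb (hA a) hrs, heli, ?_, fun a => mul_inv_cancel₀ (hε0 a), hpair⟩
  intro y hy
  have hyU := (hU' hy).2
  have := hfd y hyU
  refine Submodule.eq_of_le_of_finrank_eq ?_ ?_
  · rw [Submodule.span_le]
    rintro _ ⟨a, rfl⟩
    simp only [he, Finset.sum_apply, fsmul]
    exact Submodule.sum_mem _ fun k _ => Submodule.smul_mem _ _ (hrV y hyU k)
  · rw [finrank_span_eq_card (heli y hy), hfr y hyU, Fintype.card_fin]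

theorem exists_orthogonalFrame_of_pseudometric [T2Space B] (hD : IsPreCourant D)
    (hV : D.IsGeneralizedPseudometric V) (x : B) :
    ∃ (U : Set B) (n : ℕ) (e : Fin n → ∀ b, E b) (ε η : Fin n → ℝ), x ∈ U ∧
      IsOrthogonalFrame D V U e ε η := by
  obtain ⟨U, hU, hx, n, s, hs, h⟩ := hV.subbundle x
  obtain ⟨U', e, ε, η, -, hx', he⟩ := exists_orthogonalFrame hD hU hx hs (fun y hy => (h y hy).1)
    (fun y hy => (h y hy).2) (hV.nondegenerate x)
  exact ⟨U', n, e, ε, η, hx', he⟩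

end Frames

/-! ### Independence of the local basis -/

section Independence

open CourantData

variable {m : ℕ} {B : Type*} [TopologicalSpace B] [ChartedSpace (EuclideanSpace ℝ (Fin m)) B]
  [IsManifold (𝓡 m) ∞ B]
  {F : Type*} [NormedAddCommGroup F] [NormedSpace ℝ F] [FiniteDimensional ℝ F]
  {E : B → Type*} [TopologicalSpace (TotalSpace F E)] [∀ b, AddCommGroup (E b)]
  [∀ b, Module ℝ (E b)] [∀ b, TopologicalSpace (E b)] [FiberBundle F E] [VectorBundle ℝ F E]
  [ContMDiffVectorBundle ∞ F E (𝓡 m)]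
  [T2Space B] {D : CourantData m E} {div : (∀ b, E b) → B → ℝ} {V : ∀ b, Submodule ℝ (E b)}
  {U U' : Set B} {x : B}

namespace IsCourantAlgebroid

omit [FiniteDimensional ℝ F] in
-- Bases are related by matrices only near a point, while brackets and divergences act on global
-- sections. Agreement on a neighbourhood is required because the divergence is differentiated once
-- more.
theorem frameScalar_congr (hD : IsCourantAlgebroid F D) (hdiv : D.IsDivergence div)
    {ι : Type*} [Fintype ι] {e e' f f' : ι → ∀ b, E b} (he : ∀ a, D.IsSmooth (e a))
    (he' : ∀ a, D.IsSmooth (e' a)) (hf : ∀ a, D.IsSmooth (f a)) (hf' : ∀ a, D.IsSmooth (f' a))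
    (h : ∀ᶠ y in 𝓝 x, ∀ a, e a y = f a y) (h' : ∀ᶠ y in 𝓝 x, ∀ a, e' a y = f' a y) :
    D.frameScalar div e e' x = D.frameScalar div f f' x := by
  have hp := hD.isPreCourant
  have hb : ∀ {u v : ι → ∀ b, E b}, (∀ a, D.IsSmooth (u a)) → (∀ a, D.IsSmooth (v a)) →
      (∀ᶠ y in 𝓝 x, ∀ a, u a y = v a y) → ∀ a b,
      D.bracket (u a) (u b) x = D.bracket (v a) (v b) x := by
    intro u v hu hv huv a b
    rw [hD.bracket_congr_left (hu a) (hv a) (hu b) (huv.mono fun y hy => hy a),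
      hD.bracket_congr_right (hv a) (hu b) (hv b) (huv.mono fun y hy => hy b)]
  have hd : ∀ {u v : ι → ∀ b, E b}, (∀ a, D.IsSmooth (u a)) → (∀ a, D.IsSmooth (v a)) →
      (∀ᶠ y in 𝓝 x, ∀ a, u a y = v a y) → ∀ a, div (u a) =ᶠ[𝓝 x] div (v a) := by
    intro u v hu hv huv a
    filter_upwards [huv.eventually_nhds] with y hy
    exact hp.div_congr hdiv (hu a) (hv a) (hy.mono fun z hz => hz a)
  unfold CourantData.frameScalar
  simp only [CourantData.pair, hb he hf h, hb he' hf' h', h.self_of_nhds, h'.self_of_nhds,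
    (hd he hf h _).self_of_nhds, (hd he' hf' h' _).self_of_nhds, deriv_congr (hd he hf h _),
    deriv_congr_left (h'.self_of_nhds _)]

/-- The passage from f to e is split in two. The constant matrix P expressing e in terms of f at x
gives g = Pf, still with constant Gram matrix and equal to e at x. The remaining change from e to g
is the identity at x and orthogonal nearby. -/
theorem frameScalar_eq_of_orthogonal (hD : IsCourantAlgebroid F D) (hdiv : D.IsDivergence div)
    {n n' : ℕ} {e : Fin n → ∀ b, E b} {ε η : Fin n → ℝ} (he : IsOrthogonalFrame D V U e ε η)
    {f f' : Fin n' → ∀ b, E b} (hf : D.IsFrame V U' f f') (hx : x ∈ U) (hx' : x ∈ U') :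
    D.frameScalar div f f' x = D.frameScalar div e (fun a => η a • e a) x := by
  have hp := hD.isPreCourant
  have hFe := he.isFrame hp
  set P : Fin n → Fin n' → ℝ := fun i a => D.pairing x (e i x) (f' a x) with hP
  set P' : Fin n → Fin n' → ℝ := fun i a => η i * D.pairing x (e i x) (f a x) with hP'
  have hC : ∀ a b, ∑ i, P i a * P' i b = if a = b then 1 else 0 := by
    intro a b
    have h1 : D.pairing x (f' a x) (f b x) = if a = b then 1 else 0 := hf.dual x hx' a b
    rw [← h1, hFe.pairing_eq_sum hp hx (hf.mem hx' b)]
    refine Finset.sum_congr rfl fun i _ => ?_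
    simp only [hP, hP', Pi.smul_apply, map_smul, smul_eq_mul]
    rw [hp.pairing_symm x (e i x) (f' a x), hp.pairing_symm x (e i x) (f b x)]
    ring
  set g : Fin n → ∀ b, E b := fun i => ∑ a, P i a • f a with hg
  have hgs : ∀ i, D.IsSmooth (g i) := fun i => hp.sum fun a _ => hp.smul _ (hf.smooth a)
  have hgy : ∀ i y, g i y = ∑ a, P i a • f a y := fun i y => by simp [hg, Finset.sum_apply]
  have hgx : ∀ i, g i x = e i x := fun i => by
    refine (hgy i x).trans (Eq.trans ?_ (hf.eq_sum hx' (hFe.mem hx i)).symm)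
    refine Finset.sum_congr rfl fun a _ => ?_
    rw [hP, hp.pairing_symm]
  have hgV : ∀ y ∈ U', ∀ i, g i y ∈ V y := fun y hy i => by
    rw [hgy]
    exact Submodule.sum_mem _ fun a _ => Submodule.smul_mem _ _ (hf.mem hy a)
  have hgf : ∀ y ∈ U', ∀ i b, D.pairing y (g i y) (f b y) = D.pairing x (e i x) (f b x) := by
    intro y hy i b
    have h1 : ∀ a, D.pairing y (f a y) (f b y) = D.pairing x (f a x) (f b x) := fun a =>
      hf.const y hy x hx' a b
    rw [← hgx, hgy, hgy]
    simp only [map_sum, map_smul, LinearMap.sum_apply, LinearMap.smul_apply, h1]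
  have hgg : ∀ y ∈ U', ∀ i j, D.pairing y (g i y) (g j y) = if i = j then ε i else 0 := by
    intro y hy i j
    have h1 := he.pair_eq x hx i j
    rw [← h1]
    show _ = D.pairing x (e i x) (e j x)
    rw [← hgx j, hgy j, hgy j]
    simp only [map_sum, map_smul, hgf y hy]
  have hU'n := hf.isOpen.mem_nhds hx'
  have hUn := he.isOpen.mem_nhds hx
  -- The contragredient change of f' agrees near x with η i • g i, by expanding g in the dual basis
  -- f'.
  have step1 : D.frameScalar div f f' x = D.frameScalar div g (fun i => η i • g i) x := by
    rw [← hD.frameScalar_const_change hdiv hC hf.smooth hf.smooth_dual x]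
    refine hD.frameScalar_congr hdiv hgs
      (fun i => hp.sum fun a _ => hp.smul _ (hf.smooth_dual a)) hgs (fun i => hp.smul _ (hgs i))
      (Filter.Eventually.of_forall fun y a => rfl) ?_
    filter_upwards [hU'n] with y hy i
    have h1 := hf.eq_sum_dual hp hy (hgV y hy i)
    simp only [Pi.smul_apply]
    rw [h1, Finset.smul_sum, Finset.sum_apply]
    refine Finset.sum_congr rfl fun a _ => ?_
    rw [hgf y hy, smul_smul]; rfl
  -- The coefficients of g in the orthogonal basis e; as g and e have the same constant Gram matrix,
  -- A is pointwise orthogonal for ε.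
  set A : Fin n → Fin n → B → ℝ := fun i j y => η j * D.pair (g i) (e j) y with hA
  have hAs : ∀ i j, IsSmoothFun m (A i j) := fun i j =>
    isSmoothFun_const_mul _ (hp.pair_smooth _ _ (hgs i) (he.smooth j))
  have hgA : ∀ᶠ y in 𝓝 x, ∀ i, g i y = (∑ a, fsmul (A i a) (e a)) y := by
    filter_upwards [hU'n, hUn] with y hy hy' i
    conv_lhs => rw [hFe.eq_sum hy' (hgV y hy i)]
    simp only [Finset.sum_apply, fsmul]
    refine Finset.sum_congr rfl fun a _ => ?_
    simp only [hA, CourantData.pair, Pi.smul_apply, map_smul, LinearMap.smul_apply, smul_eq_mul]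
    rw [hp.pairing_symm]
  rw [step1, ← hD.frameScalar_comb hdiv he.smooth hAs (ε := ε) (η := η) ?_ he.mul_eq_one ?_ ?_]
  · refine hD.frameScalar_congr hdiv hgs (fun i => hp.smul _ (hgs i))
      (fun i => hp.comb (hAs i) he.smooth) (fun i => hp.smul _ (hp.comb (hAs i) he.smooth)) hgA ?_
    filter_upwards [hgA] with y hy i
    rw [Pi.smul_apply, Pi.smul_apply, hy]
  · intro i a
    simp only [hA, CourantData.pair, hgx]
    have h1 : D.pairing x (e i x) (e a x) = if i = a then ε i else 0 := he.pair_eq x hx i a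
    rw [h1]
    split_ifs with h
    · rw [h, mul_comm, he.mul_eq_one]
    · rw [mul_zero]
  · filter_upwards [hUn] with y hy
    exact he.pair_eq y hy
  · filter_upwards [hU'n, hUn, hgA] with y hy hy' hyA i j
    rw [← hgg y hy, hyA i, hyA j]
    have h1 : ∀ a b, D.pairing y (e a y) (e b y) = if a = b then ε a else 0 := he.pair_eq y hy'
    simp only [Finset.sum_apply, fsmul, map_sum, map_smul, LinearMap.sum_apply,
      LinearMap.smul_apply, h1, smul_eq_mul]
    refine Finset.sum_congr rfl fun a _ => ?_
    simp
    ring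

/-- The value of `frameScalar` does not depend on the frame. -/
theorem frameScalar_eq (hD : IsCourantAlgebroid F D) (hdiv : D.IsDivergence div)
    (hV : D.IsGeneralizedPseudometric V)
    {n n' : ℕ} {e e' : Fin n → ∀ b, E b} (he : D.IsFrame V U e e')
    {f f' : Fin n' → ∀ b, E b} (hf : D.IsFrame V U' f f') (hx : x ∈ U) (hx' : x ∈ U') :
    D.frameScalar div e e' x = D.frameScalar div f f' x := by
  obtain ⟨W, k, g, ε, η, hxW, hg⟩ := exists_orthogonalFrame_of_pseudometric hD.isPreCourant hV x
  rw [hD.frameScalar_eq_of_orthogonal hdiv hg he hxW hx,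
    hD.frameScalar_eq_of_orthogonal hdiv hg hf hxW hx']

end IsCourantAlgebroid

end Independence

/-! ### Lie derivatives of densities -/

section DensityCalculus

variable {m : ℕ} {B : Type*} [TopologicalSpace B] [ChartedSpace (EuclideanSpace ℝ (Fin m)) B]
  [IsManifold (𝓡 m) ∞ B] {σ : B → ℝ} {X : ∀ x : B, TangentSpace (𝓡 m) x} {x : B}

theorem tangentCoordChange_self_det (x : B) : (tangentCoordChange (𝓡 m) x x x).det = 1 := by
  have : tangentCoordChange (𝓡 m) x x x = ContinuousLinearMap.id ℝ _ := by
    ext v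
    rw [tangentCoordChange_self (by simp)]
    rfl
  rw [this]
  exact LinearMap.det_id

theorem densityCoeff_self (s : ℝ) (σ : B → ℝ) (x : B) : densityCoeff m s σ x x = σ x := by
  rw [densityCoeff, tangentCoordChange_self_det]
  simp

theorem densityCoeff_mul (s : ℝ) (σ g : B → ℝ) (x : B) :
    densityCoeff m s (fun y => σ y * g y) x = fun y => densityCoeff m s σ x y * g y := by
  funext y
  simp only [densityCoeff, mul_assoc]

theorem densityCoeff_sq (σ : B → ℝ) (x : B) :
    densityCoeff m 1 (σ ^ 2) x =
      fun y => densityCoeff m (1 / 2) σ x y * densityCoeff m (1 / 2) σ x y := by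
  funext y
  simp only [densityCoeff, Pi.pow_apply]
  have h := abs_nonneg (tangentCoordChange (𝓡 m) x y y).det
  have : |(tangentCoordChange (𝓡 m) x y y).det| ^ (1 : ℝ) =
      |(tangentCoordChange (𝓡 m) x y y).det| ^ (1 / 2 : ℝ) *
        |(tangentCoordChange (𝓡 m) x y y).det| ^ (1 / 2 : ℝ) := by
    rw [← Real.sqrt_eq_rpow, Real.mul_self_sqrt h, Real.rpow_one]
  rw [this]
  ring

theorem lieDensity_sq
    (hσ : MDifferentiableAt (𝓡 m) 𝓘(ℝ, ℝ) (densityCoeff m (1 / 2) σ x) x) :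
    lieDensity 1 X (σ ^ 2) x = 2 * σ x * lieDensity (1 / 2) X σ x := by
  simp only [lieDensity, densityCoeff_sq, vectorDeriv_mul hσ hσ, densityCoeff_self, Pi.pow_apply]
  ring

theorem lieDensity_mul {g : B → ℝ} {s : ℝ}
    (hσ : MDifferentiableAt (𝓡 m) 𝓘(ℝ, ℝ) (densityCoeff m s σ x) x)
    (hg : MDifferentiableAt (𝓡 m) 𝓘(ℝ, ℝ) g x) :
    lieDensity s X (fun y => σ y * g y) x = g x * lieDensity s X σ x + σ x * vectorDeriv X g x := by
  simp only [lieDensity, densityCoeff_mul, vectorDeriv_mul hσ hg, densityCoeff_self]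
  ring

theorem lieDensity_congr {s : ℝ} {σ' : B → ℝ} (h : σ =ᶠ[𝓝 x] σ') :
    lieDensity s X σ x = lieDensity s X σ' x := by
  have : densityCoeff m s σ x =ᶠ[𝓝 x] densityCoeff m s σ' x := by
    filter_upwards [h] with y hy
    simp only [densityCoeff, hy]
  rw [lieDensity, lieDensity, vectorDeriv_congr this, h.self_of_nhds]

theorem chartDiv_congr {Y : ∀ x : B, TangentSpace (𝓡 m) x} (h : ∀ᶠ y in 𝓝 x, X y = Y y) :
    chartDiv X x = chartDiv Y x := by
  have ht : Filter.Tendsto (extChartAt (𝓡 m) x).symm (𝓝 (extChartAt (𝓡 m) x x)) (𝓝 x) := by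
    have := continuousAt_extChartAt_symm (I := 𝓡 m) x
    rwa [ContinuousAt, extChartAt_to_inv] at this
  rw [chartDiv, chartDiv, Filter.EventuallyEq.fderiv_eq]
  filter_upwards [ht.eventually h] with z hz
  rw [hz]

theorem lieDensity_congr_left {s : ℝ} {Y : ∀ x : B, TangentSpace (𝓡 m) x}
    (h : ∀ᶠ y in 𝓝 x, X y = Y y) : lieDensity s X σ x = lieDensity s Y σ x := by
  simp only [lieDensity, chartDiv_congr h, vectorDeriv, h.self_of_nhds]

end DensityCalculus

/-! ### Elimination of the half-density from the curvature -/

section ScalarValue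

open CourantData

variable {m : ℕ} {B : Type*} [TopologicalSpace B] [ChartedSpace (EuclideanSpace ℝ (Fin m)) B]
  [IsManifold (𝓡 m) ∞ B] [T2Space B]
  {E : B → Type*} [∀ b, AddCommGroup (E b)] [∀ b, Module ℝ (E b)]
  {D : CourantData m E} {div : (∀ b, E b) → B → ℝ} {V : ∀ b, Submodule ℝ (E b)} {U : Set B}
  {x : B} {σ : B → ℝ} {n : ℕ} {e e' : Fin n → ∀ b, E b} {ePlus : ∀ b, E b}

theorem CourantData.divDensity_congr {u v : ∀ b, E b} (h : ∀ᶠ y in 𝓝 x, u y = v y) :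
    D.divDensity σ u x = D.divDensity σ v x := by
  rw [divDensity, divDensity, lieDensity_congr_left]
  filter_upwards [h] with y hy
  simp only [rho, hy]

/-- The logarithmic derivative of σ² is twice that of σ. Iterated Lie derivatives of half-densities
thereby become derivatives of functions. -/
theorem lieDensity_half (hσ : IsSmoothDensity m (1 / 2) σ) (hσ0 : ∀ y, σ y ≠ 0)
    (u : ∀ b, E b) : lieDensity (1 / 2) (D.rho u) σ =
      fun y => σ y * (1 / 2 * D.divDensity (σ ^ 2) u y) := by
  funext y
  rw [divDensity, lieDensity_sq ((hσ y).mdifferentiableAt (by simp)), Pi.pow_apply]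
  field_simp [hσ0 y]

/-- A smooth section which lies in `V` near a point agrees near that point with a section of
`V`. -/
theorem IsPreCourant.exists_isSectionOf (hD : IsPreCourant D) (hU : U ∈ 𝓝 x) {u : ∀ b, E b}
    (hu : D.IsSmooth u) (huV : ∀ y ∈ U, u y ∈ V y) :
    ∃ v, D.IsSectionOf V v ∧ ∀ᶠ y in 𝓝 x, v y = u y := by
  obtain ⟨φ, hφ, h1, hs⟩ := exists_bump (m := m) hU
  refine ⟨GenScalar.fsmul φ u, ⟨hD.fsmul φ u hφ hu, fun y => ?_⟩, ?_⟩
  · by_cases hy : y ∈ tsupport φ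
    · exact Submodule.smul_mem _ _ (huV y (hs hy))
    · simp [GenScalar.fsmul, image_eq_zero_of_notMem_tsupport hy]
  · filter_upwards [h1] with y hy
    simp [GenScalar.fsmul, hy]

namespace CourantData.IsChoice

/-- The section e₊ is characterized against global sections of V, whereas basis elements lie in V
over U only; cutting off and locality of both divergences bridge the gap. -/
theorem divDensity_eq (hD : IsPreCourant D) (hdiv : D.IsDivergence div)
    (h : D.IsChoice V div x σ U e e' ePlus) {u : ∀ b, E b}
    (hu : D.IsSmooth u) (huV : ∀ y ∈ U, u y ∈ V y) :
    ∀ᶠ y in 𝓝 x, D.divDensity (σ ^ 2) u y = div u y - D.pair ePlus u y := by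
  obtain ⟨v, hv, hvu⟩ := hD.exists_isSectionOf (h.isFrame.isOpen.mem_nhds h.mem) hu huV
  filter_upwards [hvu.eventually_nhds, h.isFrame.isOpen.mem_nhds h.mem] with y hy hyU
  have h1 := h.ePlus_pair v hv y hyU
  rw [divDensity_congr hy, hD.div_congr hdiv hv.1 hu hy] at h1
  simp only [CourantData.pair, hy.self_of_nhds] at h1 ⊢
  linarith

/-- Pythagoras: the square of the V₋ component is the full square minus that of the V₊ component.
This removes V₋ from the curvature formula. -/
theorem ccMinus_eq (hD : IsPreCourant D) (hF : D.IsFrame V U e e') (hx : x ∈ U) :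
    D.ccMinus e e' x =
      ∑ a, ∑ b, D.pair (D.bracket (e a) (e b)) (D.bracket (e' a) (e' b)) x - D.ccPlus e e' x := by
  have key : ∀ w w' : E x, D.pairing x (w - ∑ c, D.pairing x w (e c x) • e' c x)
      (w' - ∑ c, D.pairing x w' (e c x) • e' c x) =
      D.pairing x w w' - ∑ c, D.pairing x w (e c x) * D.pairing x w' (e' c x) := by
    intro w w'
    have h1 : ∀ d, ∑ c, D.pairing x w (e c x) * D.pairing x (e' c x) (e' d x) =
        D.pairing x w (e' d x) := by
      intro d
      conv_rhs => rw [hF.eq_sum hx (hF.mem_dual x hx d)]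
      simp only [map_sum, map_smul, smul_eq_mul]
      exact Finset.sum_congr rfl fun c _ => mul_comm _ _
    have h3 : ∀ c, D.pairing x (e' c x) w' = D.pairing x w' (e' c x) := fun c =>
      hD.pairing_symm _ _ _
    simp only [map_sub, map_sum, map_smul, LinearMap.sub_apply, LinearMap.sum_apply,
      LinearMap.smul_apply, smul_eq_mul, h1, h3, sub_self, mul_zero, Finset.sum_const_zero,
      sub_zero]
  have h4 : D.ccPlus e e' x = ∑ a, ∑ b, ∑ c, D.pairing x (D.bracket (e a) (e b) x) (e c x) *
      D.pairing x (D.bracket (e' a) (e' b) x) (e' c x) := by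
    rw [ccPlus, Finset.sum_comm]
    refine Finset.sum_congr rfl fun a _ => ?_
    rw [Finset.sum_comm]
    refine Finset.sum_congr rfl fun b _ => Finset.sum_congr rfl fun c _ => ?_
    rw [CourantData.pair, CourantData.pair, hD.pairing_symm x (e c x), hD.pairing_symm x (e' c x)]
  rw [h4, ← Finset.sum_sub_distrib]
  refine Finset.sum_congr rfl fun a _ => ?_
  rw [← Finset.sum_sub_distrib]
  exact Finset.sum_congr rfl fun b _ => key _ _

/-- The value of the generalized scalar curvature for given choices does not involve the
half-density. -/
theorem scalarValue_eq (hD : IsPreCourant D) (hdiv : D.IsDivergence div)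
    (h : D.IsChoice V div x σ U e e' ePlus) :
    D.scalarValue x σ e e' ePlus = D.frameScalar div e e' x := by
  have hF := h.isFrame
  have hx := h.mem
  have hUx := hF.isOpen.mem_nhds hx
  set p : Fin n → B → ℝ := fun a => D.pair ePlus (e a) with hp
  have hps : ∀ a, IsSmoothFun m (p a) := fun a => hD.pair_smooth _ _ h.smooth_ePlus (hF.smooth a)
  set p' : Fin n → ℝ := fun a => D.pair ePlus (e' a) x with hp'
  have hds : ∀ a, IsSmoothFun m (div (e a)) := fun a => hdiv.contMDiff _ (hF.smooth a)
  have hδ : ∀ a, ∀ᶠ y in 𝓝 x, D.divDensity (σ ^ 2) (e a) y = div (e a) y + (-1) * p a y :=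
    fun a => (h.divDensity_eq hD hdiv (hF.smooth a) fun y hy => hF.mem hy a).mono
      fun y hy => by rw [hy]; ring
  have hδ' : ∀ a, D.divDensity (σ ^ 2) (e' a) x = div (e' a) x - p' a := fun a =>
    (h.divDensity_eq hD hdiv (hF.smooth_dual a) fun y hy => hF.mem_dual y hy a).self_of_nhds
  have hgs : ∀ a, IsSmoothFun m (fun y => div (e a) y + (-1) * p a y) := fun a =>
    isSmoothFun_add (hds a) (isSmoothFun_const_mul _ (hps a))
  -- Writing δ = div_{σ²}, the inner derivative is σ δ(e_a)/2, so the outer one is σ (δ(e_a)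
  -- δ(e^a)/4 + ρ(e^a) δ(e_a)/2).
  have hLL : ∀ a, lieDensity (1 / 2) (D.rho (e' a)) (lieDensity (1 / 2) (D.rho (e a)) σ) x =
      σ x * (1 / 4 * ((div (e a) x - p a x) * (div (e' a) x - p' a)) +
        1 / 2 * (D.deriv (e' a) (div (e a)) x - D.deriv (e' a) (p a) x)) := by
    intro a
    have h1 : lieDensity (1 / 2) (D.rho (e a)) σ =ᶠ[𝓝 x]
        fun y => σ y * (1 / 2 * (div (e a) y + (-1) * p a y)) := by
      rw [lieDensity_half h.smooth_density h.ne_zero]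
      filter_upwards [hδ a] with y hy
      rw [hy]
    rw [lieDensity_congr h1, lieDensity_mul ((h.smooth_density x).mdifferentiableAt (by simp))
      ((isSmoothFun_const_mul _ (hgs a)).mdiff x), lieDensity_half h.smooth_density h.ne_zero]
    have h2 : vectorDeriv (D.rho (e' a)) (fun y => 1 / 2 * (div (e a) y + (-1) * p a y)) x =
        1 / 2 * (D.deriv (e' a) (div (e a)) x + (-1) * D.deriv (e' a) (p a) x) := by
      have h3 := CourantData.deriv_const_mul (D := D) (u := e' a) (1 / 2) (hgs a) x
      rw [CourantData.deriv_add (hds a) (isSmoothFun_const_mul _ (hps a)),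
        CourantData.deriv_const_mul _ (hps a)] at h3
      exact h3
    simp only [h2, hδ' a]
    ring
  have hplus : ∀ᶠ y in 𝓝 x, ePlus y = (∑ a, fsmul (p a) (e' a)) y := by
    filter_upwards [hUx] with y hy
    rw [Finset.sum_apply]
    exact hF.eq_sum_dual hD hy (h.ePlus_mem y hy)
  have hpp : D.pair ePlus ePlus x = ∑ a, p a x * p' a := by
    have := hF.pairing_eq_sum hD hx (v := ePlus x) (h.ePlus_mem x hx)
    exact this.trans (Finset.sum_congr rfl fun a _ => mul_comm _ _)
  have hdp : div ePlus x = ∑ a, p a x * div (e' a) x + ∑ a, D.deriv (e' a) (p a) x := by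
    rw [hD.div_congr hdiv h.smooth_ePlus (hD.comb hps hF.smooth_dual) hplus,
      hD.div_comb hdiv _ hps hF.smooth_dual, Finset.sum_add_distrib]
  have hδp : D.divDensity (σ ^ 2) ePlus x = div ePlus x - D.pair ePlus ePlus x :=
    (h.divDensity_eq hD hdiv h.smooth_ePlus h.ePlus_mem).self_of_nhds
  set γ : Fin n → Fin n → ℝ := fun a b => D.pair (e a) (e b) x with hγ
  have hγs : ∀ a b, γ a b = γ b a := fun a b => hD.pair_comm _ _ _
  have heγ : ∀ a, ∀ᶠ y in 𝓝 x, e a y = (∑ b, γ a b • e' b) y := by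
    intro a
    filter_upwards [hUx] with y hy
    rw [Finset.sum_apply]
    refine (hF.eq_sum_dual hD hy (hF.mem hy a)).trans (Finset.sum_congr rfl fun b _ => ?_)
    have : D.pairing y (e a y) (e b y) = γ a b := hF.const y hy x hx a b
    rw [this]; rfl
  -- Raising and lowering indices commutes with the divergence because the Gram matrix is constant
  -- near x.
  have hswap : ∑ a, p a x * div (e' a) x = ∑ a, p' a * div (e a) x := by
    have h1 : ∀ a, p a x = ∑ b, γ a b * p' b := fun a => by
      simp only [hp, hp', CourantData.pair]
      rw [(heγ a).self_of_nhds]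
      simp [Finset.sum_apply]
    have h2 : ∀ a, div (e a) x = ∑ b, γ a b * div (e' b) x := fun a => by
      rw [hD.div_congr hdiv (hF.smooth a) (hD.sum fun b _ => hD.smul _ (hF.smooth_dual b)) (heγ a),
        hD.div_sum hdiv _ fun b => hD.smul _ (hF.smooth_dual b)]
      exact Finset.sum_congr rfl fun b _ => by rw [hdiv.smul _ _ (hF.smooth_dual b)]; rfl
    simp_rw [h1, h2, Finset.sum_mul, Finset.mul_sum]
    rw [Finset.sum_comm]
    exact Finset.sum_congr rfl fun a _ => Finset.sum_congr rfl fun b _ => by rw [hγs]; ring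
  have hσ0 := h.ne_zero x
  rw [scalarValue, laplacian, ccMinus_eq hD hF hx, hδp, hdp, hpp, frameScalar]
  simp_rw [hLL]
  rw [← Finset.mul_sum]
  have hcc : D.ccPlus e e' x = ∑ a, ∑ b, ∑ c, D.pair (e a) (D.bracket (e b) (e c)) x *
        D.pair (e' a) (D.bracket (e' b) (e' c)) x := rfl
  rw [← hcc]
  have hmain : ∑ a, (1 / 4 * ((div (e a) x - p a x) * (div (e' a) x - p' a)) +
        1 / 2 * (D.deriv (e' a) (div (e a)) x - D.deriv (e' a) (p a) x)) =
      1 / 4 * (∑ a, (2 * D.deriv (e' a) (div (e a)) x + div (e' a) x * div (e a) x)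
        - ∑ a, p a x * div (e' a) x - ∑ a, p' a * div (e a) x + ∑ a, p a x * p' a
        - 2 * ∑ a, D.deriv (e' a) (p a) x) := by
    rw [Finset.mul_sum, ← Finset.sum_sub_distrib, ← Finset.sum_sub_distrib,
      ← Finset.sum_add_distrib, ← Finset.sum_sub_distrib, Finset.mul_sum]
    exact Finset.sum_congr rfl fun a _ => by ring
  -- The terms in e₊ from the Laplacian, namely -2 p_a div e^a - 2 ρ(e^a) p_a + ⟨e₊, e₊⟩, cancel
  -- against ⟨e₊, e₊⟩ + 2 (div e₊ - ⟨e₊, e₊⟩).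
  rw [hmain, ← hswap]
  field_simp
  ring

end CourantData.IsChoice

end ScalarValue

/-! ### Jacobi's formula for the determinant -/

section Determinant

variable {m : ℕ}

theorem clm_det_eq (L : EuclideanSpace ℝ (Fin m) →L[ℝ] EuclideanSpace ℝ (Fin m)) :
    L.det = (Matrix.of fun i j => L (EuclideanSpace.single j 1) i).det := by
  rw [ContinuousLinearMap.det, ← LinearMap.det_toMatrix (EuclideanSpace.basisFun (Fin m) ℝ).toBasis]
  congr 1

theorem contDiff_det : ContDiff ℝ ∞
    (fun L : EuclideanSpace ℝ (Fin m) →L[ℝ] EuclideanSpace ℝ (Fin m) => L.det) := by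
  have : (fun L : EuclideanSpace ℝ (Fin m) →L[ℝ] EuclideanSpace ℝ (Fin m) => L.det) =
      fun L => ∑ σ : Equiv.Perm (Fin m), ((Equiv.Perm.sign σ : ℤ) : ℝ) *
        ∏ i, L (EuclideanSpace.single i 1) (σ i) := by
    funext L
    rw [clm_det_eq, Matrix.det_apply']
    rfl
  rw [this]
  refine ContDiff.sum fun σ _ => contDiff_const.mul (contDiff_prod fun i _ => ?_)
  exact ((EuclideanSpace.proj (𝕜 := ℝ) (σ i)).comp
    (ContinuousLinearMap.apply ℝ (EuclideanSpace ℝ (Fin m))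
      (EuclideanSpace.single i (1 : ℝ) : EuclideanSpace ℝ (Fin m)))).contDiff

theorem det_clm_comp (L K : EuclideanSpace ℝ (Fin m) →L[ℝ] EuclideanSpace ℝ (Fin m)) :
    (L.comp K).det = L.det * K.det := LinearMap.det_comp _ _

theorem det_clm_id : (ContinuousLinearMap.id ℝ (EuclideanSpace ℝ (Fin m))).det = 1 :=
  LinearMap.det_id

theorem fderiv_det_id (P : EuclideanSpace ℝ (Fin m) →L[ℝ] EuclideanSpace ℝ (Fin m)) :
    fderiv ℝ (fun L : EuclideanSpace ℝ (Fin m) →L[ℝ] EuclideanSpace ℝ (Fin m) => L.det)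
      (ContinuousLinearMap.id ℝ _) P = LinearMap.trace ℝ _ P.toLinearMap := by
  have hd := ((contDiff_det (m := m)).differentiable (by simp)
    (ContinuousLinearMap.id ℝ (EuclideanSpace ℝ (Fin m)))).hasFDerivAt
  have hline : HasDerivAt (fun t : ℝ => ContinuousLinearMap.id ℝ (EuclideanSpace ℝ (Fin m)) + t • P)
      P 0 := by
    simpa using ((hasDerivAt_id (0 : ℝ)).smul_const P).const_add
      (ContinuousLinearMap.id ℝ (EuclideanSpace ℝ (Fin m)))
  have hd' : HasFDerivAt (fun L : EuclideanSpace ℝ (Fin m) →L[ℝ] EuclideanSpace ℝ (Fin m) => L.det)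
      (fderiv ℝ (fun L : EuclideanSpace ℝ (Fin m) →L[ℝ] EuclideanSpace ℝ (Fin m) => L.det)
        (ContinuousLinearMap.id ℝ _))
      (ContinuousLinearMap.id ℝ (EuclideanSpace ℝ (Fin m)) + (0 : ℝ) • P) := by
    have e0 : ContinuousLinearMap.id ℝ (EuclideanSpace ℝ (Fin m)) + (0 : ℝ) • P =
        ContinuousLinearMap.id ℝ (EuclideanSpace ℝ (Fin m)) := by ext1 v; simp
    rw [e0]
    exact hd
  have h1 := hd'.comp_hasDerivAt (0 : ℝ) hline
  set b := (EuclideanSpace.basisFun (Fin m) ℝ).toBasis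
  set A := LinearMap.toMatrix b b P.toLinearMap with hA
  have h2 : (fun t : ℝ => (ContinuousLinearMap.id ℝ (EuclideanSpace ℝ (Fin m)) + t • P).det) =
      fun t => 1 + A.trace * t +
        ((1 + (Polynomial.X : Polynomial ℝ) • A.map Polynomial.C).det).divX.divX.eval t * t ^ 2 := by
    funext t
    rw [← Matrix.det_one_add_smul, ContinuousLinearMap.det, ← LinearMap.det_toMatrix b, hA]
    congr 1
    simp only [ContinuousLinearMap.toLinearMap_add, ContinuousLinearMap.toLinearMap_smul, map_add,
      map_smul]
    congr 1
    exact LinearMap.toMatrix_id b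
  have h3 : HasDerivAt (fun t : ℝ => 1 + A.trace * t +
        ((1 + (Polynomial.X : Polynomial ℝ) • A.map Polynomial.C).det).divX.divX.eval t * t ^ 2)
      A.trace 0 := by
    have := (((hasDerivAt_id (0 : ℝ)).const_mul A.trace).const_add 1).add
      ((((1 + (Polynomial.X : Polynomial ℝ) • A.map Polynomial.C).det).divX.divX.hasDerivAt 0).mul
        (hasDerivAt_pow 2 (0 : ℝ)))
    refine this.congr_deriv ?_
    simp
  have h4 := h1.unique (h2 ▸ h3)
  rw [h4, LinearMap.trace_eq_matrix_trace ℝ b]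

/-- Multiplication by the inverse L' moves the base point to the identity. -/
theorem hasFDerivAt_det {L L' : EuclideanSpace ℝ (Fin m) →L[ℝ] EuclideanSpace ℝ (Fin m)}
    (h1 : L'.comp L = ContinuousLinearMap.id ℝ _) (h2 : L.comp L' = ContinuousLinearMap.id ℝ _)
    (P : EuclideanSpace ℝ (Fin m) →L[ℝ] EuclideanSpace ℝ (Fin m)) :
    fderiv ℝ (fun L : EuclideanSpace ℝ (Fin m) →L[ℝ] EuclideanSpace ℝ (Fin m) => L.det) L P =
      L.det * LinearMap.trace ℝ _ (L'.comp P).toLinearMap := by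
  have h3 : (fun K : EuclideanSpace ℝ (Fin m) →L[ℝ] EuclideanSpace ℝ (Fin m) => K.det) =
      fun K => L.det * ((ContinuousLinearMap.compL ℝ _ _ _ L') K).det := by
    funext K
    show K.det = L.det * (L'.comp K).det
    rw [← det_clm_comp, ← ContinuousLinearMap.comp_assoc, h2, ContinuousLinearMap.id_comp]
  have hd : DifferentiableAt ℝ
      (fun L : EuclideanSpace ℝ (Fin m) →L[ℝ] EuclideanSpace ℝ (Fin m) => L.det)
      ((ContinuousLinearMap.compL ℝ _ _ _ L') L) := (contDiff_det (m := m)).differentiable (by simp) _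
  have h4 := (hd.hasFDerivAt.comp L
    (ContinuousLinearMap.hasFDerivAt (ContinuousLinearMap.compL ℝ _ _ _ L'))).const_mul L.det
  have h5 : (ContinuousLinearMap.compL ℝ _ _ _ L') L =
      ContinuousLinearMap.id ℝ (EuclideanSpace ℝ (Fin m)) := h1
  rw [h3]
  erw [h4.fderiv]
  rw [h5]
  show L.det * (fderiv ℝ _ (ContinuousLinearMap.id ℝ _) (L'.comp P)) = _
  rw [fderiv_det_id]

end Determinant

/-! ### Divergence of vector fields in different charts -/

section ChartChange

variable {m : ℕ}

/-- The divergence of a transformed vector field at the image point. -/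
theorem trace_fderiv_transform {A : EuclideanSpace ℝ (Fin m) →
      EuclideanSpace ℝ (Fin m) →L[ℝ] EuclideanSpace ℝ (Fin m)}
    {w Θ : EuclideanSpace ℝ (Fin m) → EuclideanSpace ℝ (Fin m)} {p q : EuclideanSpace ℝ (Fin m)}
    {L' : EuclideanSpace ℝ (Fin m) →L[ℝ] EuclideanSpace ℝ (Fin m)}
    (hA : DifferentiableAt ℝ A p) (hsymm : ∀ u v, fderiv ℝ A p u v = fderiv ℝ A p v u)
    (hw : DifferentiableAt ℝ w p) (hΘ : HasFDerivAt Θ L' q) (hpq : Θ q = p)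
    (h1 : L'.comp (A p) = ContinuousLinearMap.id ℝ _) :
    LinearMap.trace ℝ _ (fderiv ℝ (fun ζ => A (Θ ζ) (w (Θ ζ))) q).toLinearMap =
      LinearMap.trace ℝ _ (L'.comp (fderiv ℝ A p (w p))).toLinearMap +
        LinearMap.trace ℝ _ (fderiv ℝ w p).toLinearMap := by
  subst hpq
  have hd := (hA.hasFDerivAt.comp q hΘ).clm_apply (hw.hasFDerivAt.comp q hΘ)
  have hd' : HasFDerivAt (fun ζ => A (Θ ζ) (w (Θ ζ))) _ q := hd
  rw [hd'.fderiv]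
  -- Symmetry of the second derivative turns the flipped term into the derivative of A in the
  -- direction w, whose trace after composition with L' is the derivative of log |det A|.
  have e1 : ((A (Θ q)).comp ((fderiv ℝ w (Θ q)).comp L') +
      (((fderiv ℝ A (Θ q)).comp L').flip (w (Θ q)))).toLinearMap =
      (A (Θ q)).toLinearMap ∘ₗ ((fderiv ℝ w (Θ q)).toLinearMap ∘ₗ L'.toLinearMap) +
      (fderiv ℝ A (Θ q) (w (Θ q))).toLinearMap ∘ₗ L'.toLinearMap := by
    ext v : 1
    simp [hsymm]
  show LinearMap.trace ℝ _ ((A (Θ q)).comp ((fderiv ℝ w (Θ q)).comp L') +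
      (((fderiv ℝ A (Θ q)).comp L').flip (w (Θ q)))).toLinearMap = _
  rw [e1, map_add, LinearMap.trace_comp_comm', LinearMap.trace_comp_comm'
    L'.toLinearMap (fderiv ℝ A (Θ q) (w (Θ q))).toLinearMap]
  have e2 : ((fderiv ℝ w (Θ q)).toLinearMap ∘ₗ L'.toLinearMap) ∘ₗ (A (Θ q)).toLinearMap =
      (fderiv ℝ w (Θ q)).toLinearMap := by
    rw [LinearMap.comp_assoc]
    have : L'.toLinearMap ∘ₗ (A (Θ q)).toLinearMap = LinearMap.id := by
      ext v : 1
      exact congrArg (fun T => T v) h1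
    rw [this, LinearMap.comp_id]
  rw [e2, add_comm]
  rfl

variable {B : Type*} [TopologicalSpace B] [ChartedSpace (EuclideanSpace ℝ (Fin m)) B]
  [IsManifold (𝓡 m) ∞ B]

/-- The coordinates of the vector field `X` in the chart at `x`. -/
def chartField (X : ∀ x : B, TangentSpace (𝓡 m) x) (x : B) (z : EuclideanSpace ℝ (Fin m)) :
    EuclideanSpace ℝ (Fin m) :=
  tangentCoordChange (𝓡 m) ((extChartAt (𝓡 m) x).symm z) x ((extChartAt (𝓡 m) x).symm z)
    (X ((extChartAt (𝓡 m) x).symm z))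

theorem chartField_extChartAt (X : ∀ x : B, TangentSpace (𝓡 m) x) {x z : B}
    (hz : z ∈ (chartAt (EuclideanSpace ℝ (Fin m)) x).source) :
    chartField X x (extChartAt (𝓡 m) x z) = tangentCoordChange (𝓡 m) z x z (X z) := by
  have h : (extChartAt (𝓡 m) x).symm (extChartAt (𝓡 m) x z) = z :=
    (extChartAt (𝓡 m) x).left_inv (by rwa [extChartAt_source])
  rw [chartField, h]

theorem chartDiv_eq (X : ∀ x : B, TangentSpace (𝓡 m) x) (x : B) : chartDiv X x =
    LinearMap.trace ℝ _ (fderiv ℝ (chartField X x) (extChartAt (𝓡 m) x x)).toLinearMap := rfl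

theorem chart_transition_contDiffAt {x y z : B} (hx : z ∈ (chartAt (EuclideanSpace ℝ (Fin m)) x).source)
    (hy : z ∈ (chartAt (EuclideanSpace ℝ (Fin m)) y).source) :
    ContDiffAt ℝ ∞ (extChartAt (𝓡 m) y ∘ (extChartAt (𝓡 m) x).symm) (extChartAt (𝓡 m) x z) := by
  rw [← extChartAt_source (𝓡 m)] at hx hy
  have h := contDiffWithinAt_ext_coord_change (I := 𝓡 m) (n := ∞) y x
    (y := extChartAt (𝓡 m) x z) (by
      rw [PartialEquiv.trans_source'', PartialEquiv.symm_symm, PartialEquiv.symm_target]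
      exact Set.mem_image_of_mem _ ⟨hx, hy⟩)
  rwa [ModelWithCorners.range_eq_univ, contDiffWithinAt_univ] at h

theorem tangentCoordChange_eq_fderiv (x y z : B) : tangentCoordChange (𝓡 m) x y z =
    fderiv ℝ (extChartAt (𝓡 m) y ∘ (extChartAt (𝓡 m) x).symm) (extChartAt (𝓡 m) x z) := by
  rw [tangentCoordChange_def, ModelWithCorners.range_eq_univ, fderivWithin_univ]

theorem tangentCoordChange_contMDiffAt {x y z : B}
    (hx : z ∈ (chartAt (EuclideanSpace ℝ (Fin m)) x).source)
    (hy : z ∈ (chartAt (EuclideanSpace ℝ (Fin m)) y).source) :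
    ContMDiffAt (𝓡 m) 𝓘(ℝ, EuclideanSpace ℝ (Fin m) →L[ℝ] EuclideanSpace ℝ (Fin m)) ∞
      (tangentCoordChange (𝓡 m) x y) z := by
  have h1 : ContDiffAt ℝ ∞ (fderiv ℝ (extChartAt (𝓡 m) y ∘ (extChartAt (𝓡 m) x).symm))
      (extChartAt (𝓡 m) x z) := (chart_transition_contDiffAt hx hy).fderiv_right (by simp)
  have h2 := h1.contMDiffAt.comp z (contMDiffAt_extChartAt' (I := 𝓡 m) (n := ∞) hx)
  refine h2.congr_of_eventuallyEq (Filter.Eventually.of_forall fun w => ?_)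
  exact tangentCoordChange_eq_fderiv x y w

theorem tangentCoordChange_clm_comp {x y z w : B}
    (hx : w ∈ (chartAt (EuclideanSpace ℝ (Fin m)) x).source)
    (hy : w ∈ (chartAt (EuclideanSpace ℝ (Fin m)) y).source)
    (hz : w ∈ (chartAt (EuclideanSpace ℝ (Fin m)) z).source) :
    (tangentCoordChange (𝓡 m) y z w).comp (tangentCoordChange (𝓡 m) x y w) =
      tangentCoordChange (𝓡 m) x z w := by
  rw [← extChartAt_source (𝓡 m)] at hx hy hz
  ext1 v
  exact tangentCoordChange_comp ⟨⟨hx, hy⟩, hz⟩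

theorem tangentCoordChange_clm_self {x w : B}
    (hx : w ∈ (chartAt (EuclideanSpace ℝ (Fin m)) x).source) :
    tangentCoordChange (𝓡 m) x x w = ContinuousLinearMap.id ℝ _ := by
  rw [← extChartAt_source (𝓡 m)] at hx
  ext1 v
  exact tangentCoordChange_self hx

theorem tangentCoordChange_det_mul {x y w : B}
    (hx : w ∈ (chartAt (EuclideanSpace ℝ (Fin m)) x).source)
    (hy : w ∈ (chartAt (EuclideanSpace ℝ (Fin m)) y).source) :
    (tangentCoordChange (𝓡 m) y x w).det * (tangentCoordChange (𝓡 m) x y w).det = 1 := by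
  rw [← det_clm_comp, tangentCoordChange_clm_comp hx hy hx, tangentCoordChange_clm_self hx,
    det_clm_id]

theorem densityCoeff_change {s : ℝ} (μ : B → ℝ) {x y z : B}
    (hx : z ∈ (chartAt (EuclideanSpace ℝ (Fin m)) x).source)
    (hy : z ∈ (chartAt (EuclideanSpace ℝ (Fin m)) y).source) :
    densityCoeff m s μ y z =
      |(tangentCoordChange (𝓡 m) y x z).det| ^ s * densityCoeff m s μ x z := by
  rw [densityCoeff, densityCoeff, ← mul_assoc, ← Real.mul_rpow (abs_nonneg _) (abs_nonneg _),
    ← abs_mul, mul_comm (ContinuousLinearMap.det _), ← det_clm_comp,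
    tangentCoordChange_clm_comp hy hx (mem_chart_source _ z)]

theorem vectorDeriv_extChartAt_comp {X : ∀ x : B, TangentSpace (𝓡 m) x} {x y : B}
    (hx : y ∈ (chartAt (EuclideanSpace ℝ (Fin m)) x).source) {G : EuclideanSpace ℝ (Fin m) → ℝ}
    (hG : DifferentiableAt ℝ G (extChartAt (𝓡 m) x y)) :
    vectorDeriv X (fun z => G (extChartAt (𝓡 m) x z)) y =
      fderiv ℝ G (extChartAt (𝓡 m) x y) (chartField X x (extChartAt (𝓡 m) x y)) := by
  have hd : MDifferentiableAt (𝓡 m) 𝓘(ℝ, EuclideanSpace ℝ (Fin m)) (extChartAt (𝓡 m) x) y :=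
    (contMDiffAt_extChartAt' (I := 𝓡 m) (n := ∞) hx).mdifferentiableAt (by simp)
  have h1 := mfderiv_comp y hG.mdifferentiableAt hd
  have h2 : mfderiv (𝓡 m) 𝓘(ℝ, EuclideanSpace ℝ (Fin m)) (extChartAt (𝓡 m) x) y =
      tangentCoordChange (𝓡 m) y x y := mfderiv_chartAt_eq_tangentCoordChange hx
  show mfderiv (𝓡 m) 𝓘(ℝ, ℝ) (G ∘ extChartAt (𝓡 m) x) y (X y) = _
  rw [h1, h2, mfderiv_eq_fderiv, chartField_extChartAt X hx]
  rfl

/-- The divergence with respect to a density in a fixed chart. -/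
theorem lieDensity_one_eq {X : ∀ x : B, TangentSpace (𝓡 m) x} {μ : B → ℝ} {x y : B}
    (hx : y ∈ (chartAt (EuclideanSpace ℝ (Fin m)) x).source)
    (hc : MDifferentiableAt (𝓡 m) 𝓘(ℝ, ℝ) (densityCoeff m 1 μ x) y)
    (hw : DifferentiableAt ℝ (chartField X x) (extChartAt (𝓡 m) x y))
    (hμ : μ y ≠ 0) :
    (μ y)⁻¹ * lieDensity 1 X μ y = (densityCoeff m 1 μ x y)⁻¹ * vectorDeriv X (densityCoeff m 1 μ x) y
      + LinearMap.trace ℝ _ (fderiv ℝ (chartField X x) (extChartAt (𝓡 m) x y)).toLinearMap := by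
  have hy := mem_chart_source (EuclideanSpace ℝ (Fin m)) y
  set Φ := extChartAt (𝓡 m) y ∘ (extChartAt (𝓡 m) x).symm with hΦ
  set p := extChartAt (𝓡 m) x y with hp
  set A := fderiv ℝ Φ with hA
  have hΦs : ContDiffAt ℝ ∞ Φ p := chart_transition_contDiffAt hx hy
  have hAs : ContDiffAt ℝ ∞ A p := hΦs.fderiv_right (by simp)
  have hsymm : ∀ u v, fderiv ℝ A p u v = fderiv ℝ A p v u :=
    hΦs.isSymmSndFDerivAt (by
      rw [minSmoothness_of_isRCLikeNormedField]; exact WithTop.coe_le_coe.2 (le_top : (2 : ℕ∞) ≤ ⊤))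
  have hAz : ∀ z, tangentCoordChange (𝓡 m) x y z = A (extChartAt (𝓡 m) x z) := fun z =>
    tangentCoordChange_eq_fderiv x y z
  set L' := tangentCoordChange (𝓡 m) y x y with hL'
  have h1 : L'.comp (A p) = ContinuousLinearMap.id ℝ _ := by
    rw [hp, ← hAz, tangentCoordChange_clm_comp hx hy hx, tangentCoordChange_clm_self hx]
  have h2 : (A p).comp L' = ContinuousLinearMap.id ℝ _ := by
    rw [hp, ← hAz, tangentCoordChange_clm_comp hy hx hy, tangentCoordChange_clm_self hy]
  have hdet : (A p).det ≠ 0 := by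
    intro h0
    have := congrArg ContinuousLinearMap.det h1
    rw [det_clm_comp, h0, mul_zero, det_clm_id] at this
    exact zero_ne_one this
  set τ := LinearMap.trace ℝ _ (L'.comp (fderiv ℝ A p (chartField X x p))).toLinearMap with hτ
  -- the factor relating the two coefficients
  set G : EuclideanSpace ℝ (Fin m) → ℝ := fun ξ => Real.exp (-Real.log (A ξ).det) with hG
  have hdetd : HasFDerivAt (fun ξ => (A ξ).det) _ p :=
    ((contDiff_det (m := m)).differentiable (by simp) (A p)).hasFDerivAt.comp p
      (hAs.differentiableAt (by simp)).hasFDerivAt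
  have hGd : HasFDerivAt G _ p := ((hdetd.log hdet).neg).exp
  -- By Jacobi's formula the conversion factor of the density has logarithmic derivative -τ, the
  -- opposite of the term that the divergence acquires in `hchart`.
  have hGw : fderiv ℝ G p (chartField X x p) = - (G p * τ) := by
    rw [hGd.fderiv]
    have h5 := hasFDerivAt_det h1 h2 (fderiv ℝ A p (chartField X x p))
    simp only [_root_.smul_apply, _root_.neg_apply,
      ContinuousLinearMap.comp_apply, smul_eq_mul]
    rw [h5, inv_mul_cancel_left₀ hdet]
    exact mul_neg _ _
  have hE : MDifferentiableAt (𝓡 m) 𝓘(ℝ, ℝ) (fun z => G (extChartAt (𝓡 m) x z)) y :=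
    (hGd.differentiableAt.mdifferentiableAt).comp y
      ((contMDiffAt_extChartAt' (I := 𝓡 m) (n := ∞) hx).mdifferentiableAt (by simp))
  have hGpos : G p ≠ 0 := (Real.exp_pos _).ne'
  have hcoeff : densityCoeff m 1 μ y =ᶠ[𝓝 y]
      fun z => G (extChartAt (𝓡 m) x z) * densityCoeff m 1 μ x z := by
    filter_upwards [(chartAt (EuclideanSpace ℝ (Fin m)) x).open_source.mem_nhds hx,
      (chartAt (EuclideanSpace ℝ (Fin m)) y).open_source.mem_nhds hy] with z hzx hzy
    rw [densityCoeff_change μ hzx hzy, Real.rpow_one]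
    congr 1
    have h6 := tangentCoordChange_det_mul hzx hzy
    rw [hAz] at h6
    have h7 : (A (extChartAt (𝓡 m) x z)).det ≠ 0 := right_ne_zero_of_mul_eq_one h6
    -- `Real.log` is the logarithm of the absolute value, so G is |det A|⁻¹ whatever the sign of the
    -- determinant.
    rw [hG]
    simp only
    rw [Real.exp_neg, Real.exp_log_eq_abs h7, eq_inv_of_mul_eq_one_left h6, abs_inv]
  have hchart : chartDiv X y = τ +
      LinearMap.trace ℝ _ (fderiv ℝ (chartField X x) p).toLinearMap := by
    have hΘ : HasFDerivAt (extChartAt (𝓡 m) x ∘ (extChartAt (𝓡 m) y).symm) L'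
        (extChartAt (𝓡 m) y y) := by
      rw [hL', tangentCoordChange_eq_fderiv]
      exact ((chart_transition_contDiffAt hy hx).differentiableAt (by simp)).hasFDerivAt
    have hpq : (extChartAt (𝓡 m) x ∘ (extChartAt (𝓡 m) y).symm) (extChartAt (𝓡 m) y y) = p := by
      simp [hp]
    rw [hτ, ← trace_fderiv_transform (hAs.differentiableAt (by simp)) hsymm hw hΘ hpq h1,
      chartDiv_eq]
    congr 2
    refine Filter.EventuallyEq.fderiv_eq ?_
    have ht : Filter.Tendsto (extChartAt (𝓡 m) y).symm (𝓝 (extChartAt (𝓡 m) y y)) (𝓝 y) := by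
      have := continuousAt_extChartAt_symm (I := 𝓡 m) y
      rwa [ContinuousAt, extChartAt_to_inv] at this
    filter_upwards [ht ((chartAt (EuclideanSpace ℝ (Fin m)) x).open_source.mem_nhds hx),
      ht ((chartAt (EuclideanSpace ℝ (Fin m)) y).open_source.mem_nhds hy)] with ζ hζx hζy
    simp only [Function.comp_apply, chartField_extChartAt X hζx, ← hAz]
    rw [chartField, ← tangentCoordChange_clm_comp (mem_chart_source _ _) hζx hζy]
    rfl
  have hμy : μ y = G p * densityCoeff m 1 μ x y := by
    rw [← densityCoeff_self (m := m) 1 μ y, hcoeff.self_of_nhds]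
  have hc0 : densityCoeff m 1 μ x y ≠ 0 := fun h => hμ (by rw [hμy, h, mul_zero])
  rw [lieDensity, vectorDeriv_congr hcoeff, vectorDeriv_mul hE hc,
    vectorDeriv_extChartAt_comp hx hGd.differentiableAt, hGw, hchart, hμy]
  field_simp
  ring

end ChartChange

/-! ### Smoothness and Leibniz rule of the divergence in charts -/

section SmoothDivergence

variable {m : ℕ} {B : Type*} [TopologicalSpace B] [ChartedSpace (EuclideanSpace ℝ (Fin m)) B]
  [IsManifold (𝓡 m) ∞ B] {X Y : ∀ x : B, TangentSpace (𝓡 m) x}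

theorem chartField_contDiffAt
    (hX : ContMDiff (𝓡 m) (𝓡 m).tangent ∞ (fun b => (⟨b, X b⟩ : TangentBundle (𝓡 m) B))) {x z : B}
    (hz : z ∈ (chartAt (EuclideanSpace ℝ (Fin m)) x).source) :
    ContDiffAt ℝ ∞ (chartField X x) (extChartAt (𝓡 m) x z) := by
  have hz' : z ∈ (extChartAt (𝓡 m) x).source := by rwa [extChartAt_source]
  have hb : z ∈ (trivializationAt (EuclideanSpace ℝ (Fin m)) (TangentSpace (𝓡 m)) x).baseSet := hz
  have h1 := ((trivializationAt (EuclideanSpace ℝ (Fin m))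
    (TangentSpace (𝓡 m) : B → Type _) x).contMDiffAt_section_iff hb).1 (hX z)
  have hs : ContMDiffAt 𝓘(ℝ, EuclideanSpace ℝ (Fin m)) (𝓡 m) ∞ (extChartAt (𝓡 m) x).symm
      (extChartAt (𝓡 m) x z) :=
    (contMDiffOn_extChartAt_symm x).contMDiffAt
      ((isOpen_extChartAt_target x).mem_nhds ((extChartAt (𝓡 m) x).map_source hz'))
  rw [← (extChartAt (𝓡 m) x).left_inv hz'] at h1
  exact (h1.comp _ hs).contDiffAt

theorem chartDivAt_contMDiffAt
    (hX : ContMDiff (𝓡 m) (𝓡 m).tangent ∞ (fun b => (⟨b, X b⟩ : TangentBundle (𝓡 m) B))) {x z : B}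
    (hz : z ∈ (chartAt (EuclideanSpace ℝ (Fin m)) x).source) :
    ContMDiffAt (𝓡 m) 𝓘(ℝ, ℝ) ∞ (fun y => LinearMap.trace ℝ (EuclideanSpace ℝ (Fin m))
      (fderiv ℝ (chartField X x) (extChartAt (𝓡 m) x y)).toLinearMap) z := by
  have h1 : ContDiffAt ℝ ∞ (fderiv ℝ (chartField X x)) (extChartAt (𝓡 m) x z) :=
    (chartField_contDiffAt hX hz).fderiv_right (by simp)
  have h2 := h1.contMDiffAt.comp z (contMDiffAt_extChartAt' (I := 𝓡 m) (n := ∞) hz)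
  have h3 : ContDiff ℝ ∞ (LinearMap.toContinuousLinearMap
      ((LinearMap.trace ℝ (EuclideanSpace ℝ (Fin m))) ∘ₗ ContinuousLinearMap.coeLM ℝ)) :=
    ContinuousLinearMap.contDiff _
  exact h3.contDiffAt.contMDiffAt.comp z h2

theorem chartField_add (x : B) : chartField (X + Y) x = chartField X x + chartField Y x := by
  funext z
  simp only [chartField, Pi.add_apply]
  exact map_add _ _ _

theorem chartDiv_add
    (hX : ContMDiff (𝓡 m) (𝓡 m).tangent ∞ (fun b => (⟨b, X b⟩ : TangentBundle (𝓡 m) B)))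
    (hY : ContMDiff (𝓡 m) (𝓡 m).tangent ∞ (fun b => (⟨b, Y b⟩ : TangentBundle (𝓡 m) B))) (x : B) :
    chartDiv (X + Y) x = chartDiv X x + chartDiv Y x := by
  have hx := mem_chart_source (EuclideanSpace ℝ (Fin m)) x
  rw [chartDiv_eq, chartDiv_eq, chartDiv_eq, chartField_add,
    fderiv_add ((chartField_contDiffAt hX hx).differentiableAt (by simp))
      ((chartField_contDiffAt hY hx).differentiableAt (by simp)),
    ContinuousLinearMap.toLinearMap_add, map_add]

theorem chartDiv_smul {f : B → ℝ} (hf : IsSmoothFun m f)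
    (hX : ContMDiff (𝓡 m) (𝓡 m).tangent ∞ (fun b => (⟨b, X b⟩ : TangentBundle (𝓡 m) B))) (x : B) :
    chartDiv (fun y => f y • X y) x = f x * chartDiv X x + vectorDeriv X f x := by
  have hx := mem_chart_source (EuclideanSpace ℝ (Fin m)) x
  have hx' := mem_extChartAt_source (I := 𝓡 m) x
  set G : EuclideanSpace ℝ (Fin m) → ℝ := f ∘ (extChartAt (𝓡 m) x).symm with hG
  have hs : ContMDiffAt 𝓘(ℝ, EuclideanSpace ℝ (Fin m)) (𝓡 m) ∞ (extChartAt (𝓡 m) x).symm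
      (extChartAt (𝓡 m) x x) :=
    (contMDiffOn_extChartAt_symm x).contMDiffAt
      ((isOpen_extChartAt_target x).mem_nhds ((extChartAt (𝓡 m) x).map_source hx'))
  have hGd : DifferentiableAt ℝ G (extChartAt (𝓡 m) x x) :=
    ((hf _).comp _ hs).contDiffAt.differentiableAt (by simp)
  have hfG : f =ᶠ[𝓝 x] fun z => G (extChartAt (𝓡 m) x z) := by
    filter_upwards [extChartAt_source_mem_nhds (I := 𝓡 m) x] with z hz
    simp only [hG, Function.comp_apply, (extChartAt (𝓡 m) x).left_inv hz]
  have hw := (chartField_contDiffAt hX hx).differentiableAt (by simp)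
  have hfield : chartField (fun y => f y • X y) x = fun z => G z • chartField X x z := by
    funext z
    simp only [chartField, hG, Function.comp_apply]
    exact map_smul _ _ _
  rw [vectorDeriv_congr hfG, vectorDeriv_extChartAt_comp hx hGd, chartDiv_eq, chartDiv_eq, hfield,
    (hGd.hasFDerivAt.fun_smul hw.hasFDerivAt).fderiv, ContinuousLinearMap.toLinearMap_add, map_add,
    ContinuousLinearMap.toLinearMap_smul, map_smul]
  congr 1
  · rw [smul_eq_mul, hfG.self_of_nhds]
  · exact LinearMap.trace_smulRight _ _

end SmoothDivergence

/-! ### Existence of a positive half-density -/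

section HalfDensity

variable {m : ℕ} {B : Type*} [TopologicalSpace B] [ChartedSpace (EuclideanSpace ℝ (Fin m)) B]
  [IsManifold (𝓡 m) ∞ B]

theorem contDiffAt_abs_rpow {t : ℝ} (ht : t ≠ 0) (s : ℝ) :
    ContDiffAt ℝ ∞ (fun t : ℝ => |t| ^ s) t :=
  (contDiffAt_abs ht).rpow_const_of_ne (abs_ne_zero.2 ht)

variable (m B) in
/-- There is a positive smooth half-density. -/
theorem exists_halfDensity [T2Space B] [SigmaCompactSpace B] :
    ∃ σ : B → ℝ, (∀ y, 0 < σ y) ∧ ∀ x, ∀ z ∈ (chartAt (EuclideanSpace ℝ (Fin m)) x).source,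
      ContMDiffAt (𝓡 m) 𝓘(ℝ, ℝ) ∞ (densityCoeff m (1 / 2) σ x) z := by
  obtain ⟨f, hf⟩ := SmoothPartitionOfUnity.exists_isSubordinate_chartAt_source (𝓡 m) B
  have hsupp : ∀ i y, f i y ≠ 0 → y ∈ (chartAt (EuclideanSpace ℝ (Fin m)) i).source :=
    fun i y h => hf i (subset_tsupport _ h)
  have hdet : ∀ {x y z : B}, z ∈ (chartAt (EuclideanSpace ℝ (Fin m)) x).source →
      z ∈ (chartAt (EuclideanSpace ℝ (Fin m)) y).source →
      (tangentCoordChange (𝓡 m) x y z).det ≠ 0 := fun hx hy =>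
    right_ne_zero_of_mul_eq_one (tangentCoordChange_det_mul hx hy)
  -- This is Σ f_i |dφ_i|^{1/2} for a partition of unity f_i subordinate to the charts φ_i, read in
  -- the preferred chart at y.
  set σ : B → ℝ := fun y => ∑ᶠ i, f i y • |(tangentCoordChange (𝓡 m) y i y).det| ^ (1 / 2 : ℝ)
    with hσ
  have hfin : ∀ y (g : B → ℝ), (Function.support fun i => f i y • g i).Finite := fun y g =>
    (f.locallyFinite.point_finite y).subset fun i hi => by
      simp only [Function.mem_support] at hi ⊢
      exact fun h => hi (by rw [h, zero_smul])
  refine ⟨σ, fun y => ?_, fun x z hz => ?_⟩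
  · obtain ⟨i, hi⟩ := f.exists_pos_of_mem (Set.mem_univ y)
    refine finsum_pos (fun j => ?_) ⟨i, ?_⟩ (hfin y _)
    · exact smul_nonneg (f.nonneg j y) (Real.rpow_nonneg (abs_nonneg _) _)
    · exact smul_pos hi (Real.rpow_pos_of_pos (abs_pos.2
        (hdet (mem_chart_source _ y) (hsupp i y hi.ne'))) _)
  · have h1 : densityCoeff m (1 / 2) σ x =ᶠ[𝓝 z]
        fun y => ∑ᶠ i, f i y • |(tangentCoordChange (𝓡 m) x i y).det| ^ (1 / 2 : ℝ) := by
      filter_upwards [(chartAt (EuclideanSpace ℝ (Fin m)) x).open_source.mem_nhds hz] with y hy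
      rw [densityCoeff, hσ, ← smul_eq_mul, smul_finsum]
      refine finsum_congr fun i => ?_
      -- Where f_i vanishes the point may lie outside the i-th chart, and the cocycle identity for
      -- coordinate changes is not available there.
      by_cases h : f i y = 0
      · rw [h, zero_smul, zero_smul, smul_zero]
      · rw [smul_comm, smul_eq_mul _ (|_| ^ _), ← Real.mul_rpow (abs_nonneg _) (abs_nonneg _),
          ← abs_mul, mul_comm (ContinuousLinearMap.det _), ← det_clm_comp,
          tangentCoordChange_clm_comp hy (mem_chart_source _ y) (hsupp i y h)]
    refine ContMDiffAt.congr_of_eventuallyEq (f.contMDiffAt_finsum fun i hi => ?_) h1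
    have hi' := hf i hi
    have h2 := ((contDiff_det (m := m)).contDiffAt.contMDiffAt).comp z
      (tangentCoordChange_contMDiffAt hz hi')
    exact (contDiffAt_abs_rpow (hdet hz hi') _).contMDiffAt.comp z h2

end HalfDensity

/-! ### Existence of the choices in the definition of the curvature -/

section Choice

open CourantData

variable {m : ℕ} {B : Type*} [TopologicalSpace B] [ChartedSpace (EuclideanSpace ℝ (Fin m)) B]
  [IsManifold (𝓡 m) ∞ B] [T2Space B]
  {E : B → Type*} [∀ b, AddCommGroup (E b)] [∀ b, Module ℝ (E b)]
  {D : CourantData m E} {div : (∀ b, E b) → B → ℝ} {V : ∀ b, Submodule ℝ (E b)} {U : Set B}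
  {σ : B → ℝ}

/-- The definition of the Lie derivative at y uses the preferred chart at y, which may jump with y.
Smoothness near z is therefore read off in the single chart at z, which is why the coefficients of σ
are assumed smooth on entire chart domains. -/
theorem IsPreCourant.isDivergence_divDensity (hD : IsPreCourant D) (hσ0 : ∀ y, 0 < σ y)
    (hσ : ∀ x, ∀ z ∈ (chartAt (EuclideanSpace ℝ (Fin m)) x).source,
      ContMDiffAt (𝓡 m) 𝓘(ℝ, ℝ) ∞ (densityCoeff m (1 / 2) σ x) z) :
    D.IsDivergence (D.divDensity (σ ^ 2)) := by
  have hμ : ∀ y, (σ ^ 2) y ≠ 0 := fun y => pow_ne_zero 2 (hσ0 y).ne'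
  have hlin : ∀ {f : B → ℝ} {a : ∀ b, E b}, IsSmoothFun m f → D.IsSmooth a →
      D.divDensity (σ ^ 2) (GenScalar.fsmul f a) = f * D.divDensity (σ ^ 2) a + D.deriv a f := by
    intro f a hf ha
    funext y
    have h1 : D.rho (GenScalar.fsmul f a) = fun y => f y • D.rho a y := by
      funext y
      exact map_smul _ _ _
    have h2 : vectorDeriv (fun y => f y • D.rho a y) (densityCoeff m 1 (σ ^ 2) y) y =
        f y * vectorDeriv (D.rho a) (densityCoeff m 1 (σ ^ 2) y) y := map_smul _ _ _
    simp only [divDensity, lieDensity, h1, chartDiv_smul hf (hD.rho_smooth a ha), h2, Pi.add_apply,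
      Pi.mul_apply, CourantData.deriv]
    have h3 := inv_mul_cancel₀ (hμ y)
    linear_combination vectorDeriv (D.rho a) f y * h3
  refine ⟨fun a ha z => ?_, fun a b ha hb => ?_, fun c a ha => ?_, fun f a hf ha => hlin hf ha⟩
  · have hz := mem_chart_source (EuclideanSpace ℝ (Fin m)) z
    set c := densityCoeff m 1 (σ ^ 2) z with hc
    have hcs : ∀ y ∈ (chartAt (EuclideanSpace ℝ (Fin m)) z).source,
        ContMDiffAt (𝓡 m) 𝓘(ℝ, ℝ) ∞ c y := fun y hy => by
      rw [hc, densityCoeff_sq]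
      exact (hσ z y hy).mul (hσ z y hy)
    have hopen := (chartAt (EuclideanSpace ℝ (Fin m)) z).open_source.mem_nhds hz
    obtain ⟨g, hg, hgc⟩ := exists_global_extension (Filter.mem_of_superset hopen hcs)
    have hcz : c z ≠ 0 := by rw [hc, densityCoeff_self]; exact hμ z
    refine ContMDiffAt.congr_of_eventuallyEq (f := fun y => (c y)⁻¹ * vectorDeriv (D.rho a) g y +
      LinearMap.trace ℝ _ (fderiv ℝ (chartField (D.rho a) z) (extChartAt (𝓡 m) z y)).toLinearMap)
      ?_ ?_
    · exact (((hcs z hz).inv₀ hcz).mul (vectorDeriv_smooth (hD.rho_smooth a ha) hg z)).add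
        (chartDivAt_contMDiffAt (hD.rho_smooth a ha) hz)
    · filter_upwards [hopen, hgc.eventually_nhds] with y hy hgy
      rw [divDensity, lieDensity_one_eq hy ((hcs y hy).mdifferentiableAt (by simp))
        ((chartField_contDiffAt (hD.rho_smooth a ha) hy).differentiableAt (by simp)) (hμ y),
        vectorDeriv_congr hgy]
  · funext y
    have h1 : D.rho (a + b) = D.rho a + D.rho b := by
      funext y
      exact map_add _ _ _
    have h2 : vectorDeriv (D.rho a + D.rho b) (densityCoeff m 1 (σ ^ 2) y) y =
        vectorDeriv (D.rho a) (densityCoeff m 1 (σ ^ 2) y) y +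
          vectorDeriv (D.rho b) (densityCoeff m 1 (σ ^ 2) y) y := map_add _ _ _
    simp only [divDensity, lieDensity, h1, chartDiv_add (hD.rho_smooth a ha) (hD.rho_smooth b hb),
      h2, Pi.add_apply]
    ring
  · rw [← fsmul_const, hlin (isSmoothFun_const c) ha]
    funext y
    simp [CourantData.deriv_const]

/-- Every frame is part of a choice of data defining the generalized scalar curvature. -/
theorem IsPreCourant.exists_isChoice [SigmaCompactSpace B] (hD : IsPreCourant D)
    (hdiv : D.IsDivergence div) {x : B} {n : ℕ} {e e' : Fin n → ∀ b, E b}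
    (hF : D.IsFrame V U e e') (hx : x ∈ U) : ∃ σ ePlus, D.IsChoice V div x σ U e e' ePlus := by
  obtain ⟨σ, hσ0, hσ⟩ := exists_halfDensity m B
  have hδ := hD.isDivergence_divDensity hσ0 hσ
  -- The difference of two divergences is linear over functions, so its values on a basis determine
  -- it on V; these values are the components of e₊ in the dual basis.
  set p : Fin n → B → ℝ := fun a y => div (e a) y + (-1) * D.divDensity (σ ^ 2) (e a) y with hp
  have hps : ∀ a, IsSmoothFun m (p a) := fun a => isSmoothFun_add (hdiv.contMDiff _ (hF.smooth a))
    (isSmoothFun_const_mul _ (hδ.contMDiff _ (hF.smooth a)))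
  refine ⟨σ, ∑ a, GenScalar.fsmul (p a) (e' a),
    { smooth_density := fun x => hσ x x (mem_chart_source _ x)
      ne_zero := fun y => (hσ0 y).ne'
      mem := hx
      isFrame := hF
      smooth_ePlus := hD.comb hps hF.smooth_dual
      ePlus_mem := fun y hy => ?_
      ePlus_pair := fun a ha y hy => ?_ }⟩
  · rw [Finset.sum_apply]
    exact Submodule.sum_mem _ fun a _ => Submodule.smul_mem _ _ (hF.mem_dual y hy a)
  · set A : Fin n → B → ℝ := fun b => D.pair (e' b) a with hA
    have hAs : ∀ b, IsSmoothFun m (A b) := fun b => hD.pair_smooth _ _ (hF.smooth_dual b) ha.1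
    have hnear : ∀ᶠ z in 𝓝 y, a z = (∑ b, GenScalar.fsmul (A b) (e b)) z := by
      filter_upwards [hF.isOpen.mem_nhds hy] with z hz
      rw [Finset.sum_apply]
      exact hF.eq_sum hz (ha.2 z)
    have hcomb := hD.comb (s := Finset.univ) hAs hF.smooth
    rw [hD.div_congr hdiv ha.1 hcomb hnear, hD.div_congr hδ ha.1 hcomb hnear,
      hD.div_comb hdiv _ hAs hF.smooth, hD.div_comb hδ _ hAs hF.smooth, pair_sum_left,
      ← Finset.sum_sub_distrib]
    refine Finset.sum_congr rfl fun b _ => ?_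
    rw [pair_fsmul_left]
    simp only [hp, hA]
    ring

end Choice

/-! ### Linear differential equations on a connected Lie group -/

section LinearODE

variable {H N : Type*} [NormedAddCommGroup H] [NormedSpace ℝ H] [NormedAddCommGroup N]
  [NormedSpace ℝ N]

/-- Grönwall's inequality along the segment from the centre of the ball. -/
theorem eq_zero_of_norm_fderiv_le {Z : H → N} {c : H} {r K : ℝ}
    (hd : ∀ ξ ∈ Metric.ball c r, DifferentiableAt ℝ Z ξ)
    (hK : ∀ ξ ∈ Metric.ball c r, ∀ η, ‖fderiv ℝ Z ξ η‖ ≤ K * ‖η‖ * ‖Z ξ‖) (h0 : Z c = 0) :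
    ∀ ξ ∈ Metric.ball c r, Z ξ = 0 := by
  intro ξ hξ
  have hr : 0 < r := lt_of_le_of_lt dist_nonneg hξ
  have hmem : ∀ t ∈ Set.Icc (0 : ℝ) 1, c + t • (ξ - c) ∈ Metric.ball c r := by
    intro t ht
    have := (convex_ball c r).add_smul_sub_mem (Metric.mem_ball_self hr) hξ ht
    exact this
  have hline : ∀ t : ℝ, HasDerivAt (fun t : ℝ => c + t • (ξ - c)) (ξ - c) t := fun t => by
    simpa using ((hasDerivAt_id t).smul_const (ξ - c)).const_add c
  have hderiv : ∀ t ∈ Set.Icc (0 : ℝ) 1, HasDerivAt (fun t : ℝ => Z (c + t • (ξ - c)))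
      (fderiv ℝ Z (c + t • (ξ - c)) (ξ - c)) t := fun t ht =>
    (hd _ (hmem t ht)).hasFDerivAt.comp_hasDerivAt t (hline t)
  have := norm_le_gronwallBound_of_norm_deriv_right_le (f := fun t : ℝ => Z (c + t • (ξ - c)))
    (f' := fun t => fderiv ℝ Z (c + t • (ξ - c)) (ξ - c)) (δ := 0) (K := K * ‖ξ - c‖) (ε := 0)
    (a := 0) (b := 1) (fun t ht => (hderiv t ht).continuousAt.continuousWithinAt)
    (fun t ht => (hderiv t (Set.Ico_subset_Icc_self ht)).hasDerivWithinAt) (by simp [h0])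
    (fun t ht => by
      rw [add_zero]
      exact hK _ (hmem t (Set.Ico_subset_Icc_self ht)) _) 1 ⟨zero_le_one, le_rfl⟩
  rw [gronwallBound_ε0_δ0] at this
  simpa using this

variable {k : ℕ} {S : Type*} [Group S] [TopologicalSpace S]
  [ChartedSpace (EuclideanSpace ℝ (Fin k)) S] [LieGroup (𝓡 k) ∞ S]

theorem lieGroup_three (k : ℕ) (S : Type*) [Group S] [TopologicalSpace S]
    [ChartedSpace (EuclideanSpace ℝ (Fin k)) S] [LieGroup (𝓡 k) ∞ S] :
    LieGroup (𝓡 k) (minSmoothness ℝ 3) S := by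
  rw [minSmoothness_of_isRCLikeNormedField]
  infer_instance

theorem mfderiv_mul_left_bijective (g : S) :
    Function.Bijective (mfderiv (𝓡 k) (𝓡 k) (g * ·) (1 : S)) := by
  have hd : ∀ a b : S, MDifferentiableAt (𝓡 k) (𝓡 k) (a * ·) b := fun a b =>
    (contMDiff_mul_left (I := 𝓡 k) (n := ∞) (a := a) b).mdifferentiableAt (by simp)
  have h1 : mfderiv (𝓡 k) (𝓡 k) (g⁻¹ * ·) (g * 1) ∘L mfderiv (𝓡 k) (𝓡 k) (g * ·) (1 : S) =
      ContinuousLinearMap.id ℝ _ := by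
    rw [← mfderiv_comp (1 : S) (hd g⁻¹ _) (hd g 1)]
    have : ((g⁻¹ * ·) ∘ (g * ·) : S → S) = id := by funext h; simp
    rw [this, mfderiv_id]
  have hinj : Function.Injective (mfderiv (𝓡 k) (𝓡 k) (g * ·) (1 : S)) := by
    intro u v huv
    have hu := congrArg (fun T => T u) h1
    have hv := congrArg (fun T => T v) h1
    simp only [ContinuousLinearMap.comp_apply] at hu hv
    rw [huv] at hu
    exact hu.symm.trans hv
  have key : ∀ T : EuclideanSpace ℝ (Fin k) →L[ℝ] EuclideanSpace ℝ (Fin k),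
      Function.Injective T → Function.Surjective T := fun T hT =>
    LinearMap.surjective_of_injective (f := T.toLinearMap) hT
  exact ⟨hinj, key _ hinj⟩

/-- A solution of a linear differential equation along the left invariant vector fields of a
connected Lie group which vanishes at `1` vanishes everywhere. -/
theorem eq_zero_of_leftInvariant_ode [ConnectedSpace S] {Z : S → N}
    (hZ : MDifferentiable (𝓡 k) 𝓘(ℝ, N) Z) {A : EuclideanSpace ℝ (Fin k) → N → N} {C : ℝ}
    (hC : 0 ≤ C) (hA : ∀ u z, ‖A u z‖ ≤ C * ‖u‖ * ‖z‖)
    (hode : ∀ (g : S) (u : GroupLieAlgebra (𝓡 k) S),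
      mfderiv (𝓡 k) 𝓘(ℝ, N) Z g (mulInvariantVectorField u g) = A u (Z g))
    (h1 : Z 1 = 0) (g : S) : Z g = 0 := by
  have := lieGroup_three k S
  -- By connectedness it is enough that the zero set is open as well as closed.
  have hcl : IsClosed {g | Z g = 0} := isClosed_eq hZ.continuous continuous_const
  suffices hop : IsOpen {g | Z g = 0} by
    have := IsClopen.eq_univ ⟨hcl, hop⟩ ⟨1, h1⟩
    exact (this ▸ Set.mem_univ g : g ∈ {g | Z g = 0})
  rw [isOpen_iff_mem_nhds]
  intro g0 hg0
  have hm : IsManifold (𝓡 k) (1 + 1) S := .of_le (n := ∞)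
    (by rw [one_add_one_eq_two]; exact WithTop.coe_le_coe.2 (le_top : (2 : ℕ∞) ≤ ⊤))
  -- L g sends u to the coordinates, in the chart at g0, of the left invariant field of u at g. It
  -- is invertible near g0 with bounded inverse, so the equation along left invariant fields bounds
  -- the full derivative of Z in the chart.
  set L : S → EuclideanSpace ℝ (Fin k) →L[ℝ] EuclideanSpace ℝ (Fin k) := fun g =>
    (tangentCoordChange (𝓡 k) g g0 g).comp (mfderiv (𝓡 k) (𝓡 k) (g * ·) (1 : S)) with hL
  have hsrc := (chartAt (EuclideanSpace ℝ (Fin k)) g0).open_source.mem_nhds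
    (mem_chart_source (EuclideanSpace ℝ (Fin k)) g0)
  have hLc : ContinuousAt L g0 := by
    refine ContinuousOn.continuousAt (s := (chartAt (EuclideanSpace ℝ (Fin k)) g0).source) ?_ hsrc
    rw [continuousOn_clm_apply]
    intro u g hg
    have hb : g ∈ (trivializationAt (EuclideanSpace ℝ (Fin k)) (TangentSpace (𝓡 k)) g0).baseSet := hg
    have h2 := ((trivializationAt (EuclideanSpace ℝ (Fin k))
      (TangentSpace (𝓡 k) : S → Type _) g0).contMDiffAt_section_iff hb).1
      (((contMDiff_mulInvariantVectorField (I := 𝓡 k) (G := S) u).of_le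
        (by rw [minSmoothness_of_isRCLikeNormedField]; exact one_le_two) : ContMDiff _ _ 1 _) g)
    exact h2.continuousAt.continuousWithinAt
  have hinv0 : ∃ e : EuclideanSpace ℝ (Fin k) ≃L[ℝ] EuclideanSpace ℝ (Fin k),
      (e : EuclideanSpace ℝ (Fin k) →L[ℝ] EuclideanSpace ℝ (Fin k)) = L g0 := by
    have hb : Function.Bijective (L g0) := by
      have : L g0 = mfderiv (𝓡 k) (𝓡 k) (g0 * ·) (1 : S) := by
        rw [hL]
        simp only
        rw [tangentCoordChange_clm_self (mem_chart_source _ g0)]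
        rfl
      rw [this]
      exact mfderiv_mul_left_bijective g0
    exact ⟨ContinuousLinearEquiv.ofBijective (L g0) (LinearMap.ker_eq_bot.2 hb.1)
      (LinearMap.range_eq_top.2 hb.2), by ext; rfl⟩
  obtain ⟨e, he⟩ := hinv0
  have hinvc : ContinuousAt (fun g => ContinuousLinearMap.inverse (L g)) g0 := by
    have h3 : ContinuousAt (ContinuousLinearMap.inverse :
        (EuclideanSpace ℝ (Fin k) →L[ℝ] EuclideanSpace ℝ (Fin k)) → _) (L g0) := by
      rw [← he]
      exact (contDiffAt_map_inverse (n := 1) e).continuousAt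
    exact h3.comp hLc
  obtain ⟨K, hK0, hK⟩ : ∃ K : ℝ, 0 ≤ K ∧ ∀ᶠ g in 𝓝 g0, ‖ContinuousLinearMap.inverse (L g)‖ ≤ K := by
    refine ⟨‖ContinuousLinearMap.inverse (L g0)‖ + 1, by positivity, ?_⟩
    exact (hinvc.norm.eventually_lt continuousAt_const (by simp)).mono fun g hg => le_of_lt hg
  have hLe : ∀ᶠ g in 𝓝 g0, L g ∈ Set.range (ContinuousLinearEquiv.toContinuousLinearMap :
      (EuclideanSpace ℝ (Fin k) ≃L[ℝ] EuclideanSpace ℝ (Fin k)) → _) := by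
    refine hLc ?_
    rw [← he]
    exact e.nhds
  have ht : Filter.Tendsto (extChartAt (𝓡 k) g0).symm (𝓝 (extChartAt (𝓡 k) g0 g0)) (𝓝 g0) := by
    have := continuousAt_extChartAt_symm (I := 𝓡 k) g0
    rwa [ContinuousAt, extChartAt_to_inv] at this
  set Z' := Z ∘ (extChartAt (𝓡 k) g0).symm with hZ'
  have hgood : ∀ᶠ ξ in 𝓝 (extChartAt (𝓡 k) g0 g0), DifferentiableAt ℝ Z' ξ ∧
      ∀ η, ‖fderiv ℝ Z' ξ η‖ ≤ (C * K) * ‖η‖ * ‖Z' ξ‖ := by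
    filter_upwards [ht.eventually (hK.and (hLe.and hsrc)), extChartAt_target_mem_nhds (I := 𝓡 k) g0]
      with ξ hξ hξt
    obtain ⟨hξK, ⟨f, hf⟩, hξs⟩ := hξ
    have hξi : extChartAt (𝓡 k) g0 ((extChartAt (𝓡 k) g0).symm ξ) = ξ :=
      (extChartAt (𝓡 k) g0).right_inv hξt
    set g := (extChartAt (𝓡 k) g0).symm ξ with hg
    have hZd : DifferentiableAt ℝ Z' ξ := by
      have hs : MDifferentiableAt 𝓘(ℝ, EuclideanSpace ℝ (Fin k)) (𝓡 k)
          (extChartAt (𝓡 k) g0).symm ξ :=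
        ((contMDiffOn_extChartAt_symm (n := ∞) g0).contMDiffAt
          ((isOpen_extChartAt_target g0).mem_nhds hξt)).mdifferentiableAt (by simp)
      exact ((hZ _).comp ξ hs).differentiableAt
    refine ⟨hZd, fun η => ?_⟩
    set u : EuclideanSpace ℝ (Fin k) := ContinuousLinearMap.inverse (L g) η with hu
    have hLu : L g u = η := by
      rw [hu, ← hf, ContinuousLinearMap.inverse_equiv]
      exact f.apply_symm_apply η
    have hder : fderiv ℝ Z' ξ η = A u (Z' ξ) := by
      have hZZ : Z =ᶠ[𝓝 g] Z' ∘ extChartAt (𝓡 k) g0 := by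
        filter_upwards [(chartAt (EuclideanSpace ℝ (Fin k)) g0).open_source.mem_nhds hξs] with h hh
        have : (extChartAt (𝓡 k) g0).symm (extChartAt (𝓡 k) g0 h) = h :=
          (extChartAt (𝓡 k) g0).left_inv (by rwa [extChartAt_source])
        simp only [hZ', Function.comp_apply, this]
      have hd : MDifferentiableAt (𝓡 k) 𝓘(ℝ, EuclideanSpace ℝ (Fin k)) (extChartAt (𝓡 k) g0) g :=
        (contMDiffAt_extChartAt' (I := 𝓡 k) (n := ∞) hξs).mdifferentiableAt (by simp)
      have h2 : mfderiv (𝓡 k) 𝓘(ℝ, EuclideanSpace ℝ (Fin k)) (extChartAt (𝓡 k) g0) g =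
        tangentCoordChange (𝓡 k) g g0 g := mfderiv_chartAt_eq_tangentCoordChange hξs
      have hZd' : DifferentiableAt ℝ Z' (extChartAt (𝓡 k) g0 g) := by rwa [hξi]
      have h4 := hode g u
      rw [hZZ.mfderiv_eq, mfderiv_comp g hZd'.mdifferentiableAt hd, h2, mfderiv_eq_fderiv, hξi] at h4
      rw [← hLu]
      exact h4
    rw [hder]
    calc ‖A u (Z' ξ)‖ ≤ C * ‖u‖ * ‖Z' ξ‖ := hA _ _
      _ ≤ C * (K * ‖η‖) * ‖Z' ξ‖ := by
        gcongr
        exact (ContinuousLinearMap.le_opNorm _ _).trans (by gcongr)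
      _ = (C * K) * ‖η‖ * ‖Z' ξ‖ := by ring
  obtain ⟨r, hr, hball⟩ := Metric.eventually_nhds_iff_ball.1 hgood
  have hzero := eq_zero_of_norm_fderiv_le (fun ξ hξ => (hball ξ hξ).1) (fun ξ hξ => (hball ξ hξ).2)
    (by simpa [hZ'] using hg0)
  have hcont : ContinuousAt (extChartAt (𝓡 k) g0) g0 := continuousAt_extChartAt g0
  filter_upwards [hcont (Metric.ball_mem_nhds _ hr), hsrc] with g hg hgs
  have h5 : Z ((extChartAt (𝓡 k) g0).symm (extChartAt (𝓡 k) g0 g)) = 0 := hzero _ hg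
  have : (extChartAt (𝓡 k) g0).symm (extChartAt (𝓡 k) g0 g) = g :=
    (extChartAt (𝓡 k) g0).left_inv (by rwa [extChartAt_source])
  rw [this] at h5
  exact h5

end LinearODE

theorem eq_zero_of_leftInvariant_linear_ode {k : ℕ} {S : Type*} [Group S] [TopologicalSpace S]
    [ChartedSpace (EuclideanSpace ℝ (Fin k)) S] [LieGroup (𝓡 k) ∞ S] [ConnectedSpace S]
    {N : Type*} [NormedAddCommGroup N] [NormedSpace ℝ N] [FiniteDimensional ℝ N] {Z : S → N}
    (hZ : MDifferentiable (𝓡 k) 𝓘(ℝ, N) Z) (A : EuclideanSpace ℝ (Fin k) →ₗ[ℝ] N →ₗ[ℝ] N)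
    (hode : ∀ (g : S) (u : GroupLieAlgebra (𝓡 k) S),
      mfderiv (𝓡 k) 𝓘(ℝ, N) Z g (mulInvariantVectorField u g) = A u (Z g))
    (h1 : Z 1 = 0) (g : S) : Z g = 0 := by
  set A' : EuclideanSpace ℝ (Fin k) →L[ℝ] N →L[ℝ] N := LinearMap.toContinuousLinearMap
    ((LinearMap.toContinuousLinearMap (E := N) (F' := N) (𝕜 := ℝ)).toLinearMap ∘ₗ A) with hA'
  exact eq_zero_of_leftInvariant_ode hZ (A := fun u z => A u z) (norm_nonneg A')
    (fun u z => A'.le_opNorm₂ u z) hode h1 g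

theorem euclideanSpace_eq_sum {k : ℕ} (v : EuclideanSpace ℝ (Fin k)) :
    v = ∑ l, v l • EuclideanSpace.single l (1 : ℝ) := by
  ext i
  simp [Pi.single_apply]

theorem mfderiv_sub_const_apply {k : ℕ} {S : Type*} [TopologicalSpace S]
    [ChartedSpace (EuclideanSpace ℝ (Fin k)) S] {N : Type*} [NormedAddCommGroup N]
    [NormedSpace ℝ N] {f : S → N} {g : S} (hf : MDifferentiableAt (𝓡 k) 𝓘(ℝ, N) f g) (c : N)
    (u : EuclideanSpace ℝ (Fin k)) :
    (mfderiv (𝓡 k) 𝓘(ℝ, N) (fun h => f h - c) g u : N) = mfderiv (𝓡 k) 𝓘(ℝ, N) f g u := by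
  have h1 := mfderiv_comp g (I' := 𝓘(ℝ, N)) (g := fun y : N => y - c)
    ((differentiableAt_id.sub_const c).mdifferentiableAt) hf
  have h2 : mfderiv 𝓘(ℝ, N) 𝓘(ℝ, N) (fun y : N => y - c) (f g) = ContinuousLinearMap.id ℝ N := by
    rw [mfderiv_eq_fderiv]
    exact (fderiv_sub_const c).trans fderiv_id
  have h3 : (mfderiv (𝓡 k) 𝓘(ℝ, N) (fun h => f h - c) g u : N) =
      (mfderiv 𝓘(ℝ, N) 𝓘(ℝ, N) (fun y : N => y - c) (f g) : N →L[ℝ] N)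
        (mfderiv (𝓡 k) 𝓘(ℝ, N) f g u) :=
    congrArg (fun T : EuclideanSpace ℝ (Fin k) →L[ℝ] N => T u) h1
  rw [h3]
  exact congrArg (fun T : N →L[ℝ] N => T (mfderiv (𝓡 k) 𝓘(ℝ, N) f g u)) h2

/-! ### From invariance under the Lie algebra to invariance under the group -/

section Transport

variable {k m : ℕ} {S : Type*} [Group S] [TopologicalSpace S]
  [ChartedSpace (EuclideanSpace ℝ (Fin k)) S] [LieGroup (𝓡 k) ∞ S]
  {M : Type*} [TopologicalSpace M] [ChartedSpace (EuclideanSpace ℝ (Fin m)) M]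
  [IsManifold (𝓡 m) ∞ M] [MulAction S M] [ContMDiffSMul (𝓡 k) (𝓡 m) ∞ S M]
  {F : Type*} [NormedAddCommGroup F] [NormedSpace ℝ F] [FiniteDimensional ℝ F]
  {E : M → Type*} [TopologicalSpace (TotalSpace F E)] [∀ x, AddCommGroup (E x)]
  [∀ x, Module ℝ (E x)] [∀ x, TopologicalSpace (E x)] [FiberBundle F E] [VectorBundle ℝ F E]
  [ContMDiffVectorBundle ∞ F E (𝓡 m)] {D : CourantData m E}

variable (F) in
/-- The coordinates of vectors in the fibre at `x` in the preferred trivialization at `x`. -/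
def fibreCoord (x : M) : E x ≃L[ℝ] F :=
  (trivializationAt F E x).continuousLinearEquivAt ℝ x (FiberBundle.mem_baseSet_trivializationAt' x)

theorem fibreCoord_apply (x : M) (v : E x) :
    fibreCoord F x v = (trivializationAt F E x (TotalSpace.mk' F x v)).2 := rfl

namespace EquivariantStructure

variable (X : EquivariantStructure k S F D)

/-- The action of `g` as a map from the fibre at `x` to the fibre at `y = g • x`. -/
def transport (g : S) (x y : M) (h : g • x = y) : E x →ₗ[ℝ] E y := h ▸ X.act g x

theorem mk_transport (g : S) (x y : M) (h : g • x = y) (v : E x) :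
    TotalSpace.mk' F y (X.transport g x y h v) = TotalSpace.mk' F (g • x) (X.act g x v) := by
  subst h
  rfl

theorem transport_one (x : M) (h : (1 : S) • x = x) (v : E x) : X.transport 1 x x h v = v := by
  have := (X.mk_transport 1 x x h v).trans (X.act_one x v)
  exact TotalSpace.mk_inj.1 this

theorem transport_mul (g h : S) (x y z : M) (hxy : h • x = y) (hyz : g • y = z)
    (hxz : (g * h) • x = z) (v : E x) :
    X.transport (g * h) x z hxz v = X.transport g y z hyz (X.transport h x y hxy v) := by
  refine TotalSpace.mk_inj.1 (?_ : TotalSpace.mk' F z _ = TotalSpace.mk' F z _)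
  rw [mk_transport, X.act_mul, mk_transport]
  subst hxy
  rfl

/-- The push-forward of sections under the action of `g`. -/
def push (g : S) (a : ∀ x, E x) (x : M) : E x :=
  X.transport g (g⁻¹ • x) x (smul_inv_smul g x) (a (g⁻¹ • x))

theorem push_one (a : ∀ x, E x) : X.push 1 a = a := by
  funext x
  have : ∀ (y : M) (h : (1 : S) • y = x), X.transport 1 y x h (a y) = a x := by
    intro y h
    have hy : y = x := by rwa [one_smul] at h
    subst hy
    exact X.transport_one _ _ _
  exact this _ _

theorem push_mul (g h : S) (a : ∀ x, E x) : X.push (g * h) a = X.push g (X.push h a) := by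
  funext x
  have : ∀ (y : M) (hy : (g * h) • y = x) (hy' : y = h⁻¹ • g⁻¹ • x),
      X.transport (g * h) y x hy (a y) = X.push g (X.push h a) x := by
    intro y hy hy'
    subst hy'
    exact X.transport_mul g h _ _ _ _ _ _ _
  exact this _ _ (by rw [mul_inv_rev, mul_smul])

theorem mk_push (g : S) (a : ∀ x, E x) (x : M) : TotalSpace.mk' F x (X.push g a x) =
    TotalSpace.mk' F (g • g⁻¹ • x) (X.act g (g⁻¹ • x) (a (g⁻¹ • x))) := X.mk_transport _ _ _ _ _

theorem push_smooth_param {a : ∀ x, E x}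
    (ha : ContMDiff (𝓡 m) ((𝓡 m).prod 𝓘(ℝ, F)) ∞ (fun b => TotalSpace.mk' F b (a b))) :
    ContMDiff ((𝓡 k).prod (𝓡 m)) ((𝓡 m).prod 𝓘(ℝ, F)) ∞
      (fun p : S × M => TotalSpace.mk' F p.2 (X.push p.1 a p.2)) := by
  have h1 : ContMDiff ((𝓡 k).prod (𝓡 m)) (𝓡 m) ∞ (fun p : S × M => p.1⁻¹ • p.2) :=
    (contMDiff_smul (I := 𝓡 k) (I' := 𝓡 m) (n := ∞) (G := S) (M := M)).comp
      (((contMDiff_inv (𝓡 k) ∞).comp contMDiff_fst).prodMk contMDiff_snd)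
  have h2 := X.act_smooth.comp (contMDiff_fst.prodMk (ha.comp h1))
  refine h2.congr fun p => ?_
  exact X.mk_push _ _ _

theorem push_coord_smooth {a : ∀ x, E x}
    (ha : ContMDiff (𝓡 m) ((𝓡 m).prod 𝓘(ℝ, F)) ∞ (fun b => TotalSpace.mk' F b (a b))) (x : M) :
    ContMDiff (𝓡 k) 𝓘(ℝ, F) ∞ (fun g => fibreCoord F x (X.push g a x)) := by
  intro g
  have h1 := ((X.push_smooth_param ha).comp
    (contMDiff_id.prodMk (contMDiff_const (c := x)) : ContMDiff (𝓡 k) _ ∞ fun g : S => (g, x))) g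
  exact (contMDiffAt_totalSpace.1 h1).2

theorem bracket_χ_push (u : GroupLieAlgebra (𝓡 k) S) {a : ∀ x, E x} (ha : D.IsSmooth a) (x : M) :
    fibreCoord F x (D.bracket (X.χ u) a x) =
      mfderiv (𝓡 k) 𝓘(ℝ, F) (fun g : S => fibreCoord F x (X.push g a x)) 1 u := by
  have h : (fun g : S => fibreCoord F x (X.push g a x)) = fun g : S => (trivializationAt F E x
        (TotalSpace.mk' F (g • g⁻¹ • x) (X.act g (g⁻¹ • x) (a (g⁻¹ • x))))).2 := by
    funext g
    rw [fibreCoord_apply, X.mk_push]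
  rw [h]
  exact X.bracket_χ u a x ha

/-- The derivative of `g ↦ f g` along a left invariant vector field. -/
theorem mfderiv_mulInvariant {N : Type*} [NormedAddCommGroup N] [NormedSpace ℝ N] {f : S → N}
    (hf : MDifferentiable (𝓡 k) 𝓘(ℝ, N) f) (g : S) (u : GroupLieAlgebra (𝓡 k) S) :
    mfderiv (𝓡 k) 𝓘(ℝ, N) f g (mulInvariantVectorField u g) =
      mfderiv (𝓡 k) 𝓘(ℝ, N) (fun h => f (g * h)) 1 u := by
  have hd : MDifferentiableAt (𝓡 k) (𝓡 k) (g * ·) (1 : S) :=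
    (contMDiff_mul_left (I := 𝓡 k) (n := ∞) (a := g) 1).mdifferentiableAt (by simp)
  have h1 := mfderiv_comp (1 : S) (hf (g * 1)) hd
  have h2 : ∀ g' : S, g' = g → ∀ v : EuclideanSpace ℝ (Fin k),
      (mfderiv (𝓡 k) 𝓘(ℝ, N) f g v : N) = (mfderiv (𝓡 k) 𝓘(ℝ, N) f g' v : N) := by
    rintro g' rfl v
    rfl
  have h3 : mfderiv (𝓡 k) 𝓘(ℝ, N) (fun h => f (g * h)) 1 =
      mfderiv (𝓡 k) 𝓘(ℝ, N) (f ∘ (g * ·)) 1 := rfl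
  rw [h3, h1]
  exact h2 _ (mul_one g) _

/-- Since push by gh is push by g after push by h, and at a fixed x the outer push is one fixed
linear map Λ between fibres, the derivative at g reduces to the derivative at 1, which is the
bracket with χ(u). -/
theorem mfderiv_push (hD : IsCourantAlgebroid F D) {a : ∀ x, E x} (ha : D.IsSmooth a)
    (x : M) (g : S) (u : GroupLieAlgebra (𝓡 k) S) :
    mfderiv (𝓡 k) 𝓘(ℝ, F) (fun g : S => fibreCoord F x (X.push g a x)) g
      (mulInvariantVectorField u g) =
      fibreCoord F x (X.push g (D.bracket (X.χ u) a) x) := by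
  have hs := fun x => X.push_coord_smooth ((hD.isSmooth_iff a).1 ha) x
  rw [mfderiv_mulInvariant ((hs x).mdifferentiable (by simp))]
  set y := g⁻¹ • x with hy
  set Λ : F →L[ℝ] F := LinearMap.toContinuousLinearMap
    ((fibreCoord F x).toLinearEquiv.toLinearMap ∘ₗ X.transport g y x (smul_inv_smul g x) ∘ₗ
      (fibreCoord F y).symm.toLinearEquiv.toLinearMap) with hΛ
  have hΛa : ∀ v : E y, Λ (fibreCoord F y v) =
      fibreCoord F x (X.transport g y x (smul_inv_smul g x) v) := by
    intro v
    simp [hΛ]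
  have h1 : (fun h => fibreCoord F x (X.push (g * h) a x)) =
      fun h => Λ (fibreCoord F y (X.push h a y)) := by
    funext h
    rw [hΛa, X.push_mul]
    rfl
  have h2 : mfderiv (𝓡 k) 𝓘(ℝ, F) (fun h => Λ (fibreCoord F y (X.push h a y))) 1 u =
      Λ (mfderiv (𝓡 k) 𝓘(ℝ, F) (fun h => fibreCoord F y (X.push h a y)) 1 u) := by
    have h3 := mfderiv_comp (1 : S) (Λ.mdifferentiableAt (x := fibreCoord F y (X.push 1 a y)))
      (((hs y) 1).mdifferentiableAt (by simp))
    have h4 : mfderiv (𝓡 k) 𝓘(ℝ, F) (fun h => Λ (fibreCoord F y (X.push h a y))) 1 =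
      mfderiv (𝓡 k) 𝓘(ℝ, F) (Λ ∘ fun h => fibreCoord F y (X.push h a y)) 1 := rfl
    rw [h4, h3, Λ.mfderiv_eq]
    rfl
  have h5 : (mfderiv (𝓡 k) 𝓘(ℝ, F) (fun h => fibreCoord F x (X.push (g * h) a x)) 1 u : F) =
      mfderiv (𝓡 k) 𝓘(ℝ, F) (fun h => Λ (fibreCoord F y (X.push h a y))) 1 u :=
    congrArg (fun φ : S → F => (mfderiv (𝓡 k) 𝓘(ℝ, F) φ 1 u : F)) h1
  refine h5.trans (h2.trans ?_)
  refine (congrArg Λ (X.bracket_χ_push u ha y).symm).trans ?_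
  exact hΛa _

theorem push_zero (g : S) : X.push g (0 : ∀ x, E x) = 0 := by
  funext x
  exact map_zero _

/-- Sections invariant under the Lie algebra are invariant under the connected Lie group. -/
theorem push_eq_self [ConnectedSpace S] (hD : IsCourantAlgebroid F D) {a : ∀ x, E x}
    (ha : D.IsSmooth a) (hinv : ∀ u, D.bracket (X.χ u) a = 0) (g : S) : X.push g a = a := by
  funext x
  have hs := X.push_coord_smooth ((hD.isSmooth_iff a).1 ha) x
  -- The derivative of Z along the left invariant field of u is the push of [χ(u), a] = 0, so the
  -- uniqueness statement applies with A = 0.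
  set Z : S → F := fun g => fibreCoord F x (X.push g a x) - fibreCoord F x (a x) with hZ
  have hZd : MDifferentiable (𝓡 k) 𝓘(ℝ, F) Z :=
    (hs.sub contMDiff_const).mdifferentiable (by simp)
  have h0 := eq_zero_of_leftInvariant_linear_ode hZd 0 (fun g u => by
    rw [mfderiv_mulInvariant hZd]
    have h1 := X.mfderiv_push hD ha x g u
    rw [mfderiv_mulInvariant (hs.mdifferentiable (by simp)), hinv, X.push_zero, Pi.zero_apply,
      map_zero] at h1
    have hd : MDifferentiableAt (𝓡 k) 𝓘(ℝ, F)
        (fun h : S => fibreCoord F x (X.push (g * h) a x)) 1 :=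
      ((hs.comp (contMDiff_mul_left (I := 𝓡 k) (n := ∞) (a := g))) 1).mdifferentiableAt (by simp)
    exact (mfderiv_sub_const_apply hd (fibreCoord F x (a x)) u).trans h1) (by simp [hZ, X.push_one]) g
  exact (fibreCoord F x).injective (sub_eq_zero.1 h0)

/-- Functions invariant under the Lie algebra are invariant under the connected Lie group. -/
theorem smul_eq_of_deriv_eq_zero [ConnectedSpace S] {f : M → ℝ} (hf : IsSmoothFun m f)
    (hinv : ∀ u, D.deriv (X.χ u) f = 0) (g : S) (x : M) : f (g • x) = f x := by
  have hsm : ∀ x : M, ContMDiff (𝓡 k) (𝓡 m) ∞ (fun g : S => g⁻¹ • x) := fun x =>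
    (contMDiff_smul (I := 𝓡 k) (I' := 𝓡 m) (n := ∞) (G := S) (M := M)).comp
      ((contMDiff_inv (𝓡 k) ∞).prodMk contMDiff_const)
  have key : ∀ (x : M) (u : GroupLieAlgebra (𝓡 k) S),
      mfderiv (𝓡 k) 𝓘(ℝ, ℝ) (fun h : S => f (h⁻¹ • x)) 1 u = 0 := by
    intro x u
    have h1 := mfderiv_comp (1 : S) (hf.mdiff ((1 : S)⁻¹ • x)) ((hsm x 1).mdifferentiableAt (by simp))
    have h2 : mfderiv (𝓡 k) 𝓘(ℝ, ℝ) (fun h : S => f (h⁻¹ • x)) 1 =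
      mfderiv (𝓡 k) 𝓘(ℝ, ℝ) (f ∘ fun h : S => h⁻¹ • x) 1 := rfl
    have h3 : ∀ (y : M), y = x → ∀ (w : EuclideanSpace ℝ (Fin m)),
        (mfderiv (𝓡 m) 𝓘(ℝ, ℝ) f y w : ℝ) = (mfderiv (𝓡 m) 𝓘(ℝ, ℝ) f x w : ℝ) := by
      rintro y rfl w
      rfl
    have h4 : (mfderiv (𝓡 k) 𝓘(ℝ, ℝ) (fun h : S => f (h⁻¹ • x)) 1 u : ℝ) =
        (mfderiv (𝓡 m) 𝓘(ℝ, ℝ) f ((1 : S)⁻¹ • x) : EuclideanSpace ℝ (Fin m) →L[ℝ] ℝ)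
          (mfderiv (𝓡 k) (𝓡 m) (fun h : S => h⁻¹ • x) 1 u) :=
      congrArg (fun T : EuclideanSpace ℝ (Fin k) →L[ℝ] ℝ => T u) (h2.trans h1)
    refine h4.trans ((h3 ((1 : S)⁻¹ • x) (by simp) _).trans ?_)
    refine Eq.trans ?_ (congrFun (hinv u) x)
    exact congrArg (fun w => (mfderiv (𝓡 m) 𝓘(ℝ, ℝ) f x : EuclideanSpace ℝ (Fin m) →L[ℝ] ℝ) w)
      (X.rho_χ u x).symm
  -- The inverse matches the convention that ρ(χ(u)) is the derivative of g⁻¹ • x; the conclusion is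
  -- accordingly evaluated at g⁻¹.
  set Z : S → ℝ := fun h => f (h⁻¹ • x) - f x with hZ
  have hs : ContMDiff (𝓡 k) 𝓘(ℝ, ℝ) ∞ (fun h : S => f (h⁻¹ • x)) := hf.comp (hsm x)
  have hZd : MDifferentiable (𝓡 k) 𝓘(ℝ, ℝ) Z := (hs.sub contMDiff_const).mdifferentiable (by simp)
  have h0 := eq_zero_of_leftInvariant_linear_ode hZd 0 (fun g u => by
    rw [mfderiv_mulInvariant hZd]
    have h4 : (fun h => Z (g * h)) =
        fun h : S => f (h⁻¹ • g⁻¹ • x) - f x := by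
      funext h
      simp [hZ, mul_smul]
    have hd : MDifferentiableAt (𝓡 k) 𝓘(ℝ, ℝ) (fun h : S => f (h⁻¹ • g⁻¹ • x)) 1 :=
      ((hf.comp (hsm (g⁻¹ • x))) 1).mdifferentiableAt (by simp)
    rw [h4]
    exact (mfderiv_sub_const_apply hd (f x) u).trans (key _ _)) (by simp [hZ]) g⁻¹
  simpa [hZ, sub_eq_zero] using h0

omit [LieGroup (𝓡 k) ∞ S] [ContMDiffSMul (𝓡 k) (𝓡 m) ∞ S M] in
-- The double orthogonal of a subspace of a finite-dimensional fibre is the subspace itself: a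
-- functional separating v from it is represented by a vector of 𝔰_E^⊥.
theorem mem_sFibre_of_pairing (hD : IsCourantAlgebroid F D) {x : M} {v : E x}
    (h : ∀ p ∈ X.perpFibre x, D.pairing x v p = 0) : v ∈ X.sFibre x := by
  by_contra hv
  obtain ⟨φ, hφv, hφ⟩ := Submodule.exists_dual_map_eq_bot_of_notMem hv inferInstance
  obtain ⟨p, hp⟩ := hD.exists_dual_vector x φ
  refine hφv ?_
  rw [← hp, hD.pairing_symm]
  refine h p fun u => ?_
  rw [hD.pairing_symm, hp]
  have : φ (X.χ u x) ∈ (X.sFibre x).map φ := Submodule.mem_map_of_mem ⟨u, rfl⟩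
  rw [hφ] at this
  exact (Submodule.mem_bot ℝ).1 this

/-- The action of `S` preserves `𝔰_E`. -/
theorem push_χ_mem [ConnectedSpace S] (hD : IsCourantAlgebroid F D)
    (g : S) (v : GroupLieAlgebra (𝓡 k) S) (x : M) : X.push g (X.χ v) x ∈ X.sFibre x := by
  have hlg := lieGroup_three k S
  refine X.mem_sFibre_of_pairing hD fun p hp => ?_
  -- the pairing with `p` in coordinates
  set P : F →L[ℝ] ℝ := LinearMap.toContinuousLinearMap
    (((D.pairing x).flip p) ∘ₗ (fibreCoord F x).symm.toLinearEquiv.toLinearMap) with hP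
  have hPa : ∀ w : E x, P (fibreCoord F x w) = D.pairing x w p := fun w => by simp [hP]
  set b : Fin k → GroupLieAlgebra (𝓡 k) S := fun j =>
    (EuclideanSpace.single j (1 : ℝ) : EuclideanSpace ℝ (Fin k)) with hb
  have hsum : ∀ v : GroupLieAlgebra (𝓡 k) S, ∃ t : Fin k → ℝ, v = ∑ l, t l • b l := fun v =>
    ⟨fun l => (show EuclideanSpace ℝ (Fin k) from v) l, euclideanSpace_eq_sum _⟩
  set c : Fin k → Fin k → EuclideanSpace ℝ (Fin k) →ₗ[ℝ] ℝ := fun j l =>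
    { toFun := fun u => (show EuclideanSpace ℝ (Fin k) from
        (⁅(show GroupLieAlgebra (𝓡 k) S from u), b j⁆ : GroupLieAlgebra (𝓡 k) S)) l
      map_add' := fun u u' => congrArg (fun w : EuclideanSpace ℝ (Fin k) => w l)
        (add_lie (show GroupLieAlgebra (𝓡 k) S from u) (show GroupLieAlgebra (𝓡 k) S from u') (b j))
      map_smul' := fun t u => congrArg (fun w : EuclideanSpace ℝ (Fin k) => w l)
        (smul_lie t (show GroupLieAlgebra (𝓡 k) S from u) (b j)) } with hc
  have hlie : ∀ (u : GroupLieAlgebra (𝓡 k) S) j, ⁅u, b j⁆ = ∑ l, c j l u • b l := fun u j =>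
    euclideanSpace_eq_sum _
  have hpushlin : ∀ (g : S) (t : Fin k → ℝ), X.push g (X.χ (∑ l, t l • b l)) x =
      ∑ l, t l • X.push g (X.χ (b l)) x := by
    intro g t
    simp only [push, map_sum, map_smul, Finset.sum_apply, Pi.smul_apply]
  -- The derivative of push g (χ(b_j)) in the direction u is push g (χ([u, b_j])), so these
  -- functions satisfy a linear system with the structure constants as coefficients. They vanish at
  -- g = 1 because p is in 𝔰_E^⊥.
  set Z : S → Fin k → ℝ := fun g j => P (fibreCoord F x (X.push g (X.χ (b j)) x)) with hZ
  have hs : ∀ j, ContMDiff (𝓡 k) 𝓘(ℝ, F) ∞ (fun g : S => fibreCoord F x (X.push g (X.χ (b j)) x)) :=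
    fun j => X.push_coord_smooth ((hD.isSmooth_iff _).1 (X.χ_smooth _)) x
  have hZj : ∀ j, ContMDiff (𝓡 k) 𝓘(ℝ, ℝ) ∞ (fun g => Z g j) := fun j =>
    P.contDiff.contMDiff.comp (hs j)
  have hZs : ContMDiff (𝓡 k) 𝓘(ℝ, Fin k → ℝ) ∞ Z := contMDiff_pi_space.2 hZj
  set A : EuclideanSpace ℝ (Fin k) →ₗ[ℝ] (Fin k → ℝ) →ₗ[ℝ] (Fin k → ℝ) :=
    LinearMap.mk₂ ℝ (fun u z j => ∑ l, c j l u * z l)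
      (fun u u' z => by
        funext j
        simp only [map_add, add_mul, Finset.sum_add_distrib, Pi.add_apply])
      (fun t u z => by
        funext j
        simp only [map_smul, smul_eq_mul, mul_assoc, Finset.mul_sum, Pi.smul_apply])
      (fun u z z' => by
        funext j
        simp only [mul_add, Finset.sum_add_distrib, Pi.add_apply])
      (fun t u z => by
        funext j
        simp only [smul_eq_mul, Finset.mul_sum, Pi.smul_apply]
        exact Finset.sum_congr rfl fun l _ => by ring) with hA
  have h0 := eq_zero_of_leftInvariant_linear_ode (hZs.mdifferentiable (by simp)) A
    (fun g u => by
      rw [mfderiv_mulInvariant (hZs.mdifferentiable (by simp))]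
      funext j
      have h1 : ContMDiff (𝓡 k) 𝓘(ℝ, Fin k → ℝ) ∞ fun h => Z (g * h) :=
        hZs.comp (contMDiff_mul_left (I := 𝓡 k) (n := ∞) (a := g))
      have h2 := mfderiv_comp (1 : S)
        ((ContinuousLinearMap.proj (R := ℝ) (φ := fun _ : Fin k => ℝ) j).mdifferentiableAt
          (x := Z (g * 1))) ((h1 1).mdifferentiableAt (by simp))
      have h3 := congrArg (fun T => T u) h2
      rw [ContinuousLinearMap.mfderiv_eq] at h3
      have h4 := mfderiv_comp (1 : S)
        (P.mdifferentiableAt (x := fibreCoord F x (X.push (g * 1) (X.χ (b j)) x)))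
        ((((hs j).comp (contMDiff_mul_left (I := 𝓡 k) (n := ∞) (a := g))) 1).mdifferentiableAt
          (by simp))
      have h5 := congrArg (fun T => T u) h4
      rw [ContinuousLinearMap.mfderiv_eq] at h5
      have h6 := X.mfderiv_push hD (X.χ_smooth (b j)) x g u
      rw [mfderiv_mulInvariant ((hs j).mdifferentiable (by simp)), X.χ_bracket, hlie,
        hpushlin] at h6
      have h7 : (A u (Z g)) j = ∑ l, c j l u * Z g l := rfl
      rw [h7]
      refine (h3.symm.trans h5).trans ?_
      refine (congrArg P h6).trans ?_
      simp only [map_sum, map_smul, smul_eq_mul]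
      rfl)
    (by
      funext j
      simp only [hZ, X.push_one, hPa, Pi.zero_apply]
      exact hp (b j)) g
  rw [← hPa]
  obtain ⟨t, rfl⟩ := hsum v
  rw [hpushlin]
  simp only [map_sum, map_smul]
  refine Finset.sum_eq_zero fun l _ => ?_
  have := congrFun h0 l
  simp only [hZ, Pi.zero_apply] at this
  rw [this, smul_zero]

/-- An invariant section which lies in `𝔰_E` at a point does so on the whole orbit. -/
theorem mem_sFibre_smul [ConnectedSpace S] (hD : IsCourantAlgebroid F D) {d : ∀ x, E x}
    (hd : D.IsSmooth d) (hinv : ∀ u, D.bracket (X.χ u) d = 0) {x : M} (hx : d x ∈ X.sFibre x)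
    (g : S) : d (g • x) ∈ X.sFibre (g • x) := by
  obtain ⟨v, hv⟩ := hx
  have hv' : d x = X.χ v x := hv.symm
  have h1 := congrFun (X.push_eq_self hD hd hinv g) (g • x)
  have h2 : X.push g d (g • x) = X.push g (X.χ v) (g • x) := by
    have : ∀ y, y = x → d y = X.χ v y := by
      rintro y rfl
      exact hv'
    simp only [push]
    rw [this _ (inv_smul_smul g x)]
  rw [← h1, h2]
  exact X.push_χ_mem hD g v _

end EquivariantStructure

end Transport

universe uN

/-! ### Smooth dependence of integrals on a parameter -/

section ParametricIntegral

open MeasureTheory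

variable {k : ℕ} {S : Type*} [TopologicalSpace S] [ChartedSpace (EuclideanSpace ℝ (Fin k)) S]
  [IsManifold (𝓡 k) ∞ S] [R1Space S] [MeasurableSpace S] [BorelSpace S] {μ : Measure S} [IsFiniteMeasureOnCompacts μ]
  {W : Type} [NormedAddCommGroup W] [NormedSpace ℝ W] [FiniteDimensional ℝ W]

theorem contMDiffAt_fderiv_param {N : Type*} [NormedAddCommGroup N] [NormedSpace ℝ N]
    {f : W → S → N} {x : W} {g : S}
    (hf : ContMDiffAt (𝓘(ℝ, W).prod (𝓡 k)) 𝓘(ℝ, N) ∞ (fun p : W × S => f p.1 p.2) (x, g)) :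
    ContMDiffAt (𝓘(ℝ, W).prod (𝓡 k)) 𝓘(ℝ, W →L[ℝ] N) ∞
      (fun p : W × S => fderiv ℝ (fun y => f y p.2) p.1) (x, g) := by
  have h1 : ContMDiffAt ((𝓘(ℝ, W).prod (𝓡 k)).prod 𝓘(ℝ, W)) 𝓘(ℝ, N) ∞
      (Function.uncurry fun (p : W × S) (y : W) => f y p.2) ((x, g), x) :=
    ContMDiffAt.comp ((x, g), x) (g := fun p : W × S => f p.1 p.2)
      (f := fun r : (W × S) × W => (r.2, r.1.2)) hf
      (contMDiffAt_snd.prodMk (contMDiffAt_snd.comp _ contMDiffAt_fst))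
  have h2 := ContMDiffAt.mfderiv (m := ∞) (fun (p : W × S) (y : W) => f y p.2) Prod.fst h1
    contMDiffAt_fst le_rfl
  have h3 := inTangentCoordinates_model_space (I := 𝓘(ℝ, W)) (I' := 𝓘(ℝ, N)) (Prod.fst : W × S → W)
    (fun p : W × S => f p.1 p.2) (fun p => mfderiv 𝓘(ℝ, W) 𝓘(ℝ, N) (fun y => f y p.2) p.1) (x, g)
  have h4 := h2.congr_of_eventuallyEq (Filter.EventuallyEq.of_eq h3.symm)
  simp only [mfderiv_eq_fderiv] at h4
  exact h4

theorem integrable_of_eq_zero_off_compact {N : Type*} [NormedAddCommGroup N] {K : Set S}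
    (hK : IsCompact K) {f : S → N} (hf : Continuous f) (h0 : ∀ g, g ∉ K → f g = 0) :
    Integrable f μ :=
  hf.integrable_of_hasCompactSupport (HasCompactSupport.intro hK h0)

/-- Differentiation under the integral sign. The integrand vanishes off a fixed compact set, so on a
closed ball of parameters its derivative is dominated by a constant on that set. -/
theorem hasFDerivAt_integral_param {N : Type*} [NormedAddCommGroup N] [NormedSpace ℝ N]
    {K : Set S} (hK : IsCompact K) {U : Set W} (hU : IsOpen U) {f : W → S → N}
    (hf : ∀ x ∈ U, ∀ g, ContMDiffAt (𝓘(ℝ, W).prod (𝓡 k)) 𝓘(ℝ, N) ∞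
      (fun p : W × S => f p.1 p.2) (x, g))
    (h0 : ∀ x ∈ U, ∀ g, g ∉ K → f x g = 0) {x : W} (hx : x ∈ U) :
    HasFDerivAt (fun x => ∫ g, f x g ∂μ) (∫ g, fderiv ℝ (fun y => f y g) x ∂μ) x := by
  have : ProperSpace W := FiniteDimensional.proper_real W
  have hcont : ∀ y ∈ U, Continuous (f y) := fun y hy => continuous_iff_continuousAt.2 fun g =>
    (hf y hy g).continuousAt.comp (continuousAt_const.prodMk continuousAt_id)
  have hcont' : ∀ y ∈ U, ∀ g, ContinuousAt (fun p : W × S => fderiv ℝ (fun y => f y p.2) p.1)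
      (y, g) := fun y hy g => (contMDiffAt_fderiv_param (hf y hy g)).continuousAt
  have h0' : ∀ y ∈ U, ∀ g, g ∉ K → fderiv ℝ (fun y => f y g) y = 0 := by
    intro y hy g hg
    have : (fun y => f y g) =ᶠ[𝓝 y] fun _ => 0 := by
      filter_upwards [hU.mem_nhds hy] with z hz using h0 z hz g hg
    rw [this.fderiv_eq, fderiv_fun_const]
    rfl
  obtain ⟨r, hr, hrU⟩ := Metric.nhds_basis_closedBall.mem_iff.1 (hU.mem_nhds hx)
  obtain ⟨C, hC⟩ := ((isCompact_closedBall x r).prod hK).exists_bound_of_continuousOn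
    (f := fun p : W × S => fderiv ℝ (fun y => f y p.2) p.1)
    (fun p hp => (hcont' p.1 (hrU hp.1) p.2).continuousWithinAt)
  -- The closure is used because it is measurable; in an R1 space it is still compact.
  have hKc : IsCompact (closure K) := hK.closure
  refine hasFDerivAt_integral_of_dominated_of_fderiv_le
    (bound := (closure K).indicator fun _ => C) (s := Metric.closedBall x r)
    (F' := fun y g => fderiv ℝ (fun y => f y g) y) (𝕜 := ℝ)
    (Metric.closedBall_mem_nhds x hr) ?_ ?_ ?_ ?_ ?_ ?_
  · filter_upwards [hU.mem_nhds hx] with y hy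
    exact (integrable_of_eq_zero_off_compact (μ := μ) hK (hcont y hy) (h0 y hy)).1
  · exact integrable_of_eq_zero_off_compact hK (hcont x hx) (h0 x hx)
  · refine (integrable_of_eq_zero_off_compact (μ := μ) hK
      (continuous_iff_continuousAt.2 fun g => ?_) (h0' x hx)).1
    exact (hcont' x hx g).comp (f := fun g : S => (x, g))
      (continuousAt_const.prodMk continuousAt_id)
  · refine Filter.Eventually.of_forall fun g y hy => ?_
    by_cases hg : g ∈ K
    · rw [Set.indicator_of_mem (subset_closure hg)]
      exact hC (y, g) ⟨hy, hg⟩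
    · rw [h0' y (hrU hy) g hg, norm_zero]
      by_cases hK0 : K.Nonempty
      · obtain ⟨g', hg'⟩ := hK0
        have : 0 ≤ C := (norm_nonneg _).trans (hC (y, g') ⟨hy, hg'⟩)
        exact Set.indicator_nonneg (fun _ _ => this) g
      · rw [Set.not_nonempty_iff_eq_empty.1 hK0]
        simp
  · exact (integrable_indicator_iff isClosed_closure.measurableSet).2
      (integrableOn_const hKc.measure_lt_top.ne)
  · refine Filter.Eventually.of_forall fun g y hy => ?_
    have h1 := ContMDiffAt.comp y (g := fun p : W × S => f p.1 p.2) (f := fun y => (y, g))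
      (hf y (hrU hy) g) (contMDiffAt_id.prodMk contMDiffAt_const)
    exact (h1.contDiffAt.differentiableAt (by simp)).hasFDerivAt

/-- The inductive step replaces N by W →L[ℝ] N, so the target space is quantified after n; with W in
the lowest universe the new target stays in the universe of N. -/
theorem contDiffOn_integral_param {K : Set S} (hK : IsCompact K) {U : Set W} (hU : IsOpen U)
    (n : ℕ) : ∀ {N : Type uN} [NormedAddCommGroup N] [NormedSpace ℝ N] {f : W → S → N}
    (hf : ∀ x ∈ U, ∀ g, ContMDiffAt (𝓘(ℝ, W).prod (𝓡 k)) 𝓘(ℝ, N) ∞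
      (fun p : W × S => f p.1 p.2) (x, g))
    (h0 : ∀ x ∈ U, ∀ g, g ∉ K → f x g = 0), ContDiffOn ℝ n (fun x => ∫ g, f x g ∂μ) U := by
  induction n with
  | zero =>
    intro N _ _ f hf h0
    exact contDiffOn_zero.2 fun x hx =>
      (hasFDerivAt_integral_param hK hU hf h0 hx).continuousAt.continuousWithinAt
  | succ n ih =>
    intro N _ _ f hf h0
    have h1 : ContDiffOn ℝ ((n : WithTop ℕ∞) + 1) (fun x => ∫ g, f x g ∂μ) U := by
      refine (contDiffOn_succ_iff_fderiv_of_isOpen hU).2 ⟨fun x hx =>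
        (hasFDerivAt_integral_param hK hU hf h0 hx).differentiableAt.differentiableWithinAt,
        by simp, ?_⟩
      refine ContDiffOn.congr (f := fun x => ∫ g, fderiv ℝ (fun y => f y g) x ∂μ) ?_
        fun x hx => (hasFDerivAt_integral_param hK hU hf h0 hx).fderiv
      refine ih (fun x hx g => contMDiffAt_fderiv_param (hf x hx g)) fun x hx g hg => ?_
      have : (fun y => f y g) =ᶠ[𝓝 x] fun _ => 0 := by
        filter_upwards [hU.mem_nhds hx] with z hz using h0 z hz g hg
      rw [this.fderiv_eq, fderiv_fun_const]
      rfl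
    exact_mod_cast h1

end ParametricIntegral

/-! ### Averaging over the group -/

section Average

open MeasureTheory
open scoped Pointwise

variable {k m : ℕ} {S : Type*} [Group S] [TopologicalSpace S]
  [ChartedSpace (EuclideanSpace ℝ (Fin k)) S] [LieGroup (𝓡 k) ∞ S]
  {M : Type*} [TopologicalSpace M] [ChartedSpace (EuclideanSpace ℝ (Fin m)) M]
  [IsManifold (𝓡 m) ∞ M] [MulAction S M] [ContMDiffSMul (𝓡 k) (𝓡 m) ∞ S M]
  {F : Type*} [NormedAddCommGroup F] [NormedSpace ℝ F] [FiniteDimensional ℝ F]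
  {E : M → Type*} [TopologicalSpace (TotalSpace F E)] [∀ x, AddCommGroup (E x)]
  [∀ x, Module ℝ (E x)] [∀ x, TopologicalSpace (E x)] [FiberBundle F E] [VectorBundle ℝ F E]
  [ContMDiffVectorBundle ∞ F E (𝓡 m)] {D : CourantData m E}

namespace EquivariantStructure

variable (X : EquivariantStructure k S F D) [IsTopologicalGroup S] [LocallyCompactSpace S]
  [MeasurableSpace S] [BorelSpace S] (μ : Measure S) [μ.IsHaarMeasure]

/-- The average over `S` of the translates of a section. -/
def average (a : ∀ x, E x) (x : M) : E x :=
  (fibreCoord F x).symm (∫ g, fibreCoord F x (X.push g a x) ∂μ)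

omit [IsTopologicalGroup S] [LocallyCompactSpace S] [MeasurableSpace S] [BorelSpace S] in
-- For compact C and N, properness makes the exceptional set of g compact, and it does not depend on
-- x in N. This is the uniform support needed for the integral over S.
theorem push_eq_zero {a : ∀ x, E x} {C N : Set M} (h0 : ∀ x, x ∉ C → a x = 0) {x : M} (hx : x ∈ N)
    {g : S} (hg : g ∉ {g : S | (g • C ∩ N).Nonempty}) : X.push g a x = 0 := by
  have : g⁻¹ • x ∉ C := fun h => hg ⟨x, ⟨g⁻¹ • x, h, smul_inv_smul g x⟩, hx⟩
  simp only [push]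
  rw [h0 _ this, map_zero]

theorem integrable_push [ProperSMul S M] {a : ∀ x, E x}
    (ha : ContMDiff (𝓡 m) ((𝓡 m).prod 𝓘(ℝ, F)) ∞ (fun b => TotalSpace.mk' F b (a b))) {C : Set M}
    (hC : IsCompact C) (h0 : ∀ x, x ∉ C → a x = 0) (x : M) :
    Integrable (fun g => fibreCoord F x (X.push g a x)) μ :=
  integrable_of_eq_zero_off_compact
    (ProperSMul.isCompact_setOfPred_inter_nonempty hC (isCompact_singleton (x := x)))
    (X.push_coord_smooth ha x).continuous fun g hg => by
      rw [X.push_eq_zero h0 (Set.mem_singleton x) hg, map_zero]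

theorem average_smooth [ProperSMul S M] [T2Space M] {a : ∀ x, E x}
    (ha : ContMDiff (𝓡 m) ((𝓡 m).prod 𝓘(ℝ, F)) ∞ (fun b => TotalSpace.mk' F b (a b))) {C : Set M}
    (hC : IsCompact C) (h0 : ∀ x, x ∉ C → a x = 0) :
    ContMDiff (𝓡 m) ((𝓡 m).prod 𝓘(ℝ, F)) ∞
      (fun b => TotalSpace.mk' F b (X.average μ a b)) := by
  intro x
  have hlc : LocallyCompactSpace M := ChartedSpace.locallyCompactSpace (EuclideanSpace ℝ (Fin m)) M
  obtain ⟨N, hN, hxN⟩ := exists_compact_mem_nhds x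
  set t := trivializationAt F E x with ht
  have hxb : x ∈ t.baseSet := FiberBundle.mem_baseSet_trivializationAt' x
  set φ := extChartAt (𝓡 m) x with hφ
  set f : EuclideanSpace ℝ (Fin m) → S → F := fun z g =>
    (t (TotalSpace.mk' F (φ.symm z) (X.push g a (φ.symm z)))).2 with hf
  set U : Set (EuclideanSpace ℝ (Fin m)) := φ.target ∩ φ.symm ⁻¹' (t.baseSet ∩ interior N) with hU
  have hUo : IsOpen U := (continuousOn_extChartAt_symm x).isOpen_inter_preimage
    (isOpen_extChartAt_target x) (t.open_baseSet.inter isOpen_interior)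
  have hxU : φ x ∈ U := by
    refine ⟨mem_extChartAt_target x, ?_⟩
    rw [Set.mem_preimage, hφ, extChartAt_to_inv]
    exact ⟨hxb, mem_interior_iff_mem_nhds.2 hxN⟩
  have hfs : ∀ z ∈ U, ∀ g, ContMDiffAt (𝓘(ℝ, EuclideanSpace ℝ (Fin m)).prod (𝓡 k)) 𝓘(ℝ, F) ∞
      (fun p : EuclideanSpace ℝ (Fin m) × S => f p.1 p.2) (z, g) := by
    intro z hz g
    have h1 : ContMDiffAt (𝓘(ℝ, EuclideanSpace ℝ (Fin m)).prod (𝓡 k)) ((𝓡 k).prod (𝓡 m)) ∞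
        (fun p : EuclideanSpace ℝ (Fin m) × S => (p.2, φ.symm p.1)) (z, g) := by
      refine contMDiffAt_snd.prodMk ?_
      exact ContMDiffAt.comp (z, g) (((contMDiffOn_extChartAt_symm x).contMDiffAt
        ((isOpen_extChartAt_target x).mem_nhds hz.1))) contMDiffAt_fst
    have h2 := ContMDiffAt.comp (z, g) (X.push_smooth_param ha (g, φ.symm z)) h1
    exact ((t.contMDiffAt_iff (n := ∞) (IB := 𝓡 m) (t.mem_source.2 hz.2.1)).1 h2).2
  have hf0 : ∀ z ∈ U, ∀ g, g ∉ {g : S | (g • C ∩ N).Nonempty} → f z g = 0 := by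
    intro z hz g hg
    have := X.push_eq_zero h0 (interior_subset hz.2.2) hg
    simp only [hf]
    rw [this]
    exact (t.linear ℝ hz.2.1).map_zero
  have hK := ProperSMul.isCompact_setOfPred_inter_nonempty (G := S) hC hN
  have h1 : ContDiffOn ℝ ∞ (fun z => ∫ g, f z g ∂μ) U := contDiffOn_infty.2 fun n =>
    contDiffOn_integral_param hK hUo n hfs hf0
  have h2 : ContMDiffAt (𝓡 m) 𝓘(ℝ, F) ∞ (fun y => ∫ g, f (φ y) g ∂μ) x :=
    ContMDiffAt.comp x (g := fun z => ∫ g, f z g ∂μ) (f := φ)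
      ((h1.contDiffAt (hUo.mem_nhds hxU)).contMDiffAt) contMDiffAt_extChartAt
  rw [Bundle.contMDiffAt_section]
  refine h2.congr_of_eventuallyEq ?_
  filter_upwards [t.open_baseSet.mem_nhds hxb, extChartAt_source_mem_nhds (I := 𝓡 m) x]
    with y hy hys
  have hint := X.integrable_push μ ha hC h0 y
  -- The average at y is defined in the preferred trivialization at y; L converts it to the fixed
  -- trivialization at x and, being linear, passes through the integral.
  set L : F →L[ℝ] F := (t.continuousLinearEquivAt ℝ y hy : E y →L[ℝ] F) ∘L
    (((fibreCoord F y : E y ≃L[ℝ] F).symm : F ≃L[ℝ] E y) : F →L[ℝ] E y) with hL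
  have h3 : (t (TotalSpace.mk' F y (X.average μ a y))).2 =
      L (∫ g, fibreCoord F y (X.push g a y) ∂μ) := rfl
  refine h3.trans ?_
  rw [← L.integral_comp_comm hint]
  refine integral_congr_ae (Filter.Eventually.of_forall fun g => ?_)
  have h4 : φ.symm (φ y) = y := φ.left_inv hys
  have h5 : ∀ y', y' = y → (t (TotalSpace.mk' F y (X.push g a y))).2 =
      (t (TotalSpace.mk' F y' (X.push g a y'))).2 := by
    rintro y' rfl
    rfl
  refine Eq.trans ?_ (h5 _ h4)
  simp only [hL, ContinuousLinearMap.comp_apply, ContinuousLinearEquiv.coe_coe,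
    ContinuousLinearEquiv.symm_apply_apply]
  rfl

/-- The action is linear on fibres and can be taken inside the integral, where it becomes a left
translation of g; the Haar measure is left invariant. -/
theorem push_average [ProperSMul S M] {a : ∀ x, E x}
    (ha : ContMDiff (𝓡 m) ((𝓡 m).prod 𝓘(ℝ, F)) ∞ (fun b => TotalSpace.mk' F b (a b))) {C : Set M}
    (hC : IsCompact C) (h0 : ∀ x, x ∉ C → a x = 0) (h : S) :
    X.push h (X.average μ a) = X.average μ a := by
  funext x
  set y := h⁻¹ • x with hy
  set Λ : F →L[ℝ] F := LinearMap.toContinuousLinearMap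
    ((fibreCoord F x).toLinearEquiv.toLinearMap ∘ₗ X.transport h y x (smul_inv_smul h x) ∘ₗ
      (fibreCoord F y).symm.toLinearEquiv.toLinearMap) with hΛ
  have hΛa : ∀ v : E y, Λ (fibreCoord F y v) =
      fibreCoord F x (X.transport h y x (smul_inv_smul h x) v) := by
    intro v
    simp [hΛ]
  apply (fibreCoord F x).injective
  have h1 : fibreCoord F x (X.push h (X.average μ a) x) =
      Λ (∫ g, fibreCoord F y (X.push g a y) ∂μ) := rfl
  rw [h1, ← Λ.integral_comp_comm (X.integrable_push μ ha hC h0 y)]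
  have h2 : ∀ g, Λ (fibreCoord F y (X.push g a y)) = fibreCoord F x (X.push (h * g) a x) := by
    intro g
    rw [hΛa, X.push_mul]
    rfl
  simp only [h2]
  rw [integral_mul_left_eq_self (fun g => fibreCoord F x (X.push g a x)) h]
  exact ((fibreCoord F x).apply_symm_apply _).symm

omit [IsTopologicalGroup S] [LocallyCompactSpace S] [MeasurableSpace S] [BorelSpace S] in
theorem bracket_χ_eq_zero_of_push {a : ∀ x, E x} (ha : D.IsSmooth a)
    (h : ∀ g, X.push g a = a) (u : GroupLieAlgebra (𝓡 k) S) : D.bracket (X.χ u) a = 0 := by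
  funext x
  apply (fibreCoord F x).injective
  rw [X.bracket_χ_push u ha x]
  have h1 : (fun g : S => fibreCoord F x (X.push g a x)) = fun _ => fibreCoord F x (a x) := by
    funext g
    rw [h]
  rw [h1, Pi.zero_apply, map_zero]
  have : mfderiv (𝓡 k) 𝓘(ℝ, F) (fun _ : S => fibreCoord F x (a x)) 1 = 0 := mfderiv_const
  exact congrArg (fun T : EuclideanSpace ℝ (Fin k) →L[ℝ] F => T u) this

end EquivariantStructure

/-- For a free and proper action, `g⁻¹ • x` is close to `x` only for `g` close to `1`. -/
theorem exists_isOpen_of_inv_smul_mem {S M : Type*} [Group S] [TopologicalSpace S]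
    [ContinuousInv S] [TopologicalSpace M] [T1Space M] [MulAction S M] [ProperSMul S M]
    [IsCancelSMul S M] {O : Set S} (hO : IsOpen O) (h1 : (1 : S) ∈ O) (x : M) :
    ∃ U : Set M, IsOpen U ∧ x ∈ U ∧ ∀ g : S, g⁻¹ • x ∈ U → g ∈ O := by
  -- A proper map is closed, so the pairs (g⁻¹ • x, x) with g outside O form a closed set. By
  -- freeness it does not contain (x, x).
  have hcl : IsClosed ((fun p : S × M => (p.1 • p.2, p.2)) ''
      ({g : S | g⁻¹ ∈ Oᶜ} ×ˢ {x})) :=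
    (ProperSMul.isProperMap_smul_pair (G := S) (X := M)).isClosedMap _
      ((hO.isClosed_compl.preimage continuous_inv).prod isClosed_singleton)
  refine ⟨(fun y => (y, x)) ⁻¹' ((fun p : S × M => (p.1 • p.2, p.2)) ''
      ({g : S | g⁻¹ ∈ Oᶜ} ×ˢ {x}))ᶜ, hcl.isOpen_compl.preimage (by fun_prop), ?_, ?_⟩
  · rintro ⟨⟨g, y⟩, ⟨hg, hy⟩, hgy⟩
    obtain ⟨hgy1, hgy2⟩ := Prod.mk.inj hgy
    have hg1 : g = 1 := IsCancelSMul.eq_one_of_smul (hgy1.trans hgy2.symm)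
    have hg' : g⁻¹ ∈ Oᶜ := hg
    rw [hg1, inv_one] at hg'
    exact hg' h1
  · intro g hg
    by_contra hgO
    refine hg ⟨(g⁻¹, x), ⟨?_, rfl⟩, rfl⟩
    rw [Set.mem_ofPred_eq, inv_inv]
    exact hgO

/-- Invariant sections span every fibre. -/
theorem EquivariantStructure.exists_invariant_section [T2Space M] [ProperSMul S M]
    [IsCancelSMul S M] (X : EquivariantStructure k S F D) (hD : IsCourantAlgebroid F D) (x : M)
    (v : E x) : ∃ a, D.IsSmooth a ∧ (∀ u, D.bracket (X.χ u) a = 0) ∧ a x = v := by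
  have hG : IsTopologicalGroup S := topologicalGroup_of_lieGroup (𝓡 k) ∞
  have hlS : LocallyCompactSpace S := ChartedSpace.locallyCompactSpace (EuclideanSpace ℝ (Fin k)) S
  have hlc : LocallyCompactSpace M := ChartedSpace.locallyCompactSpace (EuclideanSpace ℝ (Fin m)) M
  let _ : MeasurableSpace S := borel S
  have hB : BorelSpace S := ⟨rfl⟩
  set μ : Measure S := Measure.haar with hμ
  -- The values at x of invariant sections form a subspace. It suffices that no functional ℓ with ℓ
  -- v ≠ 0 vanishes on it, so no average has to take the value v exactly.
  set P : Submodule ℝ (E x) :=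
    { carrier := {v | ∃ a, D.IsSmooth a ∧ (∀ u, D.bracket (X.χ u) a = 0) ∧ a x = v}
      add_mem' := by
        rintro v w ⟨a, ha, hai, rfl⟩ ⟨b, hb, hbi, rfl⟩
        refine ⟨a + b, hD.isPreCourant.add _ _ ha hb, fun u => ?_, rfl⟩
        rw [hD.bracket_add_right _ _ _ (X.χ_smooth u) ha hb, hai, hbi, add_zero]
      zero_mem' := by
        have h := X.isInvariantPerp_zero hD
        exact ⟨0, h.smooth, h.invariant, rfl⟩
      smul_mem' := by
        rintro c v ⟨a, ha, hai, rfl⟩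
        refine ⟨c • a, hD.isPreCourant.smul c ha, fun u => ?_, rfl⟩
        rw [hD.bracket_smul_right c _ _ (X.χ_smooth u) ha, hai, smul_zero] } with hP
  suffices h : v ∈ P from h
  by_contra hv
  obtain ⟨ℓ, hℓv, hℓP⟩ := Submodule.exists_le_ker_of_notMem hv
  obtain ⟨a, ha, hav⟩ := hD.exists_section x v
  -- the function `ℓ (push g a x)`
  have ha' := (hD.isSmooth_iff a).1 ha
  set L : F →L[ℝ] ℝ := LinearMap.toContinuousLinearMap
    (ℓ ∘ₗ (fibreCoord F x).symm.toLinearEquiv.toLinearMap) with hL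
  have hLa : ∀ w : E x, L (fibreCoord F x w) = ℓ w := fun w => by simp [hL]
  -- Normalized so that h 1 = 1; it remains positive on a neighbourhood O of 1, and a cut-off close
  -- enough to x ensures that only g in O contribute to the average.
  set h : S → ℝ := fun g => (ℓ v)⁻¹ * L (fibreCoord F x (X.push g a x)) with hh
  have hcont : Continuous h :=
    continuous_const.mul (L.continuous.comp (X.push_coord_smooth ha' x).continuous)
  have h1 : h 1 = 1 := by
    simp only [hh, X.push_one, hLa, hav]
    exact inv_mul_cancel₀ hℓv
  set O : Set S := {g | 0 < h g} with hO
  have hOo : IsOpen O := isOpen_lt continuous_const hcont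
  have hO1 : (1 : S) ∈ O := by
    rw [hO, Set.mem_ofPred_eq, h1]
    exact one_pos
  obtain ⟨U, hU, hxU, hUO⟩ := exists_isOpen_of_inv_smul_mem hOo hO1 x
  obtain ⟨C, hC, hxC, hCU⟩ := exists_compact_subset hU hxU
  obtain ⟨φ, hφ, hφ1, hφs⟩ := exists_bump (m := m) (isOpen_interior.mem_nhds hxC)
  have hφs' : ∀ y, y ∉ C → φ y = 0 := fun y hy => by
    by_contra hne
    exact hy (interior_subset (hφs (subset_tsupport φ hne)))
  -- Squaring the cut-off guarantees a non-negative weight, so that ℓ of the average is ℓ v times a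
  -- positive integral.
  set b : ∀ x, E x := fsmul (fun y => φ y * φ y) a with hb
  have hbs : D.IsSmooth b := hD.isPreCourant.fsmul _ _ (isSmoothFun_mul hφ hφ) ha
  have hbs' := (hD.isSmooth_iff b).1 hbs
  have hb0 : ∀ y, y ∉ C → b y = 0 := fun y hy => by simp [hb, GenScalar.fsmul, hφs' y hy]
  have havg : X.average μ b x ∈ P := by
    have hs : D.IsSmooth (X.average μ b) := (hD.isSmooth_iff _).2 (X.average_smooth μ hbs' hC hb0)
    exact ⟨_, hs, X.bracket_χ_eq_zero_of_push hs (X.push_average μ hbs' hC hb0), rfl⟩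
  have hzero : ℓ (X.average μ b x) = 0 := hℓP havg
  have hint : ℓ (X.average μ b x) = ∫ g, ℓ v * (φ (g⁻¹ • x) ^ 2 * h g) ∂μ := by
    have h2 : ℓ (X.average μ b x) = L (∫ g, fibreCoord F x (X.push g b x) ∂μ) := rfl
    rw [h2, ← L.integral_comp_comm (X.integrable_push μ hbs' hC hb0 x)]
    refine integral_congr_ae (Filter.Eventually.of_forall fun g => ?_)
    have h3 : X.push g b x = (φ (g⁻¹ • x) * φ (g⁻¹ • x)) • X.push g a x := by
      simp only [EquivariantStructure.push, hb, GenScalar.fsmul, map_smul]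
    simp only [h3, map_smul, hh, smul_eq_mul]
    field_simp
  have hact : Continuous fun g : S => g⁻¹ • x := by
    have h1 : ContMDiff (𝓡 k) (𝓡 m) ∞ (fun g : S => g⁻¹ • x) :=
      (contMDiff_smul (I := 𝓡 k) (I' := 𝓡 m) (n := ∞) (G := S) (M := M)).comp
        ((contMDiff_inv (𝓡 k) ∞).prodMk contMDiff_const)
    exact h1.continuous
  have hpos : 0 < ∫ g, φ (g⁻¹ • x) ^ 2 * h g ∂μ := by
    refine Continuous.integral_pos_of_hasCompactSupport_nonneg_nonzero (x := (1 : S))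
      (((hφ.continuous.comp hact).pow 2).mul hcont) ?_ (fun g => ?_) ?_
    · refine HasCompactSupport.intro (ProperSMul.isCompact_setOfPred_inter_nonempty (G := S) hC
        (isCompact_singleton (x := x))) fun g hg => ?_
      have : g⁻¹ • x ∉ C := fun h => hg ⟨x, ⟨g⁻¹ • x, h, smul_inv_smul g x⟩, rfl⟩
      simp [hφs' _ this]
    · by_cases hg : g⁻¹ • x ∈ C
      · exact mul_nonneg (sq_nonneg _) (hUO g (hCU hg)).le
      · simp [hφs' _ hg]
    · simp [h1, hφ1.self_of_nhds]
  rw [hint, integral_const_mul] at hzero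
  exact (mul_ne_zero hℓv hpos.ne') hzero

end Average

/-! ### Local sections of submersions -/

section Submersion

variable {m q : ℕ} {M N : Type*} [TopologicalSpace M]
  [ChartedSpace (EuclideanSpace ℝ (Fin m)) M] [IsManifold (𝓡 m) ∞ M] [TopologicalSpace N]
  [ChartedSpace (EuclideanSpace ℝ (Fin q)) N] [IsManifold (𝓡 q) ∞ N]

/-- A submersion has a smooth local section through every point. -/
theorem exists_local_section {f : M → N} {x : M} (hf : IsSubmersionAt (𝓡 m) (𝓡 q) ∞ f x) :
    ∃ s : N → M, ContMDiffAt (𝓡 q) (𝓡 m) ∞ s (f x) ∧ s (f x) = x ∧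
      ∀ᶠ y in 𝓝 (f x), f (s y) = y := by
  set φ := hf.domChart.extend (𝓡 m) with hφ
  set ψ := hf.codChart.extend (𝓡 q) with hψ
  have hx : x ∈ hf.domChart.source := hf.mem_domChart_source
  have hy : f x ∈ hf.codChart.source := hf.mem_codChart_source
  have hxφ : x ∈ φ.source := by rwa [hφ, OpenPartialHomeomorph.extend_source]
  have hyψ : f x ∈ ψ.source := by rwa [hψ, OpenPartialHomeomorph.extend_source]
  -- In adapted charts the submersion is a linear projection; the section keeps the complementary
  -- coordinates equal to those of x.
  set s' : N → EuclideanSpace ℝ (Fin m) := fun y => hf.equiv.symm (ψ y, (hf.equiv (φ x)).2) with hs'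
  have hw : ∀ z ∈ φ.target, ψ (f (φ.symm z)) = (hf.equiv z).1 := fun z hz =>
    hf.writtenInCharts hz
  have hs'x : s' (f x) = φ x := by
    have h1 := hw (φ x) (φ.map_source hxφ)
    rw [φ.left_inv hxφ] at h1
    simp only [hs', h1]
    exact hf.equiv.symm_apply_apply _
  have hs's : ContMDiffAt (𝓡 q) 𝓘(ℝ, EuclideanSpace ℝ (Fin m)) ∞ s' (f x) := by
    have h1 : ContMDiffAt (𝓡 q) 𝓘(ℝ, EuclideanSpace ℝ (Fin q)) ∞ ψ (f x) :=
      hf.codChart.contMDiffAt_extend hf.codChart_mem_maximalAtlas hy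
    have h2 : ContDiff ℝ ∞ fun z : EuclideanSpace ℝ (Fin q) =>
        hf.equiv.symm (z, (hf.equiv (φ x)).2) :=
      hf.equiv.symm.contDiff.comp (contDiff_id.prodMk contDiff_const)
    exact h2.contMDiff.contMDiffAt.comp (f x) h1
  have hto : IsOpen φ.target := by
    rw [hφ]
    exact hf.domChart.isOpen_extend_target
  have hxt : s' (f x) ∈ φ.target := by
    rw [hs'x]
    exact φ.map_source hxφ
  refine ⟨fun y => φ.symm (s' y), ?_, ?_, ?_⟩
  · have h1 : ContMDiffAt 𝓘(ℝ, EuclideanSpace ℝ (Fin m)) (𝓡 m) ∞ φ.symm (s' (f x)) :=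
      (contMDiffOn_extend_symm hf.domChart_mem_maximalAtlas).contMDiffAt (by
        have := hto.mem_nhds hxt
        rw [hφ, OpenPartialHomeomorph.extend_target'] at this
        exact this)
    exact h1.comp (f x) hs's
  · show φ.symm (s' (f x)) = x
    rw [hs'x, φ.left_inv hxφ]
  · filter_upwards [hs's.continuousAt.preimage_mem_nhds (hto.mem_nhds hxt),
      hf.codChart.open_source.mem_nhds hy] with y hy1 hy2
    have h1 := hw _ hy1
    have h2 : (hf.equiv (s' y)).1 = ψ y := by
      simp only [hs', ContinuousLinearEquiv.apply_symm_apply]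
    have h3 : φ.symm (s' y) ∈ hf.domChart.source := by
      have := φ.map_target hy1
      rwa [hφ, OpenPartialHomeomorph.extend_source] at this
    refine ψ.injOn ?_ ?_ (h1.trans h2)
    · rw [hψ, OpenPartialHomeomorph.extend_source]
      exact hf.source_subset_preimage_source h3
    · rwa [hψ, OpenPartialHomeomorph.extend_source]

theorem isSmoothFun_of_comp_submersion {f : M → N} (hf : IsSubmersion (𝓡 m) (𝓡 q) ∞ f)
    (hs : Function.Surjective f) {g : N → ℝ} (hg : IsSmoothFun m fun x => g (f x)) :
    IsSmoothFun q g := by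
  intro y
  obtain ⟨x, rfl⟩ := hs y
  obtain ⟨s, hs, hsx, hfs⟩ := exists_local_section (hf.isSubmersionAt x)
  have h1 : ContMDiffAt (𝓡 q) 𝓘(ℝ, ℝ) ∞ (fun y => g (f (s y))) (f x) :=
    ContMDiffAt.comp (f x) (g := fun x => g (f x)) (by rw [hsx]; exact hg x) hs
  refine h1.congr_of_eventuallyEq ?_
  filter_upwards [hfs] with y hy
  rw [hy]

/-- Tangent vectors are determined by the derivatives of functions. -/
theorem eq_of_forall_mfderiv_eq [T2Space N] {b : N} {v w : EuclideanSpace ℝ (Fin q)}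
    (h : ∀ g : N → ℝ, IsSmoothFun q g →
      (mfderiv (𝓡 q) 𝓘(ℝ, ℝ) g b v : ℝ) = mfderiv (𝓡 q) 𝓘(ℝ, ℝ) g b w) : v = w := by
  ext i
  set G : EuclideanSpace ℝ (Fin q) →L[ℝ] ℝ := EuclideanSpace.proj i with hG
  have hsm : ∀ᶠ y in 𝓝 b,
      ContMDiffAt (𝓡 q) 𝓘(ℝ, ℝ) ∞ (fun z => G (extChartAt (𝓡 q) b z)) y := by
    filter_upwards [(chartAt (EuclideanSpace ℝ (Fin q)) b).open_source.mem_nhds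
      (mem_chart_source _ b)] with y hy
    exact G.contDiff.contMDiff.contMDiffAt.comp y (contMDiffAt_extChartAt' hy)
  obtain ⟨g, hg, hgG⟩ := exists_global_extension hsm
  have key : ∀ v : EuclideanSpace ℝ (Fin q), (mfderiv (𝓡 q) 𝓘(ℝ, ℝ) g b v : ℝ) = v i := by
    intro v
    set Y : ∀ y : N, TangentSpace (𝓡 q) y := fun _ => v with hY
    have h1 : vectorDeriv Y g b = vectorDeriv Y (fun z => G (extChartAt (𝓡 q) b z)) b :=
      vectorDeriv_congr hgG
    rw [vectorDeriv_extChartAt_comp (mem_chart_source _ b) G.differentiableAt,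
      chartField_extChartAt Y (mem_chart_source _ b), G.fderiv,
      tangentCoordChange_clm_self (mem_chart_source _ b)] at h1
    exact h1
  exact (key v).symm.trans ((h g hg).trans (key w))

theorem mfderiv_comp_apply' {f : M → N} (hf : ContMDiff (𝓡 m) (𝓡 q) ∞ f) {g : N → ℝ}
    (hg : IsSmoothFun q g) (x : M) {b : N} (hb : f x = b) (v : EuclideanSpace ℝ (Fin m)) :
    (mfderiv (𝓡 m) 𝓘(ℝ, ℝ) (fun y => g (f y)) x v : ℝ) =
      (mfderiv (𝓡 q) 𝓘(ℝ, ℝ) g b : EuclideanSpace ℝ (Fin q) →L[ℝ] ℝ)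
        (mfderiv (𝓡 m) (𝓡 q) f x v) := by
  subst hb
  have := mfderiv_comp x (hg.mdiff (f x)) ((hf x).mdifferentiableAt (by simp))
  exact congrArg (fun T : EuclideanSpace ℝ (Fin m) →L[ℝ] ℝ => T v) this

end Submersion

/-! ### Invariant sections and the reduced anchor and pairing -/

section Reduction

variable {k m q : ℕ} {S : Type*} [Group S] [TopologicalSpace S]
  [ChartedSpace (EuclideanSpace ℝ (Fin k)) S] [LieGroup (𝓡 k) ∞ S]
  {M : Type*} [TopologicalSpace M] [ChartedSpace (EuclideanSpace ℝ (Fin m)) M]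
  [IsManifold (𝓡 m) ∞ M] [MulAction S M] [ContMDiffSMul (𝓡 k) (𝓡 m) ∞ S M]
  {F : Type*} [NormedAddCommGroup F] [NormedSpace ℝ F] [FiniteDimensional ℝ F]
  {E : M → Type*} [TopologicalSpace (TotalSpace F E)] [∀ x, AddCommGroup (E x)]
  [∀ x, Module ℝ (E x)] [∀ x, TopologicalSpace (E x)] [FiberBundle F E] [VectorBundle ℝ F E]
  [ContMDiffVectorBundle ∞ F E (𝓡 m)] {D : CourantData m E}

namespace EquivariantStructure

theorem proj_surjective : Function.Surjective (proj S : M → OrbitSpace S M) :=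
  Quotient.mk_surjective

theorem proj_out (b : OrbitSpace S M) : proj S b.out = b := Quotient.out_eq b

theorem proj_eq_iff {x y : M} : proj S x = proj S y ↔ ∃ g : S, g • y = x :=
  Quotient.eq.trans (MulAction.orbitRel_apply.trans MulAction.mem_orbit_iff)

theorem exists_smul_out (x : M) : ∃ g : S, g • x = (proj S x).out :=
  proj_eq_iff.1 (proj_out (proj S x))

variable (X : EquivariantStructure k S F D)

section Invariant

variable [T2Space M] [ConnectedSpace S]

/-- The reduced fibre over an orbit is modelled at the arbitrary, generally non-smooth,
representative `out`. Invariance transfers values computed there to any point of the orbit. -/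
theorem apply_out_proj {f : M → ℝ} (hf : IsSmoothFun m f)
    (hinv : ∀ u, D.deriv (X.χ u) f = 0) (x : M) : f (proj S x).out = f x := by
  obtain ⟨g, hg⟩ := exists_smul_out (S := S) x
  rw [← hg]
  exact X.smul_eq_of_deriv_eq_zero hf hinv g x

theorem deriv_χ_pair (hD : IsCourantAlgebroid F D) {a b : ∀ x, E x} (ha : D.IsSmooth a)
    (hb : D.IsSmooth b) (hai : ∀ u, D.bracket (X.χ u) a = 0) (hbi : ∀ u, D.bracket (X.χ u) b = 0)
    (u : GroupLieAlgebra (𝓡 k) S) : D.deriv (X.χ u) (D.pair a b) = 0 := by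
  rw [hD.deriv_pair _ _ _ (X.χ_smooth u) ha hb, hai, hbi]
  funext x
  simp [CourantData.pair]

theorem deriv_χ_deriv (hD : IsCourantAlgebroid F D) {a : ∀ x, E x} {f : M → ℝ} (ha : D.IsSmooth a)
    (hf : IsSmoothFun m f) (hai : ∀ u, D.bracket (X.χ u) a = 0)
    (hfi : ∀ u, D.deriv (X.χ u) f = 0) (u : GroupLieAlgebra (𝓡 k) S) :
    D.deriv (X.χ u) (D.deriv a f) = 0 := by
  funext x
  have h := hD.deriv_bracket (X.χ_smooth u) ha hf x
  rw [hai, CourantData.deriv_eq_zero rfl, hfi] at h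
  have h0 : D.deriv a (0 : M → ℝ) x = 0 := CourantData.deriv_const a 0 x
  rw [h0, sub_zero] at h
  exact h.symm

theorem bracket_χ_bracket (hD : IsCourantAlgebroid F D) {a b : ∀ x, E x} (ha : D.IsSmooth a)
    (hb : D.IsSmooth b) (hai : ∀ u, D.bracket (X.χ u) a = 0) (hbi : ∀ u, D.bracket (X.χ u) b = 0)
    (u : GroupLieAlgebra (𝓡 k) S) : D.bracket (X.χ u) (D.bracket a b) = 0 := by
  have h0 := X.isInvariantPerp_zero hD
  have hz : ∀ c, D.IsSmooth c → D.bracket c (0 : ∀ x, E x) = 0 := fun c hc => by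
    have := hD.bracket_smul_right 0 c 0 hc h0.smooth
    simpa using this
  have hz' : ∀ c, D.IsSmooth c → D.bracket (0 : ∀ x, E x) c = 0 := fun c hc => by
    have := hD.bracket_smul_left 0 0 c h0.smooth hc
    simpa using this
  rw [hD.jacobi _ _ _ (X.χ_smooth u) ha hb, hai, hbi, hz a ha, hz' b hb, add_zero]

theorem isInvariantPerp_bracket (hD : IsCourantAlgebroid F D) {a b : ∀ x, E x}
    (ha : X.IsInvariantPerp a) (hb : X.IsInvariantPerp b) : X.IsInvariantPerp (D.bracket a b) :=
  ⟨hD.bracket_smooth _ _ ha.smooth hb.smooth, X.bracket_mem_perpFibre hD ha hb,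
    X.bracket_χ_bracket hD ha.smooth hb.smooth ha.invariant hb.invariant⟩

theorem isInvariantPerp_add (hD : IsCourantAlgebroid F D) {a b : ∀ x, E x}
    (ha : X.IsInvariantPerp a) (hb : X.IsInvariantPerp b) : X.IsInvariantPerp (a + b) :=
  ⟨hD.isPreCourant.add _ _ ha.smooth hb.smooth, fun x => (X.perpFibre x).add_mem (ha.mem x) (hb.mem x),
    fun u => by
      rw [hD.bracket_add_right _ _ _ (X.χ_smooth u) ha.smooth hb.smooth, ha.invariant,
        hb.invariant, add_zero]⟩

theorem isInvariantPerp_smul (hD : IsCourantAlgebroid F D) (c : ℝ) {a : ∀ x, E x}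
    (ha : X.IsInvariantPerp a) : X.IsInvariantPerp (c • a) :=
  ⟨hD.isPreCourant.smul c ha.smooth, fun x => (X.perpFibre x).smul_mem c (ha.mem x),
    fun u => by
      rw [hD.bracket_smul_right _ _ _ (X.χ_smooth u) ha.smooth, ha.invariant, smul_zero]⟩

theorem isInvariantPerp_fsmul (hD : IsCourantAlgebroid F D) {f : M → ℝ} (hf : IsSmoothFun m f)
    (hfi : ∀ u, D.deriv (X.χ u) f = 0) {a : ∀ x, E x}
    (ha : X.IsInvariantPerp a) : X.IsInvariantPerp (fsmul f a) :=
  ⟨hD.isPreCourant.fsmul f a hf ha.smooth, fun x => (X.perpFibre x).smul_mem _ (ha.mem x),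
    fun u => by
      rw [hD.leibniz _ _ _ (X.χ_smooth u) hf ha.smooth, ha.invariant, hfi]
      funext x
      simp [fsmul]⟩

end Invariant

variable [ChartedSpace (EuclideanSpace ℝ (Fin q)) (OrbitSpace S M)]
  [IsManifold (𝓡 q) ∞ (OrbitSpace S M)]

theorem isSmoothFun_comp_proj (hπ : IsSubmersion (𝓡 m) (𝓡 q) ∞ (proj S : M → OrbitSpace S M))
    {f : OrbitSpace S M → ℝ} (hf : IsSmoothFun q f) : IsSmoothFun m fun x => f (proj S x) :=
  hf.comp hπ.contMDiff

theorem deriv_χ_comp_proj (hπ : IsSubmersion (𝓡 m) (𝓡 q) ∞ (proj S : M → OrbitSpace S M))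
    {f : OrbitSpace S M → ℝ} (hf : IsSmoothFun q f) (u : GroupLieAlgebra (𝓡 k) S) :
    D.deriv (X.χ u) (fun x => f (proj S x)) = 0 := by
  funext x
  refine (mfderiv_comp_apply' hπ.contMDiff hf x rfl _).trans ?_
  have h := X.mfderiv_proj_anchor hπ x u
  exact (congrArg (mfderiv (𝓡 q) 𝓘(ℝ, ℝ) f (proj S x)) h).trans (map_zero _)

section

variable [T2Space M] [ConnectedSpace S] (hD : IsCourantAlgebroid F D)
  (hπ : IsSubmersion (𝓡 m) (𝓡 q) ∞ (proj S : M → OrbitSpace S M))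

variable {X} {a a' : ∀ x, E x} {t t' : ∀ b : OrbitSpace S M, X.RedFibre b}

theorem Represents.add (hD : IsCourantAlgebroid F D) (h : X.Represents a t)
    (h' : X.Represents a' t') : X.Represents (a + a') (t + t') :=
  ⟨X.isInvariantPerp_add hD h.1 h'.1, fun b => by
    rw [Pi.add_apply, h.2 b, h'.2 b]
    rfl⟩

theorem Represents.fsmul (hD : IsCourantAlgebroid F D)
    (hπ : IsSubmersion (𝓡 m) (𝓡 q) ∞ (proj S : M → OrbitSpace S M)) {f : OrbitSpace S M → ℝ}
    (hf : IsSmoothFun q f) (h : X.Represents a t) :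
    X.Represents (GenScalar.fsmul (fun x => f (proj S x)) a) (GenScalar.fsmul f t) :=
  ⟨X.isInvariantPerp_fsmul hD (isSmoothFun_comp_proj hπ hf) (X.deriv_χ_comp_proj hπ hf) h.1,
    fun b => by
      have h1 : GenScalar.fsmul f t b = f b • t b := rfl
      rw [h1, h.2 b, ← Submodule.Quotient.mk_smul]
      congr 1
      ext
      simp only [GenScalar.fsmul, proj_out, Submodule.coe_smul]⟩

theorem represents_lift (h : ∃ a, X.Represents a t) : X.Represents (X.lift t) t := by
  unfold lift
  rw [dif_pos h]
  exact h.choose_spec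

theorem Represents.pair_eq (h : X.Represents a t) (h' : X.Represents a' t') (b : OrbitSpace S M) :
    (X.reduction hD hπ).pair t t' b = D.pair a a' b.out := by
  simp only [CourantData.pair]
  rw [h.2 b, h'.2 b]
  rfl

theorem Represents.rho_eq (h : X.Represents a t) (b : OrbitSpace S M) :
    ((X.reduction hD hπ).rho t b : EuclideanSpace ℝ (Fin q)) =
      mfderiv (𝓡 m) (𝓡 q) (proj S : M → OrbitSpace S M) b.out (D.rho a b.out) := by
  simp only [CourantData.rho]
  rw [h.2 b]
  rfl

theorem Represents.deriv_eq (h : X.Represents a t) {f : OrbitSpace S M → ℝ}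
    (hf : IsSmoothFun q f) (b : OrbitSpace S M) :
    (X.reduction hD hπ).deriv t f b = D.deriv a (fun x => f (proj S x)) b.out := by
  refine Eq.trans ?_
    (mfderiv_comp_apply' hπ.contMDiff hf b.out (proj_out b) (D.rho a b.out)).symm
  exact congrArg (fun w => (mfderiv (𝓡 q) 𝓘(ℝ, ℝ) f b : EuclideanSpace ℝ (Fin q) →L[ℝ] ℝ) w)
    (h.rho_eq hD hπ b)

/-- The anchor is defined at the representative of the orbit. Tangent vectors of M/S are detected by
functions g, and ρ(a)(g ∘ π) is invariant, so any point of the orbit gives the same vector. -/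
theorem Represents.rho_proj [T2Space (OrbitSpace S M)] (h : X.Represents a t) (x : M) :
    ((X.reduction hD hπ).rho t (proj S x) : EuclideanSpace ℝ (Fin q)) =
      mfderiv (𝓡 m) (𝓡 q) (proj S : M → OrbitSpace S M) x (D.rho a x) := by
  refine eq_of_forall_mfderiv_eq (b := proj S x) fun g hg => ?_
  have h1 := mfderiv_comp_apply' hπ.contMDiff hg x rfl (D.rho a x)
  refine Eq.trans ?_ h1
  have h2 := h.deriv_eq hD hπ hg (proj S x)
  refine h2.trans ?_
  have hg' := isSmoothFun_comp_proj hπ hg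
  exact X.apply_out_proj (hD.isPreCourant.deriv_smooth h.1.smooth hg')
    (X.deriv_χ_deriv hD h.1.smooth hg' h.1.invariant (X.deriv_χ_comp_proj hπ hg)) x

/-- Smoothness of a function on M/S is tested after pull-back along π, and that of the anchor by
local sections of π, so that the choice of representatives plays no role. -/
theorem isPreCourant_reduction [T2Space (OrbitSpace S M)] :
    IsPreCourant (X.reduction hD hπ) where
  zero := ⟨0, X.isInvariantPerp_zero hD, fun b => rfl⟩
  add := by
    rintro t t' ⟨a, ha⟩ ⟨a', ha'⟩
    exact ⟨_, ha.add hD ha'⟩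
  fsmul := by
    rintro f t hf ⟨a, ha⟩
    exact ⟨_, ha.fsmul hD hπ hf⟩
  pair_smooth := by
    rintro t t' ⟨a, ha⟩ ⟨a', ha'⟩
    refine isSmoothFun_of_comp_submersion hπ proj_surjective ?_
    have hs := hD.pair_smooth a a' ha.1.smooth ha'.1.smooth
    have : (fun x => (X.reduction hD hπ).pair t t' (proj S x)) = D.pair a a' := by
      funext x
      rw [ha.pair_eq hD hπ ha']
      exact X.apply_out_proj hs
        (X.deriv_χ_pair hD ha.1.smooth ha'.1.smooth ha.1.invariant ha'.1.invariant) x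
    rw [this]
    exact hs
  pairing_symm := by
    intro b v w
    induction v using Submodule.Quotient.induction_on with | _ v => ?_
    induction w using Submodule.Quotient.induction_on with | _ w => ?_
    exact hD.pairing_symm _ _ _
  rho_smooth := by
    rintro t ⟨a, ha⟩ b
    obtain ⟨x, rfl⟩ := proj_surjective b
    obtain ⟨s, hs, hsx, hps⟩ := exists_local_section (hπ.isSubmersionAt x)
    have h1 : ContMDiffAt (𝓡 q) (𝓡 m).tangent ∞
        (fun b => (⟨s b, D.rho a (s b)⟩ : TangentBundle (𝓡 m) M)) (proj S x) :=
      ContMDiffAt.comp (proj S x) (hD.rho_smooth a ha.1.smooth (s (proj S x))) hs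
    have h2 : ContMDiff (𝓡 m).tangent (𝓡 q).tangent ∞
        (tangentMap (𝓡 m) (𝓡 q) (proj S : M → OrbitSpace S M)) :=
      hπ.contMDiff.contMDiff_tangentMap (by simp)
    refine (ContMDiffAt.comp (proj S x) (h2 _) h1).congr_of_eventuallyEq ?_
    filter_upwards [hps] with b hb
    have h3 := ha.rho_proj hD hπ (s b)
    have h4 : ∀ b' : OrbitSpace S M, b' = b →
        (⟨b, (X.reduction hD hπ).rho t b⟩ : TangentBundle (𝓡 q) (OrbitSpace S M)) =
          ⟨b', (X.reduction hD hπ).rho t b'⟩ := by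
      rintro b' rfl
      rfl
    rw [h4 _ hb]
    exact congrArg (fun w : EuclideanSpace ℝ (Fin q) =>
      (⟨proj S (s b), w⟩ : TangentBundle (𝓡 q) (OrbitSpace S M))) h3

end

end EquivariantStructure

end Reduction

/-! ### The adjoint trace in a basis -/

section LieBasis

variable {k : ℕ} {S : Type*} [Group S] [TopologicalSpace S]
  [ChartedSpace (EuclideanSpace ℝ (Fin k)) S]

/-- The standard basis of the Lie algebra. -/
def lieBasis (k : ℕ) (S : Type*) [Group S] [TopologicalSpace S]
    [ChartedSpace (EuclideanSpace ℝ (Fin k)) S] :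
    Module.Basis (Fin k) ℝ (GroupLieAlgebra (𝓡 k) S) :=
  show Module.Basis (Fin k) ℝ (EuclideanSpace ℝ (Fin k)) from
    (EuclideanSpace.basisFun (Fin k) ℝ).toBasis

theorem trAd_eq_sum [LieGroup (𝓡 k) ∞ S] (u : GroupLieAlgebra (𝓡 k) S) :
    EquivariantStructure.trAd k S u = ∑ j, (lieBasis k S).coord j ⁅u, lieBasis k S j⁆ := by
  have hlg := lieGroup_three k S
  unfold EquivariantStructure.trAd
  rw [LinearMap.trace_eq_matrix_trace ℝ (lieBasis k S), Matrix.trace]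
  refine Finset.sum_congr rfl fun j _ => ?_
  rw [Matrix.diag_apply, LinearMap.toMatrix_apply]
  rfl

end LieBasis

/-! ### Sections of 𝔰_E: coefficients, divergence and brackets -/

section Reduction

variable {k m q : ℕ} {S : Type*} [Group S] [TopologicalSpace S]
  [ChartedSpace (EuclideanSpace ℝ (Fin k)) S] [LieGroup (𝓡 k) ∞ S]
  {M : Type*} [TopologicalSpace M] [T2Space M] [ChartedSpace (EuclideanSpace ℝ (Fin m)) M]
  [IsManifold (𝓡 m) ∞ M] [MulAction S M] [ContMDiffSMul (𝓡 k) (𝓡 m) ∞ S M]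
  {F : Type*} [NormedAddCommGroup F] [NormedSpace ℝ F] [FiniteDimensional ℝ F]
  {E : M → Type*} [TopologicalSpace (TotalSpace F E)] [∀ x, AddCommGroup (E x)]
  [∀ x, Module ℝ (E x)] [∀ x, TopologicalSpace (E x)] [FiberBundle F E] [VectorBundle ℝ F E]
  [ContMDiffVectorBundle ∞ F E (𝓡 m)] {D : CourantData m E}

theorem IsCourantAlgebroid.bracket_comb_right (hD : IsCourantAlgebroid F D) {ι : Type*}
    (s : Finset ι) {u : ∀ x, E x} {v : ι → ∀ x, E x} {f : ι → M → ℝ} (hu : D.IsSmooth u)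
    (hf : ∀ i, IsSmoothFun m (f i)) (hv : ∀ i, D.IsSmooth (v i)) (x : M) :
    D.bracket u (∑ i ∈ s, fsmul (f i) (v i)) x =
      ∑ i ∈ s, (f i x • D.bracket u (v i) x + D.deriv u (f i) x • v i x) := by
  classical
  have hp := hD.isPreCourant
  induction s using Finset.induction_on with
  | empty =>
    have := hD.bracket_smul_right 0 u 0 hu hp.zero
    simp only [zero_smul] at this
    simp [this]
  | insert a s ha ih =>
    rw [Finset.sum_insert ha, hD.bracket_add_right _ _ _ hu (hp.fsmul _ _ (hf a) (hv a))
      (hp.comb hf hv), Finset.sum_insert ha, Pi.add_apply, ih, hD.bracket_fsmul_right hu (hf a) (hv a)]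

namespace EquivariantStructure

variable (X : EquivariantStructure k S F D)

/-- Sections of `𝔰_E` are combinations of the `χ(u)` with smooth coefficients. -/
theorem exists_coefficients (hD : IsCourantAlgebroid F D) {d : ∀ x, E x} (hd : D.IsSmooth d)
    {x : M} (hx : ∀ᶠ y in 𝓝 x, d y ∈ X.sFibre y) :
    ∃ f : Fin k → M → ℝ, (∀ i, IsSmoothFun m (f i)) ∧
      ∀ᶠ y in 𝓝 x, d y = (∑ i, fsmul (f i) (X.χ (lieBasis k S i))) y := by
  set T : GroupLieAlgebra (𝓡 k) S →ₗ[ℝ] E x := LinearMap.proj x ∘ₗ X.χ with hT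
  have hTinj : LinearMap.ker T = ⊥ := LinearMap.ker_eq_bot.2 (X.χ_injective x)
  obtain ⟨L, hL⟩ := LinearMap.exists_leftInverse_of_injective T hTinj
  -- Since 𝔰_E is isotropic, its coefficients are measured by auxiliary sections z_j dual to the
  -- χ(b_j) at x. Nearby, the matrix of pairings is still invertible, and its inverse gives smooth
  -- coefficients.
  have hz : ∀ j, ∃ z, D.IsSmooth z ∧ ∀ w, D.pairing x (z x) w = (lieBasis k S).coord j (L w) := by
    intro j
    obtain ⟨p, hp⟩ := hD.exists_dual_vector x ((lieBasis k S).coord j ∘ₗ L)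
    obtain ⟨z, hz, rfl⟩ := hD.exists_section x p
    exact ⟨z, hz, hp⟩
  choose z hz hzx using hz
  have hG : ∀ i j, IsSmoothFun m (D.pair (z i) (X.χ (lieBasis k S j))) := fun i j =>
    hD.pair_smooth _ _ (hz i) (X.χ_smooth _)
  have hG1 : (Matrix.of fun i j => D.pair (z i) (X.χ (lieBasis k S j)) x) = 1 := by
    ext i j
    have h1 : D.pair (z i) (X.χ (lieBasis k S j)) x =
        (lieBasis k S).coord i (L (T (lieBasis k S j))) := hzx i _
    have h2 : L (T (lieBasis k S j)) = lieBasis k S j := LinearMap.congr_fun hL _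
    rw [Matrix.of_apply, h1, h2, Module.Basis.coord_apply, Module.Basis.repr_self,
      Finsupp.single_apply, Matrix.one_apply]
    simp only [eq_comm]
  obtain ⟨A, hA, hAG⟩ := exists_smooth_matrix_inverse (m := m) (x := x)
    (G := fun i j => D.pair (z i) (X.χ (lieBasis k S j)))
    (Filter.Eventually.of_forall fun y i j => hG i j y) (by rw [hG1]; simp)
  refine ⟨fun l y => ∑ i, A l i y * D.pair (z i) d y, fun l => isSmoothFun_sum fun i _ =>
    isSmoothFun_mul (hA l i) (hD.pair_smooth _ _ (hz i) hd), ?_⟩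
  filter_upwards [hAG, hx] with y hy hdy
  obtain ⟨v, hv⟩ := hdy
  have hv' : d y = X.χ v y := hv.symm
  have hvs : X.χ v = ∑ j, (lieBasis k S).repr v j • X.χ (lieBasis k S j) := by
    conv_lhs => rw [← (lieBasis k S).sum_repr v, map_sum]
    simp only [map_smul]
  have hp : ∀ i, D.pair (z i) d y =
      ∑ j, D.pair (z i) (X.χ (lieBasis k S j)) y * (lieBasis k S).repr v j := by
    intro i
    have h1 : D.pair (z i) d y = D.pair (z i) (X.χ v) y := by simp only [CourantData.pair, hv']
    rw [h1, hvs, CourantData.pair_sum_right]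
    refine Finset.sum_congr rfl fun j _ => ?_
    rw [CourantData.pair_smul_right, mul_comm]
  have hcoef : ∀ l, ∑ i, A l i y * D.pair (z i) d y = (lieBasis k S).repr v l := by
    intro l
    simp only [hp, Finset.mul_sum]
    rw [Finset.sum_comm]
    have h2 : ∀ j, ∑ i, A l i y * (D.pair (z i) (X.χ (lieBasis k S j)) y *
        (lieBasis k S).repr v j) = (1 : Matrix (Fin k) (Fin k) ℝ) l j * (lieBasis k S).repr v j := by
      intro j
      rw [← hy, Matrix.mul_apply, Finset.sum_mul]
      refine Finset.sum_congr rfl fun i _ => ?_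
      simp only [Matrix.of_apply]
      ring
    simp only [h2, Matrix.one_apply]
    simp
  rw [hv', hvs]
  simp only [Finset.sum_apply, fsmul, Pi.smul_apply, hcoef]

/-- The divergence of an invariant section of `𝔰_E` vanishes. -/
theorem div_eq_zero_of_mem_sFibre (hD : IsCourantAlgebroid F D) {div : (∀ x, E x) → M → ℝ}
    (hdiv : D.IsDivergence div) (hdivX : X.IsEquivariantDiv div) {d : ∀ x, E x}
    (hd : D.IsSmooth d) (hinv : ∀ u, D.bracket (X.χ u) d = 0) {x : M}
    (hx : ∀ᶠ y in 𝓝 x, d y ∈ X.sFibre y) : div d x = 0 := by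
  have hlg := lieGroup_three k S
  have hp := hD.isPreCourant
  obtain ⟨f, hf, hdf⟩ := X.exists_coefficients hD hd hx
  set b := lieBasis k S with hb
  have hχ : ∀ i, D.IsSmooth (X.χ (b i)) := fun i => X.χ_smooth _
  -- Invariance of Σ f_i χ(b_i) under χ(b_j), as an equation in the Lie algebra thanks to
  -- injectivity of χ at x.
  have h1 : ∀ j, ∑ i, (f i x • ⁅b j, b i⁆ + D.deriv (X.χ (b j)) (f i) x • b i) = 0 := by
    intro j
    apply X.χ_injective x
    have h2 := hD.bracket_congr_right (X.χ_smooth (b j)) hd (hp.comb hf hχ) hdf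
    rw [hinv, hD.bracket_comb_right _ (X.χ_smooth (b j)) hf hχ] at h2
    simp only [X.χ_bracket] at h2
    simp only [map_sum, map_add, map_smul, Finset.sum_apply, Pi.add_apply, Pi.smul_apply, map_zero]
    exact h2.symm
  -- The j-th component of the j-th equation, summed over j. The first sum is -Σ f_i Tr ad_{b_i} = Σ
  -- f_i div χ(b_i), so the left side is the divergence of the section.
  have h3 : ∑ j, ∑ i, f i x * b.coord j ⁅b j, b i⁆ + ∑ j, D.deriv (X.χ (b j)) (f j) x = 0 := by
    rw [← Finset.sum_add_distrib]
    refine Finset.sum_eq_zero fun j _ => ?_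
    have h4 := congrArg (b.coord j) (h1 j)
    simp only [map_sum, map_add, map_smul, smul_eq_mul, map_zero, Finset.sum_add_distrib] at h4
    rw [← h4]
    congr 1
    simp [Finsupp.single_apply]
  rw [hp.div_congr hdiv hd (hp.comb hf hχ) hdf, hp.div_comb hdiv _ hf hχ, Finset.sum_add_distrib,
    ← h3]
  congr 1
  rw [Finset.sum_comm]
  refine Finset.sum_congr rfl fun i _ => ?_
  rw [hdivX.unimodular, trAd_eq_sum, ← Finset.sum_neg_distrib, Finset.mul_sum]
  refine Finset.sum_congr rfl fun j _ => ?_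
  rw [← map_neg, lie_skew]

/-- Brackets of invariant sections of `𝔰_E^⊥` and of `𝔰_E` are in `𝔰_E`. -/
theorem bracket_mem_sFibre (hD : IsCourantAlgebroid F D) {w d : ∀ x, E x}
    (hw : X.IsInvariantPerp w) (hd : D.IsSmooth d) {x : M} (hx : ∀ᶠ y in 𝓝 x, d y ∈ X.sFibre y) :
    D.bracket w d x ∈ X.sFibre x := by
  have hp := hD.isPreCourant
  obtain ⟨f, hf, hdf⟩ := X.exists_coefficients hD hd hx
  set b := lieBasis k S with hb
  have hχ : ∀ i, D.IsSmooth (X.χ (b i)) := fun i => X.χ_smooth _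
  rw [hD.bracket_congr_right hw.smooth hd (hp.comb hf hχ) hdf,
    hD.bracket_comb_right _ hw.smooth hf hχ]
  refine Submodule.sum_mem _ fun i _ => ?_
  -- Both [χ(b_i), w] and the differential of ⟨w, χ(b_i)⟩ = 0 vanish, hence so does the bracket in
  -- the other order; only derivatives of the coefficients f_i remain.
  have h1 : D.bracket w (X.χ (b i)) x = 0 := by
    refine hD.pairing_nondegenerate x _ fun v => ?_
    obtain ⟨v, hv, rfl⟩ := hD.exists_section x v
    have h2 := hD.pair_bracket_swap hw.smooth (hχ i) hv x
    have h3 : D.pair w (X.χ (b i)) = fun _ => 0 := funext fun y =>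
      (hD.pairing_symm y _ _).trans (hw.mem y _)
    rw [h3, CourantData.deriv_const, hw.invariant] at h2
    refine h2.trans ?_
    simp [CourantData.pair]
  rw [h1, smul_zero, zero_add]
  exact Submodule.smul_mem _ _ ⟨b i, rfl⟩

/-- The bracket is not skew, so this order needs its own argument. The additional gradient term of
[fχ(u), w] has the factor ⟨χ(u), w⟩ = 0; what is left is orthogonal to 𝔰_E^⊥. -/
theorem bracket_mem_sFibre' (hD : IsCourantAlgebroid F D) {w d : ∀ x, E x}
    (hw : X.IsInvariantPerp w) (hd : D.IsSmooth d) {x : M} (hx : ∀ᶠ y in 𝓝 x, d y ∈ X.sFibre y) :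
    D.bracket d w x ∈ X.sFibre x := by
  have hp := hD.isPreCourant
  refine X.mem_sFibre_of_pairing hD fun v hv => ?_
  obtain ⟨v, hvs, rfl⟩ := hD.exists_section x v
  obtain ⟨f, hf, hdf⟩ := X.exists_coefficients hD hd hx
  set b := lieBasis k S with hb
  have hχ : ∀ i, D.IsSmooth (X.χ (b i)) := fun i => X.χ_smooth _
  rw [hD.bracket_congr_left hd (hp.comb hf hχ) hw.smooth hdf,
    hD.bracket_sum_left _ (fun i => hp.fsmul _ _ (hf i) (hχ i)) hw.smooth]
  refine (CourantData.pair_sum_left (D := D) Finset.univ _ v x).trans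
    (Finset.sum_eq_zero fun i _ => ?_)
  rw [hD.pair_bracket_fsmul_left (hχ i) (hf i) hw.smooth hvs, hw.invariant]
  have h1 : D.pair (X.χ (b i)) v x = 0 := hv (b i)
  have h2 : D.pair (X.χ (b i)) w x = 0 := hw.mem x (b i)
  rw [h1, h2]
  simp [CourantData.pair]

end EquivariantStructure

end Reduction

/-! ### Orthogonal projection to a generalized pseudometric -/

section Projection

variable {m : ℕ} {M : Type*} [TopologicalSpace M] [T2Space M]
  [ChartedSpace (EuclideanSpace ℝ (Fin m)) M] [IsManifold (𝓡 m) ∞ M]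
  {F : Type*} [NormedAddCommGroup F] [NormedSpace ℝ F]
  {E : M → Type*} [TopologicalSpace (TotalSpace F E)] [∀ x, AddCommGroup (E x)]
  [∀ x, Module ℝ (E x)] [∀ x, TopologicalSpace (E x)] [FiberBundle F E] [VectorBundle ℝ F E]
  {D : CourantData m E}

/-- The orthogonal projection of a section to a generalized pseudometric. -/
theorem exists_projection (hD : IsCourantAlgebroid F D) {V : ∀ x, Submodule ℝ (E x)}
    (hV : D.IsGeneralizedPseudometric V) {l : ∀ x, E x} (hl : D.IsSmooth l) :
    ∃ p, D.IsSectionOf V p ∧ ∀ x, ∀ w ∈ V x, D.pairing x (p x) w = D.pairing x (l x) w := by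
  have hp := hD.isPreCourant
  have key : ∀ x, ∃ v, D.IsSmooth v ∧ ∀ᶠ y in 𝓝 x, v y ∈ V y ∧
      ∀ w ∈ V y, D.pairing y (v y) w = D.pairing y (l y) w := by
    intro x
    obtain ⟨U, n, e, ε, η, hx, he⟩ := exists_orthogonalFrame_of_pseudometric hp hV x
    have hF := he.isFrame hp
    set e' : Fin n → ∀ x, E x := fun a => η a • e a with he'
    refine ⟨∑ a, fsmul (D.pair l (e a)) (e' a),
      hp.comb (fun a => hp.pair_smooth _ _ hl (hF.smooth a)) hF.smooth_dual, ?_⟩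
    filter_upwards [hF.isOpen.mem_nhds hx] with y hy
    have h1 : (∑ a, fsmul (D.pair l (e a)) (e' a)) y = ∑ a, D.pair l (e a) y • e' a y := by
      simp [fsmul]
    rw [h1]
    refine ⟨Submodule.sum_mem _ fun a _ => Submodule.smul_mem _ _ (hF.mem_dual y hy a),
      fun w hw => ?_⟩
    conv_rhs => rw [hF.eq_sum hy hw]
    simp only [map_sum, map_smul, LinearMap.sum_apply, LinearMap.smul_apply, smul_eq_mul]
    exact Finset.sum_congr rfl fun a _ => mul_comm _ _
  have hpt : ∀ x, ∃ v ∈ V x, ∀ w ∈ V x, D.pairing x v w = D.pairing x (l x) w := fun x => by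
    obtain ⟨v, -, hv⟩ := key x
    exact ⟨v x, hv.self_of_nhds.1, hv.self_of_nhds.2⟩
  -- Non-degeneracy makes the projection unique at each point, so the pointwise choice coincides
  -- with the smooth local ones and nothing has to be glued.
  choose p hpV hpp using hpt
  refine ⟨p, ⟨hD.isSmooth_of_locally fun x => ?_, hpV⟩, hpp⟩
  obtain ⟨v, hv, hvx⟩ := key x
  refine ⟨v, hv, hvx.mono fun y hy => ?_⟩
  rw [← sub_eq_zero]
  refine hV.nondegenerate y _ (Submodule.sub_mem _ (hpV y) hy.1) fun w hw => ?_
  rw [map_sub, LinearMap.sub_apply, hpp y w hw, hy.2 w hw, sub_self]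

theorem eq_of_isSectionOf_pairing {V : ∀ x, Submodule ℝ (E x)}
    (hV : D.IsGeneralizedPseudometric V) {x : M} {v w : E x} (hv : v ∈ V x) (hw : w ∈ V x)
    (h : ∀ z ∈ V x, D.pairing x v z = D.pairing x w z) : v = w := by
  rw [← sub_eq_zero]
  refine hV.nondegenerate x _ (Submodule.sub_mem _ hv hw) fun z hz => ?_
  rw [map_sub, LinearMap.sub_apply, h z hz, sub_self]

end Projection

/-! ### The reduced divergence, and projection of invariant sections -/

section Reduction

variable {k m q : ℕ} {S : Type*} [Group S] [TopologicalSpace S]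
  [ChartedSpace (EuclideanSpace ℝ (Fin k)) S] [LieGroup (𝓡 k) ∞ S]
  {M : Type*} [TopologicalSpace M] [T2Space M] [ChartedSpace (EuclideanSpace ℝ (Fin m)) M]
  [IsManifold (𝓡 m) ∞ M] [MulAction S M] [ContMDiffSMul (𝓡 k) (𝓡 m) ∞ S M]
  {F : Type*} [NormedAddCommGroup F] [NormedSpace ℝ F] [FiniteDimensional ℝ F]
  {E : M → Type*} [TopologicalSpace (TotalSpace F E)] [∀ x, AddCommGroup (E x)]
  [∀ x, Module ℝ (E x)] [∀ x, TopologicalSpace (E x)] [FiberBundle F E] [VectorBundle ℝ F E]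
  [ContMDiffVectorBundle ∞ F E (𝓡 m)] {D : CourantData m E} [ConnectedSpace S]

namespace EquivariantStructure

variable {X : EquivariantStructure k S F D}

theorem exists_smul_out_eq {b : OrbitSpace S M} {y : M} (hy : proj S y = b) :
    ∃ g : S, g • b.out = y := by
  subst hy
  exact proj_eq_iff.1 (proj_out (proj S y)).symm

theorem mem_sFibre_of_proj (hD : IsCourantAlgebroid F D) {d : ∀ x, E x} (hd : D.IsSmooth d)
    (hinv : ∀ u, D.bracket (X.χ u) d = 0) {b : OrbitSpace S M} (hb : d b.out ∈ X.sFibre b.out)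
    {y : M} (hy : proj S y = b) : d y ∈ X.sFibre y := by
  obtain ⟨g, rfl⟩ := exists_smul_out_eq hy
  exact X.mem_sFibre_smul hD hd hinv hb g

theorem isInvariantPerp_sub (hD : IsCourantAlgebroid F D) {a b : ∀ x, E x}
    (ha : X.IsInvariantPerp a) (hb : X.IsInvariantPerp b) : X.IsInvariantPerp (a - b) := by
  rw [sub_eq_add_neg, ← neg_one_smul ℝ b]
  exact X.isInvariantPerp_add hD ha (X.isInvariantPerp_smul hD _ hb)

theorem mk_eq_iff {b : OrbitSpace S M} {v w : E b.out} (hv : v ∈ X.perpFibre b.out)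
    (hw : w ∈ X.perpFibre b.out) :
    (Submodule.Quotient.mk ⟨v, hv⟩ : X.RedFibre b) = Submodule.Quotient.mk ⟨w, hw⟩ ↔
      v - w ∈ X.sFibre b.out :=
  Submodule.Quotient.eq _

theorem apply_smul_eq_zero (hD : IsCourantAlgebroid F D) {a : ∀ x, E x} (ha : D.IsSmooth a)
    (hinv : ∀ u, D.bracket (X.χ u) a = 0) {x : M} (hx : a x = 0) (g : S) : a (g • x) = 0 := by
  rw [← congrFun (X.push_eq_self hD ha hinv g) (g • x)]
  have : ∀ y, y = x → a y = 0 := by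
    rintro y rfl
    exact hx
  simp only [push]
  rw [this _ (inv_smul_smul g x), map_zero]

section Div

variable {div : (∀ x, E x) → M → ℝ}

theorem deriv_χ_div (hD : IsCourantAlgebroid F D) (hdiv : D.IsDivergence div)
    (hdivX : X.IsEquivariantDiv div) {a : ∀ x, E x} (ha : D.IsSmooth a)
    (hinv : ∀ u, D.bracket (X.χ u) a = 0) (u : GroupLieAlgebra (𝓡 k) S) :
    D.deriv (X.χ u) (div a) = 0 := by
  rw [hdivX.equivariant u a ha, hinv]
  have := hdiv.smul 0 0 (X.isInvariantPerp_zero hD).smooth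
  simpa only [zero_smul] using this

/-- The divergences of invariant sections which agree modulo `𝔰_E` agree. -/
theorem div_eq_of_sub_mem (hD : IsCourantAlgebroid F D) (hdiv : D.IsDivergence div)
    (hdivX : X.IsEquivariantDiv div) {a a' : ∀ x, E x} (ha : X.IsInvariantPerp a)
    (ha' : X.IsInvariantPerp a') {x : M} (h : ∀ᶠ y in 𝓝 x, (a - a') y ∈ X.sFibre y) :
    div a x = div a' x := by
  have hs := isInvariantPerp_sub hD ha ha'
  have h1 := X.div_eq_zero_of_mem_sFibre hD hdiv hdivX hs.smooth hs.invariant h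
  have h2 := congrFun (hdiv.add _ _ hs.smooth ha'.smooth) x
  rw [sub_add_cancel, Pi.add_apply, h1, zero_add] at h2
  exact h2

theorem Represents.div_eq (hD : IsCourantAlgebroid F D) (hdiv : D.IsDivergence div)
    (hdivX : X.IsEquivariantDiv div) {a a' : ∀ x, E x} {t : ∀ b : OrbitSpace S M, X.RedFibre b}
    (h : X.Represents a t) (h' : X.Represents a' t) : div a = div a' := by
  funext x
  have hs := isInvariantPerp_sub hD h.1 h'.1
  refine div_eq_of_sub_mem hD hdiv hdivX h.1 h'.1 (Filter.Eventually.of_forall fun y => ?_)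
  exact mem_sFibre_of_proj hD hs.smooth hs.invariant
    ((mk_eq_iff (h.1.mem _) (h'.1.mem _)).1 ((h.2 _).symm.trans (h'.2 _))) rfl

/-- The reduced divergence is defined by a chosen lift and a chosen point of the orbit. The first
choice is harmless because invariant sections of 𝔰_E have zero divergence, the second because the
divergence of an invariant section is an invariant function. -/
theorem Represents.redDiv_proj (hD : IsCourantAlgebroid F D) (hdiv : D.IsDivergence div)
    (hdivX : X.IsEquivariantDiv div) {a : ∀ x, E x} {t : ∀ b : OrbitSpace S M, X.RedFibre b}
    (h : X.Represents a t) (x : M) : X.redDiv div t (proj S x) = div a x := by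
  have hl := represents_lift ⟨a, h⟩
  unfold redDiv
  rw [hl.div_eq hD hdiv hdivX h]
  exact X.apply_out_proj (hdiv.contMDiff _ h.1.smooth)
    (deriv_χ_div hD hdiv hdivX h.1.smooth h.1.invariant) x

variable [ChartedSpace (EuclideanSpace ℝ (Fin q)) (OrbitSpace S M)]
  [IsManifold (𝓡 q) ∞ (OrbitSpace S M)]

theorem isDivergence_redDiv (hD : IsCourantAlgebroid F D) (hdiv : D.IsDivergence div)
    (hdivX : X.IsEquivariantDiv div)
    (hπ : IsSubmersion (𝓡 m) (𝓡 q) ∞ (proj S : M → OrbitSpace S M)) :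
    (X.reduction hD hπ).IsDivergence (X.redDiv div) where
  contMDiff := by
    rintro t ⟨a, ha⟩
    refine isSmoothFun_of_comp_submersion hπ proj_surjective ?_
    simp only [ha.redDiv_proj hD hdiv hdivX]
    exact hdiv.contMDiff a ha.1.smooth
  add := by
    rintro t t' ⟨a, ha⟩ ⟨a', ha'⟩
    funext b
    obtain ⟨x, rfl⟩ := proj_surjective b
    rw [(ha.add hD ha').redDiv_proj hD hdiv hdivX, Pi.add_apply, ha.redDiv_proj hD hdiv hdivX,
      ha'.redDiv_proj hD hdiv hdivX, hdiv.add _ _ ha.1.smooth ha'.1.smooth, Pi.add_apply]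
  smul := by
    rintro c t ⟨a, ha⟩
    funext b
    obtain ⟨x, rfl⟩ := proj_surjective b
    have h1 : X.Represents (c • a) (c • t) := ha.fsmul hD hπ (isSmoothFun_const c)
    rw [h1.redDiv_proj hD hdiv hdivX, Pi.smul_apply, ha.redDiv_proj hD hdiv hdivX,
      hdiv.smul _ _ ha.1.smooth, Pi.smul_apply]
  leibniz := by
    rintro f t hf ⟨a, ha⟩
    funext b
    have hf' := isSmoothFun_comp_proj (S := S) hπ hf
    have h1 := (ha.fsmul hD hπ hf).redDiv_proj hD hdiv hdivX b.out
    have h2 := ha.redDiv_proj hD hdiv hdivX b.out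
    rw [proj_out] at h1 h2
    rw [h1, Pi.add_apply, Pi.mul_apply, h2, ha.deriv_eq hD hπ hf,
      hdiv.leibniz _ _ hf' ha.1.smooth, Pi.add_apply, Pi.mul_apply, proj_out]

end Div

section Project

variable {V : ∀ x, Submodule ℝ (E x)}

/-- The projection of an invariant section to an admissible generalized pseudometric. -/
theorem exists_invariant_projection (hD : IsCourantAlgebroid F D)
    (hV : D.IsGeneralizedPseudometric V) (hVX : X.IsAdmissible V) {l : ∀ x, E x}
    (hl : D.IsSmooth l) (hinv : ∀ u, D.bracket (X.χ u) l = 0) :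
    ∃ p, X.IsInvariantPerp p ∧ (∀ x, p x ∈ V x) ∧
      ∀ x, ∀ w ∈ V x, D.pairing x (p x) w = D.pairing x (l x) w := by
  obtain ⟨p, hpV, hp⟩ := exists_projection hD hV hl
  refine ⟨p, ⟨hpV.1, fun x => hVX.le_perp x (hpV.2 x), fun u => ?_⟩, hpV.2, hp⟩
  funext x
  have hbr := hVX.invariant u p hpV
  refine hV.nondegenerate x _ (hbr.2 x) fun w hw => ?_
  obtain ⟨w, hws, rfl⟩ : ∃ w', D.IsSectionOf V w' ∧ w' x = w := by
    obtain ⟨w, hws, rfl⟩ := hD.exists_section x w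
    obtain ⟨w', hw', h⟩ := exists_projection hD hV hws
    exact ⟨w', hw', eq_of_isSectionOf_pairing hV (hw'.2 x) hw (h x)⟩
  -- Differentiating ⟨p, w⟩ = ⟨l, w⟩ along χ(u), for w in V, gives ⟨[χ(u), p], w⟩ = ⟨[χ(u), l], w⟩ =
  -- 0, because [χ(u), w] again lies in V.
  have h1 := hD.deriv_pair _ p w (X.χ_smooth u) hpV.1 hws.1
  have h2 := hD.deriv_pair _ l w (X.χ_smooth u) hl hws.1
  have h3 : D.pair p w = D.pair l w := funext fun y => hp y _ (hws.2 y)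
  have h4 : D.pair p (D.bracket (X.χ u) w) = D.pair l (D.bracket (X.χ u) w) :=
    funext fun y => hp y _ ((hVX.invariant u w hws).2 y)
  rw [h3, h2, h4, hinv] at h1
  have h5 := congrFun (add_right_cancel h1) x
  refine h5.symm.trans ?_
  simp [CourantData.pair]

end Project

end EquivariantStructure

end Reduction

/-! ### Descent of the curvature formula modulo 𝔰_E -/

section Reduction

variable {k m q : ℕ} {S : Type*} [Group S] [TopologicalSpace S]
  [ChartedSpace (EuclideanSpace ℝ (Fin k)) S] [LieGroup (𝓡 k) ∞ S]
  {M : Type*} [TopologicalSpace M] [T2Space M] [ChartedSpace (EuclideanSpace ℝ (Fin m)) M]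
  [IsManifold (𝓡 m) ∞ M] [MulAction S M] [ContMDiffSMul (𝓡 k) (𝓡 m) ∞ S M]
  {F : Type*} [NormedAddCommGroup F] [NormedSpace ℝ F] [FiniteDimensional ℝ F]
  {E : M → Type*} [TopologicalSpace (TotalSpace F E)] [∀ x, AddCommGroup (E x)]
  [∀ x, Module ℝ (E x)] [∀ x, TopologicalSpace (E x)] [FiberBundle F E] [VectorBundle ℝ F E]
  [ContMDiffVectorBundle ∞ F E (𝓡 m)] {D : CourantData m E} [ConnectedSpace S]
  {V : ∀ x, Submodule ℝ (E x)} {div : (∀ x, E x) → M → ℝ}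

namespace EquivariantStructure

variable {X : EquivariantStructure k S F D}

theorem pairing_sFibre {x : M} {v w : E x} (hv : v ∈ X.sFibre x) (hw : w ∈ X.perpFibre x) :
    D.pairing x v w = 0 := by
  obtain ⟨u, rfl⟩ := hv
  exact hw u

theorem pairing_eq_of_sub_mem (hD : IsCourantAlgebroid F D) {x : M} {v v' w w' : E x}
    (hv' : v' ∈ X.perpFibre x) (hw : w ∈ X.perpFibre x)
    (h : v - v' ∈ X.sFibre x) (h' : w - w' ∈ X.sFibre x) :
    D.pairing x v w = D.pairing x v' w' := by
  have h1 := pairing_sFibre h hw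
  have h2 := pairing_sFibre h' hv'
  rw [hD.pairing_symm] at h2
  rw [map_sub, LinearMap.sub_apply, sub_eq_zero] at h1
  rw [map_sub, sub_eq_zero] at h2
  exact h1.trans h2

/-- 𝔰_E is orthogonal to V, on which the pairing is non-degenerate; hence V embeds into the quotient
of 𝔰_E^⊥ by 𝔰_E. -/
theorem eq_zero_of_mem_sFibre (hV : D.IsGeneralizedPseudometric V) (hVX : X.IsAdmissible V) {x : M}
    {v : E x} (hv : v ∈ V x) (hs : v ∈ X.sFibre x) : v = 0 :=
  hV.nondegenerate x v hv fun _ hw => pairing_sFibre hs (hVX.le_perp x hw)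

theorem bracket_sub_mem_sFibre (hD : IsCourantAlgebroid F D) {l l' e e' : ∀ x, E x} {x : M}
    (hl' : X.IsInvariantPerp l') (he : X.IsInvariantPerp e) (hl : X.IsInvariantPerp l)
    (he' : X.IsInvariantPerp e') (h : ∀ᶠ y in 𝓝 x, (l - e) y ∈ X.sFibre y)
    (h' : ∀ᶠ y in 𝓝 x, (l' - e') y ∈ X.sFibre y) :
    D.bracket l l' x - D.bracket e e' x ∈ X.sFibre x := by
  have hs := isInvariantPerp_sub hD hl he
  have hs' := isInvariantPerp_sub hD hl' he'
  have h1 := congrFun (hD.bracket_add_left (l - e) e l' hs.smooth he.smooth hl'.smooth) x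
  have h2 := congrFun (hD.bracket_add_right e (l' - e') e' he.smooth hs'.smooth he'.smooth) x
  rw [sub_add_cancel] at h1 h2
  rw [h1, Pi.add_apply, h2, Pi.add_apply, ← add_assoc, add_sub_cancel_right]
  exact Submodule.add_mem _ (X.bracket_mem_sFibre' hD hl' hs.smooth h)
    (X.bracket_mem_sFibre hD he hs'.smooth h')

/-- `frameScalar` only depends on invariant sections modulo `𝔰_E`. -/
theorem frameScalar_eq_of_sub_mem (hD : IsCourantAlgebroid F D) (hdiv : D.IsDivergence div)
    (hdivX : X.IsEquivariantDiv div) {n : ℕ} {l l' e e' : Fin n → ∀ x, E x} {x : M}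
    (hl : ∀ a, X.IsInvariantPerp (l a)) (hl' : ∀ a, X.IsInvariantPerp (l' a))
    (he : ∀ a, X.IsInvariantPerp (e a)) (he' : ∀ a, X.IsInvariantPerp (e' a))
    (h : ∀ a, ∀ᶠ y in 𝓝 x, (l a - e a) y ∈ X.sFibre y)
    (h' : ∀ a, ∀ᶠ y in 𝓝 x, (l' a - e' a) y ∈ X.sFibre y) :
    D.frameScalar div l l' x = D.frameScalar div e e' x := by
  have hd : ∀ a, div (l a) =ᶠ[𝓝 x] div (e a) := fun a =>
    (eventually_eventually_nhds.2 (h a)).mono fun y hy =>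
      div_eq_of_sub_mem hD hdiv hdivX (hl a) (he a) hy
  have hd' : ∀ a, div (l' a) =ᶠ[𝓝 x] div (e' a) := fun a =>
    (eventually_eventually_nhds.2 (h' a)).mono fun y hy =>
      div_eq_of_sub_mem hD hdiv hdivX (hl' a) (he' a) hy
  have h1 : ∀ a, D.deriv (l' a) (div (l a)) x = D.deriv (e' a) (div (e a)) x := by
    intro a
    rw [CourantData.deriv_congr (hd a)]
    -- At x the two sections differ by a vector χ(u), and χ(u) annihilates the invariant function
    -- div (e a).
    obtain ⟨u, hu⟩ := (h' a).self_of_nhds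
    have h2 : l' a x = (X.χ u + e' a) x := by
      have : X.χ u x = l' a x - e' a x := hu
      rw [Pi.add_apply, this, sub_add_cancel]
    rw [CourantData.deriv_congr_left h2, CourantData.deriv_add_left,
      deriv_χ_div hD hdiv hdivX (he a).smooth (he a).invariant, Pi.zero_apply, zero_add]
  have hbr := fun a b => bracket_sub_mem_sFibre hD (hl b) (he a) (hl a) (he b) (h a) (h b)
  have hbr' := fun a b => bracket_sub_mem_sFibre hD (hl' b) (he' a) (hl' a) (he' b) (h' a) (h' b)
  have h2 : ∀ a b, D.pair (D.bracket (l a) (l b)) (D.bracket (l' a) (l' b)) x =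
      D.pair (D.bracket (e a) (e b)) (D.bracket (e' a) (e' b)) x := fun a b =>
    pairing_eq_of_sub_mem hD (X.bracket_mem_perpFibre hD (he a) (he b) x)
      (X.bracket_mem_perpFibre hD (hl' a) (hl' b) x) (hbr a b) (hbr' a b)
  have h3 : ∀ a b c, D.pair (l a) (D.bracket (l b) (l c)) x =
      D.pair (e a) (D.bracket (e b) (e c)) x := fun a b c =>
    pairing_eq_of_sub_mem hD ((he a).mem x) (X.bracket_mem_perpFibre hD (hl b) (hl c) x)
      (h a).self_of_nhds (hbr b c)
  have h4 : ∀ a b c, D.pair (l' a) (D.bracket (l' b) (l' c)) x =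
      D.pair (e' a) (D.bracket (e' b) (e' c)) x := fun a b c =>
    pairing_eq_of_sub_mem hD ((he' a).mem x) (X.bracket_mem_perpFibre hD (hl' b) (hl' c) x)
      (h' a).self_of_nhds (hbr' b c)
  simp only [CourantData.frameScalar, h1, h2, h3, h4, fun a => (hd a).self_of_nhds,
    fun a => (hd' a).self_of_nhds]

/-- `frameScalar` of invariant sections is an invariant function. -/
theorem frameScalar_apply_out_proj (hD : IsCourantAlgebroid F D) (hdiv : D.IsDivergence div)
    (hdivX : X.IsEquivariantDiv div) {n : ℕ} {e e' : Fin n → ∀ x, E x}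
    (he : ∀ a, X.IsInvariantPerp (e a)) (he' : ∀ a, X.IsInvariantPerp (e' a)) (x : M) :
    D.frameScalar div e e' (proj S x).out = D.frameScalar div e e' x := by
  have hds : ∀ a, X.IsInvariantPerp a → IsSmoothFun m (div a) := fun a ha =>
    hdiv.contMDiff a ha.smooth
  have hdi : ∀ a, X.IsInvariantPerp a → ∀ u, D.deriv (X.χ u) (div a) = 0 := fun a ha =>
    deriv_χ_div hD hdiv hdivX ha.smooth ha.invariant
  have h1 : ∀ a, X.IsInvariantPerp a → div a (proj S x).out = div a x := fun a ha =>
    X.apply_out_proj (hds a ha) (hdi a ha) x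
  have h2 : ∀ a b, X.IsInvariantPerp a → X.IsInvariantPerp b →
      D.deriv b (div a) (proj S x).out = D.deriv b (div a) x := fun a b ha hb =>
    X.apply_out_proj (hD.isPreCourant.deriv_smooth hb.smooth (hds a ha))
      (X.deriv_χ_deriv hD hb.smooth (hds a ha) hb.invariant (hdi a ha)) x
  have h3 : ∀ a b, X.IsInvariantPerp a → X.IsInvariantPerp b →
      D.pair a b (proj S x).out = D.pair a b x := fun a b ha hb =>
    X.apply_out_proj (hD.pair_smooth _ _ ha.smooth hb.smooth)
      (X.deriv_χ_pair hD ha.smooth hb.smooth ha.invariant hb.invariant) x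
  have hb := fun a b (ha : X.IsInvariantPerp a) (hb : X.IsInvariantPerp b) =>
    X.isInvariantPerp_bracket hD ha hb
  simp only [CourantData.frameScalar, fun a => h1 _ (he a), fun a => h1 _ (he' a),
    fun a => h2 _ _ (he a) (he' a), fun a b => h3 _ _ (hb _ _ (he a) (he b)) (hb _ _ (he' a) (he' b)),
    fun a b c => h3 _ _ (he a) (hb _ _ (he b) (he c)),
    fun a b c => h3 _ _ (he' a) (hb _ _ (he' b) (he' c))]

variable [ChartedSpace (EuclideanSpace ℝ (Fin q)) (OrbitSpace S M)]
  [IsManifold (𝓡 q) ∞ (OrbitSpace S M)]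

theorem represents_bracket (hD : IsCourantAlgebroid F D)
    (hπ : IsSubmersion (𝓡 m) (𝓡 q) ∞ (proj S : M → OrbitSpace S M))
    (t t' : ∀ b : OrbitSpace S M, X.RedFibre b) :
    X.Represents (D.bracket (X.lift t) (X.lift t')) ((X.reduction hD hπ).bracket t t') :=
  ⟨X.isInvariantPerp_bracket hD (X.isInvariantPerp_lift hD t) (X.isInvariantPerp_lift hD t'),
    fun _ => rfl⟩

/-- The lifts are sections of 𝔰_E^⊥ that need not lie in V; they are corrected by sections of 𝔰_E
only afterwards. -/
theorem frameScalar_reduction (hD : IsCourantAlgebroid F D) (hdiv : D.IsDivergence div)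
    (hdivX : X.IsEquivariantDiv div)
    (hπ : IsSubmersion (𝓡 m) (𝓡 q) ∞ (proj S : M → OrbitSpace S M)) {n : ℕ}
    {t t' : Fin n → ∀ b : OrbitSpace S M, X.RedFibre b}
    (ht : ∀ a, (X.reduction hD hπ).IsSmooth (t a)) (ht' : ∀ a, (X.reduction hD hπ).IsSmooth (t' a))
    (b : OrbitSpace S M) :
    (X.reduction hD hπ).frameScalar (X.redDiv div) t t' b =
      D.frameScalar div (fun a => X.lift (t a)) (fun a => X.lift (t' a)) b.out := by
  have hl : ∀ a, X.Represents (X.lift (t a)) (t a) := fun a => represents_lift (ht a)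
  have hl' : ∀ a, X.Represents (X.lift (t' a)) (t' a) := fun a => represents_lift (ht' a)
  have hδ := isDivergence_redDiv hD hdiv hdivX hπ
  have h1 : ∀ a, X.redDiv div (t a) b = div (X.lift (t a)) b.out := fun a => rfl
  have h1' : ∀ a, X.redDiv div (t' a) b = div (X.lift (t' a)) b.out := fun a => rfl
  have h2 : ∀ a, (X.reduction hD hπ).deriv (t' a) (X.redDiv div (t a)) b =
      D.deriv (X.lift (t' a)) (div (X.lift (t a))) b.out := fun a => by
    rw [(hl' a).deriv_eq hD hπ (hδ.contMDiff _ (ht a))]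
    congr 1
    funext x
    exact (hl a).redDiv_proj hD hdiv hdivX x
  have hb := fun s s' : ∀ b : OrbitSpace S M, X.RedFibre b => represents_bracket hD hπ s s'
  simp only [CourantData.frameScalar, h1, h1', h2, fun a b c d => (hb a b).pair_eq hD hπ (hb c d),
    fun a b c => (hl a).pair_eq hD hπ (hb b c), fun a b c => (hl' a).pair_eq hD hπ (hb b c)]

end EquivariantStructure

end Reduction

/-! ### Lifting local bases of the reduced pseudometric -/

section Reduction

variable {k m q : ℕ} {S : Type*} [Group S] [TopologicalSpace S]
  [ChartedSpace (EuclideanSpace ℝ (Fin k)) S] [LieGroup (𝓡 k) ∞ S]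
  {M : Type*} [TopologicalSpace M] [T2Space M] [ChartedSpace (EuclideanSpace ℝ (Fin m)) M]
  [IsManifold (𝓡 m) ∞ M] [MulAction S M] [ContMDiffSMul (𝓡 k) (𝓡 m) ∞ S M]
  {F : Type*} [NormedAddCommGroup F] [NormedSpace ℝ F] [FiniteDimensional ℝ F]
  {E : M → Type*} [TopologicalSpace (TotalSpace F E)] [∀ x, AddCommGroup (E x)]
  [∀ x, Module ℝ (E x)] [∀ x, TopologicalSpace (E x)] [FiberBundle F E] [VectorBundle ℝ F E]
  [ContMDiffVectorBundle ∞ F E (𝓡 m)] {D : CourantData m E} [ConnectedSpace S]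
  {V : ∀ x, Submodule ℝ (E x)} {div : (∀ x, E x) → M → ℝ}

namespace EquivariantStructure

variable {X : EquivariantStructure k S F D}

theorem mem_redSubbundle_iff {b : OrbitSpace S M} {v : E b.out} (hv : v ∈ X.perpFibre b.out)
    (hVX : X.IsAdmissible V) :
    (Submodule.Quotient.mk ⟨v, hv⟩ : X.RedFibre b) ∈ X.redSubbundle V b ↔
      ∃ w ∈ V b.out, v - w ∈ X.sFibre b.out := by
  constructor
  · rintro ⟨⟨w, hw⟩, hwV, h⟩
    refine ⟨w, hwV, (mk_eq_iff hv hw).1 ?_⟩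
    exact h.symm
  · rintro ⟨w, hw, h⟩
    exact ⟨⟨w, hVX.le_perp _ hw⟩, hw, ((mk_eq_iff hv (hVX.le_perp _ hw)).2 h).symm⟩

theorem isInvariantPerp_comb (hD : IsCourantAlgebroid F D) {ι : Type*} (s : Finset ι) (c : ι → ℝ)
    {e : ι → ∀ x, E x} (he : ∀ i, X.IsInvariantPerp (e i)) :
    X.IsInvariantPerp (∑ i ∈ s, c i • e i) := by
  classical
  induction s using Finset.induction_on with
  | empty => simpa using X.isInvariantPerp_zero hD
  | insert a s ha ih =>
    rw [Finset.sum_insert ha]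
    exact X.isInvariantPerp_add hD (X.isInvariantPerp_smul hD _ (he a)) ih

/-- Invariant sections of an admissible generalized pseudometric through a vector. -/
theorem exists_invariant_section_of_mem [ProperSMul S M] [IsCancelSMul S M]
    (hD : IsCourantAlgebroid F D)
    (hV : D.IsGeneralizedPseudometric V) (hVX : X.IsAdmissible V) {x : M} {v : E x} (hv : v ∈ V x) :
    ∃ p, X.IsInvariantPerp p ∧ (∀ x, p x ∈ V x) ∧ p x = v := by
  obtain ⟨a, ha, hai, rfl⟩ := X.exists_invariant_section hD x v
  obtain ⟨p, hp, hpV, hpa⟩ := exists_invariant_projection hD hV hVX ha hai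
  exact ⟨p, hp, hpV, eq_of_isSectionOf_pairing hV (hpV x) hv (hpa x)⟩

variable [ChartedSpace (EuclideanSpace ℝ (Fin q)) (OrbitSpace S M)]
  [IsManifold (𝓡 q) ∞ (OrbitSpace S M)]

/-- The invariant sections of `V` projecting to a given section of the reduction of `V`. -/
theorem exists_section_of_represents (hD : IsCourantAlgebroid F D)
    (hV : D.IsGeneralizedPseudometric V) (hVX : X.IsAdmissible V)
    {t : ∀ b : OrbitSpace S M, X.RedFibre b} {l : ∀ x, E x} (hl : X.Represents l t) :
    ∃ e, X.IsInvariantPerp e ∧ (∀ x, e x ∈ V x) ∧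
      ∀ x, t (proj S x) ∈ X.redSubbundle V (proj S x) → (l - e) x ∈ X.sFibre x := by
  obtain ⟨e, he, heV, hel⟩ := exists_invariant_projection hD hV hVX hl.1.smooth hl.1.invariant
  have hs := isInvariantPerp_sub hD hl.1 he
  refine ⟨e, he, heV, fun x hx => mem_sFibre_of_proj hD hs.smooth hs.invariant ?_ rfl⟩
  rw [hl.2, mem_redSubbundle_iff _ hVX] at hx
  obtain ⟨v, hv, hlv⟩ := hx
  -- Where the class of l comes from some v in V, the projection of l is v, since l - v lies in 𝔰_E
  -- and so is orthogonal to V.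
  have : e (proj S x).out = v := eq_of_isSectionOf_pairing hV (heV _) hv fun z hz => by
    have h1 := pairing_sFibre hlv (hVX.le_perp _ hz)
    rw [map_sub, LinearMap.sub_apply, sub_eq_zero] at h1
    rw [hel _ z hz, h1]
  rw [Pi.sub_apply, this]
  exact hlv

theorem pair_eq_reduction (hD : IsCourantAlgebroid F D)
    (hπ : IsSubmersion (𝓡 m) (𝓡 q) ∞ (proj S : M → OrbitSpace S M))
    {t t' : ∀ b : OrbitSpace S M, X.RedFibre b} {l l' e e' : ∀ x, E x} (hl : X.Represents l t)
    (hl' : X.Represents l' t') (he : X.IsInvariantPerp e) (he' : X.IsInvariantPerp e') {x : M}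
    (h : (l - e) (proj S x).out ∈ X.sFibre (proj S x).out)
    (h' : (l' - e') (proj S x).out ∈ X.sFibre (proj S x).out) :
    D.pair e e' x = (X.reduction hD hπ).pair t t' (proj S x) := by
  rw [hl.pair_eq hD hπ hl', ← X.apply_out_proj (hD.pair_smooth _ _ he.smooth he'.smooth)
    (X.deriv_χ_pair hD he.smooth he'.smooth he.invariant he'.invariant) x]
  exact (pairing_eq_of_sub_mem hD (he.mem _) (hl'.1.mem _) h h').symm

/-- A frame of the reduction of `V` comes from an invariant frame of `V`. -/
theorem exists_frame_of_reduction [ProperSMul S M] [IsCancelSMul S M] (hD : IsCourantAlgebroid F D)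
    (hπ : IsSubmersion (𝓡 m) (𝓡 q) ∞ (proj S : M → OrbitSpace S M))
    (hV : D.IsGeneralizedPseudometric V) (hVX : X.IsAdmissible V) {U : Set (OrbitSpace S M)} {n : ℕ}
    {t t' : Fin n → ∀ b : OrbitSpace S M, X.RedFibre b}
    (hF : (X.reduction hD hπ).IsFrame (X.redSubbundle V) U t t') :
    ∃ e e' : Fin n → ∀ x, E x, (∀ a, X.IsInvariantPerp (e a)) ∧ (∀ a, X.IsInvariantPerp (e' a)) ∧
      (∀ a, ∀ x, proj S x ∈ U → (X.lift (t a) - e a) x ∈ X.sFibre x) ∧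
      (∀ a, ∀ x, proj S x ∈ U → (X.lift (t' a) - e' a) x ∈ X.sFibre x) ∧
      D.IsFrame V (proj S ⁻¹' U) e e' := by
  have hl : ∀ a, X.Represents (X.lift (t a)) (t a) := fun a => represents_lift (hF.smooth a)
  have hl' : ∀ a, X.Represents (X.lift (t' a)) (t' a) := fun a => represents_lift (hF.smooth_dual a)
  choose e he heV hle using fun a => exists_section_of_represents hD hV hVX (hl a)
  choose e' he' heV' hle' using fun a => exists_section_of_represents hD hV hVX (hl' a)
  have hle2 : ∀ a, ∀ x, proj S x ∈ U → (X.lift (t a) - e a) x ∈ X.sFibre x := fun a x hx =>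
    hle a x (hF.mem hx a)
  have hle2' : ∀ a, ∀ x, proj S x ∈ U → (X.lift (t' a) - e' a) x ∈ X.sFibre x := fun a x hx =>
    hle' a x (hF.mem_dual _ hx a)
  have hout : ∀ x : M, proj S x ∈ U → proj S (proj S x).out ∈ U := fun x hx => by rwa [proj_out]
  have hpair : ∀ a b, ∀ x, proj S x ∈ U →
      D.pair (e a) (e b) x = (X.reduction hD hπ).pair (t a) (t b) (proj S x) := fun a b x hx =>
    pair_eq_reduction hD hπ (hl a) (hl b) (he a) (he b) (hle2 a _ (hout x hx)) (hle2 b _ (hout x hx))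
  have hdual : ∀ y, proj S y ∈ U → ∀ a b, D.pair (e' a) (e b) y = if a = b then 1 else 0 :=
    fun x hx a b => by
      rw [pair_eq_reduction hD hπ (hl' a) (hl b) (he' a) (he b) (hle2' a _ (hout x hx))
        (hle2 b _ (hout x hx)), hF.dual _ hx]
  refine ⟨e, e', he, he', hle2, hle2', hF.isOpen.preimage hπ.contMDiff.continuous,
    fun a => (he a).smooth, fun a => (he' a).smooth, fun y hy => ?_, fun y hy => ?_,
    fun y hy z hz a b => ?_, fun y hy a => heV' a y, hdual⟩
  · rw [Fintype.linearIndependent_iff]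
    intro c hc a
    have h1 := congrArg (D.pairing y (e' a y)) hc
    have h2 : ∀ b, D.pairing y (e' a y) (e b y) = if a = b then 1 else 0 := hdual y hy a
    simpa [h2] using h1
  · refine le_antisymm (Submodule.span_le.2 ?_) fun w hw => ?_
    · rintro _ ⟨a, rfl⟩
      exact heV a y
    -- The coefficients of w are found in the reduced fibre, which is modelled at another point of
    -- the orbit; extending w to an invariant section of V connects the two points.
    obtain ⟨p, hp, hpV, rfl⟩ := exists_invariant_section_of_mem hD hV hVX hw
    have h1 : (Submodule.Quotient.mk ⟨p (proj S y).out, hp.mem _⟩ : X.RedFibre (proj S y)) ∈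
        X.redSubbundle V (proj S y) :=
      (mem_redSubbundle_iff _ hVX).2 ⟨_, hpV _, by simp⟩
    rw [← hF.span _ hy, Submodule.mem_span_range_iff_exists_fun] at h1
    obtain ⟨c, hc⟩ := h1
    have hL := isInvariantPerp_comb hD Finset.univ c fun a => (hl a).1
    have h2 : (∑ a, c a • t a (proj S y)) = (Submodule.Quotient.mk
        ⟨(∑ a, c a • X.lift (t a)) (proj S y).out, hL.mem _⟩ : X.RedFibre (proj S y)) := by
      have h3 : (⟨(∑ a, c a • X.lift (t a)) (proj S y).out, hL.mem _⟩ :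
          X.perpFibre (proj S y).out) = ∑ a, c a • ⟨X.lift (t a) (proj S y).out, (hl a).1.mem _⟩ := by
        ext
        simp [Finset.sum_apply]
      rw [h3, ← Submodule.mkQ_apply, map_sum]
      simp only [map_smul, Submodule.mkQ_apply, (hl _).2]
    rw [h2, mk_eq_iff] at hc
    have hs := isInvariantPerp_sub hD hL hp
    have h4 : (∑ a, c a • X.lift (t a) - p) y ∈ X.sFibre y :=
      mem_sFibre_of_proj hD hs.smooth hs.invariant hc rfl
    -- The difference lies in V by construction and in 𝔰_E by invariance, and these two intersect
    -- trivially.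
    have h5 : p y - ∑ a, c a • e a y = 0 := by
      refine eq_zero_of_mem_sFibre hV hVX (Submodule.sub_mem _ (hpV y)
        (Submodule.sum_mem _ fun a _ => Submodule.smul_mem _ _ (heV a y))) ?_
      have h6 : p y - ∑ a, c a • e a y = ∑ a, c a • (X.lift (t a) - e a) y -
          (∑ a, c a • X.lift (t a) - p) y := by
        simp [Finset.sum_apply, smul_sub, Finset.sum_sub_distrib]
      rw [h6]
      exact Submodule.sub_mem _ (Submodule.sum_mem _ fun a _ =>
        Submodule.smul_mem _ _ (hle2 a y hy)) h4
    rw [sub_eq_zero.1 h5]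
    exact Submodule.sum_mem _ fun a _ => Submodule.smul_mem _ _ (Submodule.subset_span ⟨a, rfl⟩)
  · rw [hpair a b y hy, hpair a b z hz]
    exact hF.const _ hy _ hz a b

/-- The generalized scalar curvature of the reduction, in a frame. -/
theorem frameScalar_reduction_eq (hD : IsCourantAlgebroid F D) (hdiv : D.IsDivergence div)
    (hdivX : X.IsEquivariantDiv div)
    (hπ : IsSubmersion (𝓡 m) (𝓡 q) ∞ (proj S : M → OrbitSpace S M)) [ProperSMul S M]
    [IsCancelSMul S M]
    (hV : D.IsGeneralizedPseudometric V) (hVX : X.IsAdmissible V) {U : Set (OrbitSpace S M)} {n : ℕ}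
    {t t' : Fin n → ∀ b : OrbitSpace S M, X.RedFibre b}
    (hF : (X.reduction hD hπ).IsFrame (X.redSubbundle V) U t t') {x : M} (hx : proj S x ∈ U) :
    ∃ e e' : Fin n → ∀ x, E x, D.IsFrame V (proj S ⁻¹' U) e e' ∧
      (X.reduction hD hπ).frameScalar (X.redDiv div) t t' (proj S x) =
        D.frameScalar div e e' x := by
  obtain ⟨e, e', he, he', hle, hle', hFe⟩ := exists_frame_of_reduction hD hπ hV hVX hF
  refine ⟨e, e', hFe, ?_⟩
  have hout : (proj S x).out ∈ (proj S ⁻¹' U : Set M) := by rwa [Set.mem_preimage, proj_out]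
  rw [frameScalar_reduction hD hdiv hdivX hπ hF.smooth hF.smooth_dual,
    ← frameScalar_apply_out_proj hD hdiv hdivX he he' x]
  refine frameScalar_eq_of_sub_mem hD hdiv hdivX (fun a => X.isInvariantPerp_lift hD _)
    (fun a => X.isInvariantPerp_lift hD _) he he' (fun a => ?_) fun a => ?_
  · filter_upwards [hFe.isOpen.mem_nhds hout] with y hy using hle a y hy
  · filter_upwards [hFe.isOpen.mem_nhds hout] with y hy using hle' a y hy

end EquivariantStructure

end Reduction

/-! ### Bases of a subbundle near a point -/

section Frames

variable {m : ℕ} {M : Type*} [TopologicalSpace M] [T2Space M]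
  [ChartedSpace (EuclideanSpace ℝ (Fin m)) M] [IsManifold (𝓡 m) ∞ M]
  {E : M → Type*} [∀ x, AddCommGroup (E x)] [∀ x, Module ℝ (E x)] {D : CourantData m E}

/-- Sections of `V` which agree at `x` with a frame of `V` form a basis of `V` near `x`. -/
theorem CourantData.IsFrame.eventually_basis (hD : IsPreCourant D) {V : ∀ x, Submodule ℝ (E x)}
    {U : Set M} {n : ℕ} {f f' e : Fin n → ∀ x, E x} (hF : D.IsFrame V U f f') {x : M} (hx : x ∈ U)
    (he : ∀ i, D.IsSectionOf V (e i)) (hex : ∀ i, e i x = f i x) :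
    ∀ᶠ y in 𝓝 x, LinearIndependent ℝ (fun i => e i y) ∧
      Submodule.span ℝ (Set.range fun i => e i y) = V y := by
  have hP : ∀ i j, IsSmoothFun m (D.pair (f' i) (e j)) := fun i j =>
    hD.pair_smooth _ _ (hF.smooth_dual i) (he j).1
  have hPx : (Matrix.of fun i j => D.pair (f' i) (e j) x) = 1 := by
    ext i j
    have : D.pair (f' i) (e j) x = D.pair (f' i) (f j) x := by simp only [CourantData.pair, hex]
    rw [Matrix.of_apply, this, hF.dual x hx, Matrix.one_apply]
  have hdet : ∀ᶠ y in 𝓝 x, (Matrix.of fun i j => D.pair (f' i) (e j) y).det ≠ 0 :=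
    (contMDiffAt_det (fun i j => hP i j x)).continuousAt.eventually_ne (by rw [hPx]; simp)
  filter_upwards [hdet, hF.isOpen.mem_nhds hx] with y hy hyU
  have hli : LinearIndependent ℝ (fun i => e i y) := by
    rw [Fintype.linearIndependent_iff]
    intro c hc
    refine congrFun (Matrix.eq_zero_of_mulVec_eq_zero hy (v := c) ?_)
    funext i
    have h1 := congrArg (D.pairing y (f' i y)) hc
    simp only [map_sum, map_smul, smul_eq_mul, map_zero] at h1
    simp only [Matrix.mulVec, dotProduct, Matrix.of_apply, Pi.zero_apply]
    rw [← h1]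
    exact Finset.sum_congr rfl fun j _ => mul_comm _ _
  refine ⟨hli, ?_⟩
  have hfin : FiniteDimensional ℝ (V y) := by
    rw [← hF.span y hyU]
    exact FiniteDimensional.span_of_finite ℝ (Set.finite_range _)
  refine Submodule.eq_of_le_of_finrank_eq (Submodule.span_le.2 ?_) ?_
  · rintro _ ⟨i, rfl⟩
    exact (he i).2 y
  · rw [← hF.span y hyU, finrank_span_eq_card hli, finrank_span_eq_card (hF.linearIndependent y hyU)]

end Frames

/-! ### The reduced pseudometric -/

section Reduction

variable {k m q : ℕ} {S : Type*} [Group S] [TopologicalSpace S]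
  [ChartedSpace (EuclideanSpace ℝ (Fin k)) S] [LieGroup (𝓡 k) ∞ S]
  {M : Type*} [TopologicalSpace M] [T2Space M] [ChartedSpace (EuclideanSpace ℝ (Fin m)) M]
  [IsManifold (𝓡 m) ∞ M] [MulAction S M] [ContMDiffSMul (𝓡 k) (𝓡 m) ∞ S M]
  {F : Type*} [NormedAddCommGroup F] [NormedSpace ℝ F] [FiniteDimensional ℝ F]
  {E : M → Type*} [TopologicalSpace (TotalSpace F E)] [∀ x, AddCommGroup (E x)]
  [∀ x, Module ℝ (E x)] [∀ x, TopologicalSpace (E x)] [FiberBundle F E] [VectorBundle ℝ F E]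
  [ContMDiffVectorBundle ∞ F E (𝓡 m)] {D : CourantData m E} [ConnectedSpace S]
  {V : ∀ x, Submodule ℝ (E x)}
  [ChartedSpace (EuclideanSpace ℝ (Fin q)) (EquivariantStructure.OrbitSpace S M)]
  [IsManifold (𝓡 q) ∞ (EquivariantStructure.OrbitSpace S M)]

namespace EquivariantStructure

variable {X : EquivariantStructure k S F D}

/-- The reduction of an admissible generalized pseudometric is a generalized pseudometric. -/
theorem isGeneralizedPseudometric_redSubbundle [ProperSMul S M] [IsCancelSMul S M]
    (hD : IsCourantAlgebroid F D)
    (hπ : IsSubmersion (𝓡 m) (𝓡 q) ∞ (proj S : M → OrbitSpace S M))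
    (hV : D.IsGeneralizedPseudometric V) (hVX : X.IsAdmissible V) :
    (X.reduction hD hπ).IsGeneralizedPseudometric (X.redSubbundle V) where
  subbundle b := by
    obtain ⟨U, n, f, ε, η, hxU, hf⟩ :=
      exists_orthogonalFrame_of_pseudometric hD.isPreCourant hV b.out
    have hF := hf.isFrame hD.isPreCourant
    choose e he heV hex using fun i =>
      exists_invariant_section_of_mem (X := X) hD hV hVX (hF.mem hxU i)
    obtain ⟨W, hW, hWo, hbW⟩ := eventually_nhds_iff.1
      (hF.eventually_basis hD.isPreCourant hxU (fun i => ⟨(he i).smooth, heV i⟩) hex)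
    -- Invariant sections forming a basis of V on a neighbourhood of one point of the orbit give a
    -- reduced basis on the image of that neighbourhood, which is open.
    have hopen : IsOpenMap (proj S : M → OrbitSpace S M) := isOpenMap_quotient_mk'_mul
    set t : Fin n → ∀ b : OrbitSpace S M, X.RedFibre b := fun i b =>
      Submodule.Quotient.mk ⟨e i b.out, (he i).mem _⟩ with ht
    refine ⟨proj S '' W, hopen _ hWo, ⟨b.out, hbW, proj_out b⟩, n, t,
      fun i => ⟨e i, he i, fun _ => rfl⟩, ?_⟩
    rintro _ ⟨y, hy, rfl⟩
    have hcomb := fun c : Fin n → ℝ => isInvariantPerp_comb hD Finset.univ c he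
    have hcombV : ∀ (c : Fin n → ℝ) x, (∑ i, c i • e i) x ∈ V x := fun c x => by
      rw [Finset.sum_apply]
      exact Submodule.sum_mem _ fun i _ => Submodule.smul_mem _ _ (heV i x)
    have hsum : ∀ c : Fin n → ℝ, ∑ i, c i • t i (proj S y) =
        (Submodule.Quotient.mk ⟨(∑ i, c i • e i) (proj S y).out, (hcomb c).mem _⟩ :
          X.RedFibre (proj S y)) := by
      intro c
      have h3 : (⟨(∑ i, c i • e i) (proj S y).out, (hcomb c).mem _⟩ :
          X.perpFibre (proj S y).out) = ∑ i, c i • ⟨e i (proj S y).out, (he i).mem _⟩ := by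
        ext
        simp [Finset.sum_apply]
      rw [h3, ← Submodule.mkQ_apply, map_sum]
      simp only [map_smul, Submodule.mkQ_apply, ht]
    refine ⟨?_, le_antisymm (Submodule.span_le.2 ?_) fun v hv => ?_⟩
    · rw [Fintype.linearIndependent_iff]
      intro c hc
      rw [hsum, Submodule.Quotient.mk_eq_zero] at hc
      have h1 : (∑ i, c i • e i) y ∈ X.sFibre y :=
        mem_sFibre_of_proj hD (hcomb c).smooth (hcomb c).invariant hc rfl
      have h2 := eq_zero_of_mem_sFibre hV hVX (hcombV c y) h1
      refine Fintype.linearIndependent_iff.1 (hW y hy).1 c ?_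
      simpa [Finset.sum_apply] using h2
    · rintro _ ⟨i, rfl⟩
      exact (mem_redSubbundle_iff _ hVX).2 ⟨_, heV i _, by simp⟩
    · obtain ⟨⟨w, hw⟩, hwV, rfl⟩ := hv
      obtain ⟨p, hp, hpV, rfl⟩ := exists_invariant_section_of_mem hD hV hVX hwV
      have h1 := hpV y
      rw [← (hW y hy).2, Submodule.mem_span_range_iff_exists_fun] at h1
      obtain ⟨c, hc⟩ := h1
      have hs := isInvariantPerp_sub hD (hcomb c) hp
      have h2 : (∑ i, c i • e i - p) y = 0 := by
        rw [Pi.sub_apply, Finset.sum_apply, ← hc]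
        simp
      -- The linear relation holds at y, whereas the reduced fibre is modelled at another point of
      -- its orbit; an invariant section that vanishes at y vanishes there too.
      obtain ⟨g, hg⟩ := exists_smul_out (S := S) y
      have h3 := apply_smul_eq_zero hD hs.smooth hs.invariant h2 g
      rw [hg, Pi.sub_apply] at h3
      refine (Submodule.mem_span_range_iff_exists_fun ℝ).2 ⟨c, ?_⟩
      rw [hsum]
      refine (mk_eq_iff _ _).2 ?_
      rw [h3]
      exact Submodule.zero_mem _
  nondegenerate b v hv h := by
    obtain ⟨⟨w, hw⟩, hwV, rfl⟩ := hv
    have : w = 0 := hV.nondegenerate _ w hwV fun z hz =>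
      h (Submodule.Quotient.mk ⟨z, hVX.le_perp _ hz⟩)
        ((mem_redSubbundle_iff _ hVX).2 ⟨z, hz, by simp⟩)
    subst this
    exact map_zero _

end EquivariantStructure

end Reduction

/-! ### Well-definedness and the main theorem -/

theorem CourantData.IsScalarCurvatureAt.scalarCurvature_eq {m : ℕ} {B : Type*} [TopologicalSpace B]
    [ChartedSpace (EuclideanSpace ℝ (Fin m)) B] [IsManifold (𝓡 m) 1 B] {E : B → Type*}
    [∀ b, AddCommGroup (E b)] [∀ b, Module ℝ (E b)] {D : CourantData m E}
    {V : ∀ b, Submodule ℝ (E b)} {div : (∀ b, E b) → B → ℝ} {x : B} {r : ℝ}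
    (h : D.IsScalarCurvatureAt V div x r) : D.scalarCurvature V div x = r := by
  have hex : ∃ r, D.IsScalarCurvatureAt V div x r := ⟨r, h⟩
  unfold CourantData.scalarCurvature
  rw [dif_pos hex]
  obtain ⟨σ, U, n, e, e', p, hc⟩ := h.1
  exact (hex.choose_spec.2 σ U n e e' p hc).symm.trans (h.2 σ U n e e' p hc)

/-- Generalized scalar curvature exists as soon as there are frames with the same `frameScalar`. -/
theorem isScalarCurvatureAt_of_frameScalar {m : ℕ} {B : Type*} [TopologicalSpace B] [T2Space B]
    [SigmaCompactSpace B] [ChartedSpace (EuclideanSpace ℝ (Fin m)) B] [IsManifold (𝓡 m) ∞ B]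
    {E : B → Type*} [∀ b, AddCommGroup (E b)] [∀ b, Module ℝ (E b)] {D : CourantData m E}
    (hD : IsPreCourant D) {V : ∀ b, Submodule ℝ (E b)} (hV : D.IsGeneralizedPseudometric V)
    {div : (∀ b, E b) → B → ℝ} (hdiv : D.IsDivergence div) {x : B} {r : ℝ}
    (h : ∀ (U : Set B) (n : ℕ) (e e' : Fin n → ∀ b, E b), D.IsFrame V U e e' → x ∈ U →
      D.frameScalar div e e' x = r) : D.IsScalarCurvatureAt V div x r := by
  refine ⟨?_, fun σ U n e e' p hc => ?_⟩
  · obtain ⟨U, n, e, ε, η, hx, he⟩ := exists_orthogonalFrame_of_pseudometric hD hV x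
    obtain ⟨σ, p, hc⟩ := hD.exists_isChoice hdiv (he.isFrame hD) hx
    exact ⟨σ, U, n, _, _, p, hc⟩
  · rw [CourantData.IsChoice.scalarValue_eq hD hdiv hc]
    exact h U n e e' hc.isFrame hc.mem

end GenScalar

theorem mainTheorem5 {k m q : ℕ}
    -- a connected Lie group `S`
    {S : Type*} [Group S] [TopologicalSpace S] [ChartedSpace (EuclideanSpace ℝ (Fin k)) S]
    [LieGroup (𝓡 k) ∞ S] [ConnectedSpace S]
    -- a smooth manifold `M` with a smooth, free and proper action of `S`
    {M : Type*} [TopologicalSpace M] [T2Space M] [SecondCountableTopology M]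
    [ChartedSpace (EuclideanSpace ℝ (Fin m)) M] [IsManifold (𝓡 m) ∞ M]
    [MulAction S M] [ContMDiffSMul (𝓡 k) (𝓡 m) ∞ S M] [IsCancelSMul S M] [ProperSMul S M]
    -- the smooth structure on the orbit space `M/S`, for which `π : M → M/S` is a submersion
    [ChartedSpace (EuclideanSpace ℝ (Fin q)) (GenScalar.EquivariantStructure.OrbitSpace S M)]
    [IsManifold (𝓡 q) ∞ (GenScalar.EquivariantStructure.OrbitSpace S M)]
    (hπ : IsSubmersion (𝓡 m) (𝓡 q) ∞
      (GenScalar.EquivariantStructure.proj S :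
        M → GenScalar.EquivariantStructure.OrbitSpace S M))
    -- an `S`-equivariant Courant algebroid `E → M`
    {F : Type*} [NormedAddCommGroup F] [NormedSpace ℝ F] [FiniteDimensional ℝ F]
    {E : M → Type*} [TopologicalSpace (TotalSpace F E)] [∀ x, AddCommGroup (E x)]
    [∀ x, Module ℝ (E x)] [∀ x, TopologicalSpace (E x)] [FiberBundle F E] [VectorBundle ℝ F E]
    [ContMDiffVectorBundle ∞ F E (𝓡 m)]
    (D : GenScalar.CourantData m E) (hD : GenScalar.IsCourantAlgebroid F D)
    (X : GenScalar.EquivariantStructure k S F D)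
    -- an admissible generalized pseudometric and an equivariant divergence
    (V : ∀ x, Submodule ℝ (E x)) (hV : D.IsGeneralizedPseudometric V) (hVX : X.IsAdmissible V)
    (div : (∀ x, E x) → M → ℝ) (hdiv : D.IsDivergence div) (hdivX : X.IsEquivariantDiv div) :
    (∀ x, D.IsScalarCurvatureAt V div x (D.scalarCurvature V div x)) ∧
    (∀ b, (X.reduction hD hπ).IsScalarCurvatureAt (X.redSubbundle V) (X.redDiv div) b
      ((X.reduction hD hπ).scalarCurvature (X.redSubbundle V) (X.redDiv div) b)) ∧
    ∀ x, D.scalarCurvature V div x =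
      (X.reduction hD hπ).scalarCurvature (X.redSubbundle V) (X.redDiv div)
        (GenScalar.EquivariantStructure.proj S x) := by
  have hGr : IsTopologicalGroup S := topologicalGroup_of_lieGroup (𝓡 k) ∞
  have hlc : LocallyCompactSpace M := ChartedSpace.locallyCompactSpace (EuclideanSpace ℝ (Fin m)) M
  -- M/S is Hausdorff because the action is proper. Together with second countability and local
  -- compactness this yields partitions of unity, hence a positive half-density on M/S.
  have hT2 : T2Space (GenScalar.EquivariantStructure.OrbitSpace S M) :=
    t2Space_quotient_mulAction_of_properSMul
  have hlc' : LocallyCompactSpace (GenScalar.EquivariantStructure.OrbitSpace S M) :=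
    ChartedSpace.locallyCompactSpace (EuclideanSpace ℝ (Fin q)) _
  have hsc : SecondCountableTopology (GenScalar.EquivariantStructure.OrbitSpace S M) :=
    ContinuousConstSMul.secondCountableTopology
  have hR := GenScalar.EquivariantStructure.isPreCourant_reduction (X := X) hD hπ
  have hRV := GenScalar.EquivariantStructure.isGeneralizedPseudometric_redSubbundle hD hπ hV hVX
  have hRdiv := GenScalar.EquivariantStructure.isDivergence_redDiv hD hdiv hdivX hπ
  have h1 : ∀ x, ∃ r, D.IsScalarCurvatureAt V div x r := fun x => by
    obtain ⟨U, n, e, ε, η, hx, he⟩ :=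
      GenScalar.exists_orthogonalFrame_of_pseudometric hD.isPreCourant hV x
    exact ⟨_, GenScalar.isScalarCurvatureAt_of_frameScalar hD.isPreCourant hV hdiv
      fun U' n' f f' hf hx' => hD.frameScalar_eq hdiv hV hf (he.isFrame hD.isPreCourant) hx' hx⟩
  have h2 : ∀ x, D.IsScalarCurvatureAt V div x (D.scalarCurvature V div x) := fun x => by
    obtain ⟨r, hr⟩ := h1 x
    rwa [hr.scalarCurvature_eq]
  -- Any local basis of the reduced pseudometric lifts to one of V with the same `frameScalar`, and
  -- that value is the curvature on M at x. So well-definedness on M/S and the equality are obtained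
  -- together.
  have h3 : ∀ x, (X.reduction hD hπ).IsScalarCurvatureAt (X.redSubbundle V) (X.redDiv div)
      (GenScalar.EquivariantStructure.proj S x) (D.scalarCurvature V div x) := fun x =>
    GenScalar.isScalarCurvatureAt_of_frameScalar hR hRV hRdiv fun U n t t' hF hx => by
      obtain ⟨e, e', hFe, h⟩ := GenScalar.EquivariantStructure.frameScalar_reduction_eq
        hD hdiv hdivX hπ hV hVX hF hx
      rw [h]
      obtain ⟨σ, p, hc⟩ := hD.isPreCourant.exists_isChoice hdiv hFe hx
      rw [← GenScalar.CourantData.IsChoice.scalarValue_eq hD.isPreCourant hdiv hc]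
      exact (h2 x).2 _ _ _ _ _ _ hc
  refine ⟨h2, fun b => ?_, fun x => (h3 x).scalarCurvature_eq.symm⟩
  obtain ⟨x, rfl⟩ := GenScalar.EquivariantStructure.proj_surjective b
  rw [(h3 x).scalarCurvature_eq]
  exact h3 x
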